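/- For real $X,Y\ge 1$ let $$S(X,Y)=\sum_{\substack{1\le m\le X\\ m\ \mathrm{odd}}}\ \sum_{\substack{1\le n\le Y\\ n\ \mathrm{odd}}}\left(\frac mn\right),$$ where $\left(\frac mn\right)$ is the Jacobi symbol. For real $\alpha\ge 0$ define $$C(\alpha)=\sqrt{\alpha}+\frac1{2\pi}\sum_{k=1}^{\infty}\frac1{k^2}\int_0^{\alpha}\sqrt y\left(1-\cos\left(\frac{2\pi k^2}{y}\right)+\sin\left(\frac{2\pi k^2}{y}\right)\right)dy,$$ where the integrals exist and the series converges. Then, uniformly for all large real $X$ and $Y$, $$S(X,Y)=\frac{2}{\pi^2}\,C\left(\frac YX\right)X^{3/2}+O\left(\left(XY^{7/16}+YX^{7/16}\right)\log(XY)\right);$$ that is, there are absolute constants $K$ and $Z$ such that for all real $X,Y\ge Z$ the difference of $S(X,Y)$ and $\frac{2}{\pi^2}C(Y/X)X^{3/2}$ is at most $K\left(XY^{7/16}+YX^{7/16}\right)\log(XY)$ in absolute value. Moreover, for every real $\alpha>0$, $$C(\alpha)=\alpha+\alpha^{3/2}\,\frac2\pi\sum_{k=1}^{\infty}\frac1{k^2}\int_0^{1/\alpha}\sqrt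 y\,\sin\left(\frac{\pi k^2}{2y}\right)dy,$$ where again the integrals exist and the series converges. -/

import Mathlib

open scoped NumberTheorySymbols

noncomputable section

/-- `S(X, Y)`: the sum of the Jacobi symbols `(m / n)` over the odd positive integers
`m ≤ X` and `n ≤ Y`. -/
def jacobiDoubleSum (X Y : ℝ) : ℝ :=
  ∑ m ∈ (Finset.Icc 1 ⌊X⌋₊).filter (fun m : ℕ => Odd m),
    ∑ n ∈ (Finset.Icc 1 ⌊Y⌋₊).filter (fun n : ℕ => Odd n), (J((m : ℤ) | n) : ℝ)

/-- The integrand `√y (1 - cos(2πk²/y) + sin(2πk²/y))`. -/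
def transitionIntegrand (k : ℕ) (y : ℝ) : ℝ :=
  √y * (1 - Real.cos (2 * Real.pi * (k : ℝ) ^ 2 / y)
    + Real.sin (2 * Real.pi * (k : ℝ) ^ 2 / y))

/-- The `k`-th term `k⁻² ∫₀^α √y (1 - cos(2πk²/y) + sin(2πk²/y)) dy`. -/
def transitionTerm (α : ℝ) (k : ℕ) : ℝ :=
  1 / (k : ℝ) ^ 2 * ∫ y in (0 : ℝ)..α, transitionIntegrand k y

/-- `C(α) = √α + (1/2π) ∑_{k ≥ 1} k⁻² ∫₀^α √y (1 - cos(2πk²/y) + sin(2πk²/y)) dy`. -/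
def transitionC (α : ℝ) : ℝ :=
  √α + 1 / (2 * Real.pi) * ∑' k : ℕ, transitionTerm α (k + 1)

/-- The integrand `√y sin(πk²/(2y))`. -/
def dualIntegrand (k : ℕ) (y : ℝ) : ℝ :=
  √y * Real.sin (Real.pi * (k : ℝ) ^ 2 / (2 * y))

/-- The `k`-th term `k⁻² ∫₀^{1/α} √y sin(πk²/(2y)) dy`. -/
def dualTerm (α : ℝ) (k : ℕ) : ℝ :=
  1 / (k : ℝ) ^ 2 * ∫ y in (0 : ℝ)..(1 / α), dualIntegrand k y

end

open Complex in
theorem summable_cexp_neg_sq {w : ℂ} (hw : 0 < w.re) :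
    Summable fun n : ℤ => cexp (-Real.pi * w * n ^ 2) := by
  refine ((summable_jacobiTheta₂_term_iff 0 (I * w)).mpr (by simpa using hw)).congr fun n => ?_
  rw [jacobiTheta₂_term]
  congr 1
  linear_combination (Real.pi * (n : ℂ) ^ 2 * w) * I_sq

open Complex Filter Topology in
theorem tendsto_tsum_exp_neg_quadratic_one {ι : Type*} {l : Filter ι} [l.IsCountablyGenerated]
    {a : ι → ℂ} (ha : Tendsto (fun i => (a i).re) l atTop) (b : ℝ) :
    Tendsto (fun i => ∑' n : ℤ, cexp (-Real.pi * a i * n ^ 2 + 2 * Real.pi * (-I * b) * n)) l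
      (𝓝 1) := by
  have hnorm : ∀ i (n : ℤ), ‖cexp (-Real.pi * a i * n ^ 2 + 2 * Real.pi * (-I * b) * n)‖
      = Real.exp (-Real.pi * (a i).re * (n : ℝ) ^ 2) := by
    intro i n
    rw [Complex.norm_exp]
    congr 1
    have : (-Real.pi * a i * (n : ℂ) ^ 2 + 2 * Real.pi * (-I * b) * n)
      = ((-Real.pi * (n : ℝ) ^ 2 : ℝ) : ℂ) * a i + ((-2 * Real.pi * b * n : ℝ) : ℂ) * I := by
      push_cast; ring
    rw [this]
    simp only [add_re, mul_re, ofReal_re, ofReal_im, I_re, I_im]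
    ring
  have hs : Summable (fun n : ℤ => Real.exp (-Real.pi * (n : ℝ) ^ 2)) := by
    refine (summable_cexp_neg_sq (w := 1) (by simp)).norm.congr fun n => ?_
    rw [Complex.norm_exp]
    congr 1
    have : (-Real.pi * (1 : ℂ) * (n : ℂ) ^ 2) = ((-Real.pi * (n : ℝ) ^ 2 : ℝ) : ℂ) := by
      push_cast; ring
    rw [this, ofReal_re]
  have key : Tendsto (fun i => ∑' n : ℤ,
      cexp (-Real.pi * a i * n ^ 2 + 2 * Real.pi * (-I * b) * n)) l
      (𝓝 (∑' n : ℤ, if n = 0 then (1 : ℂ) else 0)) := by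
    refine tendsto_tsum_of_dominated_convergence hs (fun n => ?_) ?_
    · rcases eq_or_ne n 0 with rfl | hn
      · simpa using tendsto_const_nhds
      · simp only [hn, if_false]
        rw [tendsto_zero_iff_norm_tendsto_zero]
        simp only [hnorm]
        refine Real.tendsto_exp_atBot.comp ?_
        have hpos : 0 < Real.pi * (n : ℝ) ^ 2 := by positivity
        have := (ha.const_mul_atTop hpos)
        refine (tendsto_neg_atTop_atBot.comp this).congr fun i => ?_
        simp only [Function.comp]; ring
    · filter_upwards [ha.eventually_ge_atTop 1] with i hi n
      rw [hnorm]
      refine Real.exp_le_exp.mpr ?_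
      have hpos : 0 ≤ Real.pi * (n : ℝ) ^ 2 := by positivity
      nlinarith
  simpa using key

open Complex in
theorem tsum_periodic_mul_exp_neg_sq {q : ℕ} [NeZero q] {c : ℤ → ℂ}
    (hc : ∀ k, c (k + q) = c k) {w : ℂ} (hw : 0 < w.re) :
    ∑' k : ℤ, c k * cexp (-Real.pi * w * k ^ 2) =
      (1 / (q ^ 2 * w)) ^ (1 / 2 : ℂ) * ∑ r ∈ Finset.range q, c r *
        ∑' n : ℤ, cexp (-Real.pi * (1 / (q ^ 2 * w)) * n ^ 2
          + 2 * Real.pi * (-I * ((r / q : ℝ) : ℂ)) * n) := by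
  have hq : (q : ℂ) ≠ 0 := Nat.cast_ne_zero.mpr (NeZero.ne q)
  have hw0 : w ≠ 0 := by rintro rfl; simp at hw
  have hcm : ∀ (k j : ℤ), c (k + q * j) = c k := by
    intro k j
    have hp : Function.Periodic c (q : ℤ) := hc
    rw [mul_comm]
    exact hp.int_mul j k
  have hnorm : ∀ k : ℤ, ‖cexp (-Real.pi * w * k ^ 2)‖ = Real.exp (-Real.pi * w.re * (k : ℝ) ^ 2) := by
    intro k
    rw [Complex.norm_exp]
    congr 1
    have : (-Real.pi * w * (k : ℂ) ^ 2) = ((-Real.pi * (k : ℝ) ^ 2 : ℝ) : ℂ) * w := by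
      push_cast; ring
    rw [this, re_ofReal_mul]; ring
  have hs0 := summable_cexp_neg_sq hw
  obtain ⟨B, hB⟩ : ∃ B, ∀ k, ‖c k‖ ≤ B := by
    refine ⟨∑ r ∈ Finset.range q, ‖c r‖, fun k => ?_⟩
    have h1 : c k = c ((k % q).toNat : ℤ) := by
      rw [Int.toNat_of_nonneg (Int.emod_nonneg _ (by exact_mod_cast NeZero.ne q))]
      conv_lhs => rw [← Int.emod_add_mul_ediv k q]
      exact hcm _ _
    rw [h1]
    refine Finset.single_le_sum (f := fun r : ℕ => ‖c r‖) (fun _ _ => norm_nonneg _) ?_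
    have h2 := Int.emod_lt_of_pos k (b := q) (by exact_mod_cast NeZero.pos q)
    have h3 := Int.emod_nonneg k (b := q) (by exact_mod_cast NeZero.ne q)
    rw [Finset.mem_range]; omega
  have hs : Summable fun k : ℤ => c k * cexp (-Real.pi * w * k ^ 2) := by
    refine Summable.of_norm_bounded (hs0.norm.mul_left B) fun k => ?_
    rw [norm_mul]
    exact mul_le_mul_of_nonneg_right (hB k) (norm_nonneg _)
  have hs' := (Int.divModEquiv q).symm.summable_iff.mpr hs
  rw [← (Int.divModEquiv q).symm.tsum_eq, ← (Equiv.prodComm _ _).tsum_eq]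
  have hs'' := (Equiv.prodComm _ _).summable_iff.mpr hs'
  refine (Summable.tsum_prod hs'').trans ?_
  rw [tsum_fintype, Finset.sum_range, Finset.mul_sum]
  refine Finset.sum_congr rfl fun r _ => ?_
  have ha : 0 < (1 / ((q : ℂ) ^ 2 * w)).re := by
    have h1 : ((q : ℂ) ^ 2 * w) = ((q ^ 2 : ℝ) : ℂ) * w := by push_cast; ring
    have hqr : (0 : ℝ) < q := by exact_mod_cast NeZero.pos q
    rw [one_div, inv_re, h1, re_ofReal_mul]
    have : 0 < normSq (((q ^ 2 : ℝ) : ℂ) * w) := by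
      rw [normSq_pos, ← h1]; exact mul_ne_zero (pow_ne_zero _ hq) hw0
    positivity
  have hne : (1 / ((q : ℂ) ^ 2 * w)) ≠ 0 := by
    intro h; rw [h] at ha; simp at ha
  have hcp : (1 / ((q : ℂ) ^ 2 * w)) ^ (1 / 2 : ℂ) ≠ 0 := by
    rw [Ne, Complex.cpow_eq_zero_iff]; tauto
  rw [Complex.tsum_exp_neg_quadratic ha, ← mul_assoc, ← mul_assoc, mul_comm _ (c _),
    mul_assoc (c _), mul_one_div_cancel hcp, mul_one, ← tsum_mul_left]
  refine tsum_congr fun n => ?_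
  simp only [Function.comp, Equiv.prodComm_apply, Prod.swap, Int.divModEquiv_symm_apply]
  rw [add_comm, mul_comm, mul_comm (n : ℤ), hcm, mul_comm]
  congr 2
  push_cast
  field_simp
  linear_combination (-(2 * q * n * r) - (r : ℂ) ^ 2 * (1 - I ^ 2)) * I_sq

open Complex Filter Topology in
theorem tendsto_periodic_theta {q : ℕ} [NeZero q] {c : ℤ → ℂ} (hc : ∀ k, c (k + q) = c k)
    {ι : Type*} {l : Filter ι} [l.IsCountablyGenerated] {w : ι → ℂ} (hw : ∀ᶠ i in l, 0 < (w i).re)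
    (ha : Tendsto (fun i => (1 / ((q : ℂ) ^ 2 * w i)).re) l atTop) {ε : ι → ℝ} (hε : ∀ i, 0 ≤ ε i)
    {A : ℂ} (hA : Tendsto (fun i => (ε i : ℂ) * (1 / ((q : ℂ) ^ 2 * w i))) l (𝓝 A))
    (hA0 : A ∈ slitPlane) :
    Tendsto (fun i => (ε i : ℂ) ^ (1 / 2 : ℂ) * ∑' k : ℤ, c k * cexp (-Real.pi * w i * k ^ 2)) l
      (𝓝 (A ^ (1 / 2 : ℂ) * ∑ r ∈ Finset.range q, c r)) := by
  have h1 : Tendsto (fun i => ((ε i : ℂ) * (1 / ((q : ℂ) ^ 2 * w i))) ^ (1 / 2 : ℂ)) l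
      (𝓝 (A ^ (1 / 2 : ℂ))) := hA.cpow tendsto_const_nhds hA0
  have h2 : Tendsto (fun i => ∑ r ∈ Finset.range q, c r *
        ∑' n : ℤ, cexp (-Real.pi * (1 / (q ^ 2 * w i)) * n ^ 2
          + 2 * Real.pi * (-I * ((r / q : ℝ) : ℂ)) * n)) l (𝓝 (∑ r ∈ Finset.range q, c r * 1)) :=
    tendsto_finsetSum _ fun r _ =>
      (tendsto_tsum_exp_neg_quadratic_one ha (r / q : ℝ)).const_mul (c r)
  simp only [mul_one] at h2
  refine (h1.mul h2).congr' ?_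
  filter_upwards [hw, ha.eventually_gt_atTop 0] with i hi hi2
  rw [tsum_periodic_mul_exp_neg_sq hc hi, ← mul_assoc]
  congr 1
  rcases eq_or_lt_of_le (hε i) with h0 | h0
  · rw [← h0]; simp
  · have hne : (1 / ((q : ℂ) ^ 2 * w i)) ≠ 0 := by
      intro h; rw [h] at hi2; simp at hi2
    have hεne : (ε i : ℂ) ≠ 0 := ofReal_ne_zero.mpr h0.ne'
    rw [cpow_def_of_ne_zero (mul_ne_zero hεne hne), cpow_def_of_ne_zero hεne,
      cpow_def_of_ne_zero hne, ← Complex.exp_add, Complex.log_ofReal_mul h0 hne,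
      Complex.ofReal_log h0.le, add_mul]

open Complex Filter Topology in
theorem sum_exp_sq_div {n : ℕ} (hn : Odd n) :
    ∑ x ∈ Finset.range n, cexp (2 * Real.pi * I * (x : ℂ) ^ 2 / n) =
      (Real.sqrt n : ℂ) * ((1 + (-I) ^ n) / (1 - I)) := by
  have hn0 : 0 < n := hn.pos
  have : NeZero n := ⟨hn0.ne'⟩
  have hnC : (n : ℂ) ≠ 0 := by exact_mod_cast hn0.ne'
  have hnR : (0 : ℝ) < n := by exact_mod_cast hn0
  have hI : (1 - I : ℂ) ≠ 0 := by
    intro h; have := congrArg re h; simp at this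
  set l : Filter ℝ := 𝓝[>] (0 : ℝ)
  set c1 : ℤ → ℂ := fun k => cexp (2 * Real.pi * I * (k : ℂ) ^ 2 / n) with hc1
  set c2 : ℤ → ℂ := fun k => cexp (-(Real.pi * I * n / 2 * (k : ℂ) ^ 2)) with hc2
  have hp1 : ∀ k, c1 (k + n) = c1 k := by
    intro k
    simp only [hc1]
    rw [Complex.exp_eq_exp_iff_exists_int]
    refine ⟨2 * k + n, ?_⟩
    push_cast; field_simp; ring
  have hp2 : ∀ k, c2 (k + (2 : ℕ)) = c2 k := by
    intro k
    simp only [hc2]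
    rw [Complex.exp_eq_exp_iff_exists_int]
    refine ⟨-n * (k + 1), ?_⟩
    push_cast; ring
  have hz : ∀ ε : ℝ, 0 < ε → ((ε : ℂ) - 2 * I / n) ≠ 0 := by
    intro ε h h0; have := congrArg re h0; simp [div_natCast_re] at this; exact h.ne' this
  set A : ℂ := ((1 / (n : ℝ) ^ 2 : ℝ) : ℂ) with hAdef
  have hA0 : A ∈ slitPlane := by
    rw [hAdef, ofReal_mem_slitPlane]; positivity
  have hev : ∀ᶠ ε : ℝ in l, 0 < ε := self_mem_nhdsWithin
  have hinv : Tendsto (fun ε : ℝ => 1 / (n : ℝ) ^ 2 * ε⁻¹) l atTop :=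
    tendsto_inv_nhdsGT_zero.const_mul_atTop (by positivity)
  have hcont : Tendsto (fun ε : ℝ => ((ε : ℂ) - 2 * I / n)) l (𝓝 (-(2 * I / n))) := by
    have : Tendsto (fun ε : ℝ => ((ε : ℂ) - 2 * I / n)) (𝓝 0) (𝓝 (((0 : ℝ) : ℂ) - 2 * I / n)) :=
      (Continuous.tendsto (by fun_prop) 0)
    simpa using this.mono_left nhdsWithin_le_nhds
  -- the two expansions of the theta function near the cusp
  have T1 := tendsto_periodic_theta (l := l) hp1 (w := fun ε : ℝ => (ε : ℂ))
    (ε := fun ε => max ε 0) (A := A)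
    (by filter_upwards [hev] with ε h using by simpa using h)
    (by
      refine hinv.congr' ?_
      filter_upwards [hev] with ε h
      have : (1 / ((n : ℂ) ^ 2 * (ε : ℂ))) = ((1 / (n : ℝ) ^ 2 * ε⁻¹ : ℝ) : ℂ) := by
        push_cast; field_simp
      rw [this, ofReal_re])
    (fun _ => le_max_right _ _)
    (by
      refine tendsto_const_nhds.congr' ?_
      filter_upwards [hev] with ε h
      have h' : (ε : ℂ) ≠ 0 := ofReal_ne_zero.mpr h.ne'
      rw [max_eq_left h.le, hAdef]
      push_cast; field_simp) hA0
  set w2 : ℝ → ℂ := fun ε => (-(I * n * ε / 2)) / ((ε : ℂ) - 2 * I / n) with hw2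
  have hw2' : ∀ ε : ℝ, 0 < ε →
      (1 / (((2 : ℕ) : ℂ) ^ 2 * w2 ε)) = ((1 / (n : ℝ) ^ 2 * ε⁻¹ : ℝ) : ℂ) + ((1 / (2 * n) : ℝ) : ℂ) * I := by
    intro ε h
    have h' : (ε : ℂ) ≠ 0 := ofReal_ne_zero.mpr h.ne'
    have hzz := hz ε h
    have hzz' : (ε : ℂ) * n - 2 * I ≠ 0 := by
      intro h0; apply hzz; field_simp; linear_combination h0
    simp only [hw2]
    push_cast
    rw [one_div, mul_div_assoc', inv_div, div_eq_iff (by simp [h', hnC])]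
    field_simp
    linear_combination (ε * n : ℂ) * I_sq
  have T2 := tendsto_periodic_theta (l := l) hp2 (w := w2)
    (ε := fun ε => max ε 0) (A := A)
    (by
      filter_upwards [hev] with ε h
      have h1 := hw2' ε h
      have h2 : w2 ε = (4 * ((((1 / (n : ℝ) ^ 2 * ε⁻¹ : ℝ) : ℂ) + ((1 / (2 * n) : ℝ) : ℂ) * I)))⁻¹ := by
        rw [← h1]; push_cast; rw [one_div, mul_inv, mul_inv]; norm_num; ring
      rw [h2, inv_re]
      refine div_pos ?_ (normSq_pos.mpr ?_)
      · simp only [mul_re, add_re, ofReal_re, ofReal_im, I_re, I_im]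
        have : 0 < 1 / (n : ℝ) ^ 2 * ε⁻¹ := by positivity
        norm_num; positivity
      · rw [← h1]
        have h' : (ε : ℂ) ≠ 0 := ofReal_ne_zero.mpr h.ne'
        simp [hw2, h', hnC, hz ε h])
    (by
      refine hinv.congr' ?_
      filter_upwards [hev] with ε h
      rw [hw2' ε h]
      simp only [add_re, ofReal_re, mul_re, ofReal_im, I_re]
      ring)
    (fun _ => le_max_right _ _)
    (by
      have : Tendsto (fun ε : ℝ => A + (ε : ℂ) * (((1 / (2 * n) : ℝ) : ℂ) * I)) l
          (𝓝 (A + ((0 : ℝ) : ℂ) * (((1 / (2 * n) : ℝ) : ℂ) * I))) :=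
        (Continuous.tendsto (by fun_prop) 0).mono_left nhdsWithin_le_nhds
      simp only [ofReal_zero, zero_mul, add_zero] at this
      refine this.congr' ?_
      filter_upwards [hev] with ε h
      have h' : (ε : ℂ) ≠ 0 := ofReal_ne_zero.mpr h.ne'
      rw [max_eq_left h.le, hw2' ε h, hAdef]
      push_cast; field_simp) hA0
  have T3 := (hcont.cpow tendsto_const_nhds (b := (1 / 2 : ℂ)) (by
    rw [mem_slitPlane_iff]; right
    simp [div_natCast_im, hn0.ne'])).mul T1
  have hEq : A ^ (1 / 2 : ℂ) * ∑ r ∈ Finset.range 2, c2 r =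
      (-(2 * I / n)) ^ (1 / 2 : ℂ) * (A ^ (1 / 2 : ℂ) * ∑ r ∈ Finset.range n, c1 r) := by
    refine tendsto_nhds_unique (T2.congr' ?_) T3
    filter_upwards [hev] with ε h
    have h' : (ε : ℂ) ≠ 0 := ofReal_ne_zero.mpr h.ne'
    have hzre : 0 < ((ε : ℂ) - 2 * I / n).re := by simpa [div_natCast_re] using h
    have hcp : ((ε : ℂ) - 2 * I / n) ^ (1 / 2 : ℂ) ≠ 0 := by
      rw [Ne, Complex.cpow_eq_zero_iff]; exact fun hh => hz ε h hh.1
    have e1 : ∑' k : ℤ, c1 k * cexp (-Real.pi * (ε : ℂ) * k ^ 2)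
        = ∑' k : ℤ, cexp (-Real.pi * ((ε : ℂ) - 2 * I / n) * k ^ 2) := by
      refine tsum_congr fun k => ?_
      rw [hc1, ← Complex.exp_add]; congr 1; field_simp; ring
    have e2 : ∑' k : ℤ, c2 k * cexp (-Real.pi * w2 ε * k ^ 2)
        = ∑' k : ℤ, cexp (-Real.pi / ((ε : ℂ) - 2 * I / n) * k ^ 2) := by
      refine tsum_congr fun k => ?_
      rw [hc2, ← Complex.exp_add]; congr 1
      have : w2 ε + I * n / 2 = 1 / ((ε : ℂ) - 2 * I / n) := by
        rw [eq_div_iff (hz ε h), hw2, add_mul, div_mul_cancel₀ _ (hz ε h)]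
        field_simp
        linear_combination (-2) * I_sq
      linear_combination (-(Real.pi * (k : ℂ) ^ 2)) * this
    rw [e1, e2, Complex.tsum_exp_neg_mul_int_sq hzre, one_div ((_ : ℂ) ^ (1 / 2 : ℂ)), mul_left_comm,
      mul_inv_cancel_left₀ hcp]
  have hA1 : A ^ (1 / 2 : ℂ) ≠ 0 := by
    rw [Ne, Complex.cpow_eq_zero_iff]
    intro hh
    exact slitPlane_ne_zero hA0 hh.1
  have hroot : (-(2 * I / n)) ^ (1 / 2 : ℂ) = (1 - I) / (Real.sqrt n : ℂ) := by
    have hs : ((Real.sqrt n : ℝ) : ℂ) ^ 2 = n := by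
      rw [← ofReal_pow, Real.sq_sqrt hnR.le]; simp
    have : (-(2 * I / n)) = ((1 - I) / (Real.sqrt n : ℂ)) ^ 2 := by
      rw [div_pow, hs]
      field_simp
      linear_combination -I_sq
    rw [this, one_div, Complex.sq_cpow_two_inv]
    rw [div_ofReal_re]; simp [hn0]
  have hs0 : (Real.sqrt n : ℂ) ≠ 0 := by simp [hn0.ne']
  rw [hroot] at hEq
  have h3 : ∑ r ∈ Finset.range 2, c2 r = 1 + (-I) ^ n := by
    rw [Finset.sum_range_succ, Finset.sum_range_one, hc2]
    congr 1
    · simp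
    · have : (-I : ℂ) = cexp (-(Real.pi / 2 * I)) := by
        rw [Complex.exp_neg, Complex.exp_pi_div_two_mul_I, inv_I]
      rw [this, ← Complex.exp_nat_mul]
      push_cast; ring_nf
  rw [h3] at hEq
  have h4 : 1 + (-I) ^ n = (1 - I) / (Real.sqrt n : ℂ) * ∑ r ∈ Finset.range n, c1 r := by
    apply mul_left_cancel₀ hA1; rw [hEq]; ring
  have h5 : ∑ x ∈ Finset.range n, cexp (2 * Real.pi * I * (x : ℂ) ^ 2 / n)
      = ∑ r ∈ Finset.range n, c1 r := by simp [hc1]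
  rw [h5, h4]; field_simp

theorem sum_range_natCast_zmod {M : Type*} [AddCommMonoid M] (n : ℕ) [NeZero n] (F : ZMod n → M) :
    ∑ a ∈ Finset.range n, F (a : ZMod n) = ∑ a : ZMod n, F a := by
  refine Finset.sum_nbij' (fun a : ℕ => (a : ZMod n)) (fun a => a.val) (fun _ _ => Finset.mem_univ _)
    (fun a _ => Finset.mem_range.mpr (ZMod.val_lt a)) (fun a ha => ?_) (fun a _ => ?_)
    (fun _ _ => rfl)
  · exact ZMod.val_cast_of_lt (Finset.mem_range.mp ha)
  · exact ZMod.natCast_zmod_val a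

theorem sum_range_mul_of_coprime {R : Type*} [CommSemiring R] {m n : ℕ} (hm : 0 < m) (hn : 0 < n)
    (h : m.Coprime n) {f g : ℕ → R} (hf : ∀ a, f (a % m) = f a) (hg : ∀ a, g (a % n) = g a) :
    ∑ a ∈ Finset.range (m * n), f a * g a =
      (∑ a ∈ Finset.range m, f a) * ∑ a ∈ Finset.range n, g a := by
  rw [Finset.sum_mul_sum, ← Finset.sum_product']
  refine Finset.sum_nbij' (fun a => (a % m, a % n))
    (fun p => (Nat.chineseRemainder h p.1 p.2 : ℕ)) ?_ ?_ ?_ ?_ ?_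
  · intro a _
    simp [Nat.mod_lt _ hm, Nat.mod_lt _ hn]
  · intro p _
    exact Finset.mem_range.mpr (Nat.chineseRemainder_lt_mul h p.1 p.2 hm.ne' hn.ne')
  · intro a ha
    have ha := Finset.mem_range.mp ha
    have h1 := (Nat.chineseRemainder h (a % m) (a % n)).2
    have h2 : (Nat.chineseRemainder h (a % m) (a % n) : ℕ) ≡ a [MOD m * n] :=
      (Nat.modEq_and_modEq_iff_modEq_mul h).mp
        ⟨h1.1.trans (Nat.mod_modEq _ _), h1.2.trans (Nat.mod_modEq _ _)⟩
    exact Nat.ModEq.eq_of_lt_of_lt h2 (Nat.chineseRemainder_lt_mul h _ _ hm.ne' hn.ne') ha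
  · rintro ⟨x, y⟩ hp
    simp only [Finset.mem_product, Finset.mem_range] at hp
    have h1 := (Nat.chineseRemainder h x y).2
    refine Prod.ext ?_ ?_
    · exact Eq.trans h1.1 (Nat.mod_eq_of_lt hp.1)
    · exact Eq.trans h1.2 (Nat.mod_eq_of_lt hp.2)
  · intro a _
    simp only [hf, hg]

/-- The unit `1` or `i` that occurs in the quadratic Gauss sum modulo an odd `n`. -/
noncomputable def gaussUnit (n : ℕ) : ℂ := if n % 4 = 1 then 1 else Complex.I

open Complex in
theorem cexp_two_pi_int_div_mod {n : ℕ} (hn : n ≠ 0) (k : ℤ) (a : ℕ) :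
    cexp (2 * Real.pi * I * ((a % n : ℕ) : ℂ) * k / n) = cexp (2 * Real.pi * I * (a : ℂ) * k / n) := by
  have hnC : (n : ℂ) ≠ 0 := by exact_mod_cast hn
  have h : (a : ℂ) = ((a % n : ℕ) : ℂ) + n * ((a / n : ℕ) : ℂ) := by
    exact_mod_cast (Nat.mod_add_div a n).symm
  generalize a / n = t at h
  rw [Complex.exp_eq_exp_iff_exists_int]
  refine ⟨-(t : ℤ) * k, ?_⟩
  rw [h]; push_cast; field_simp; ring

open Complex in
theorem jacobi_gauss_sum_prime {p : ℕ} [Fact p.Prime] (hp : Odd p) (k : ℤ) :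
    ∑ a ∈ Finset.range p, (J(a | p) : ℂ) * cexp (2 * Real.pi * I * a * k / p) =
      J(k | p) * (gaussUnit p * Real.sqrt p) := by
  have hp2 : ringChar (ZMod p) ≠ 2 := by
    rw [ZMod.ringChar_zmod_n]; rintro rfl; exact absurd hp (by decide)
  have hpp : (p : ℂ) ≠ 0 := by exact_mod_cast (Fact.out : p.Prime).ne_zero
  set χ : MulChar (ZMod p) ℂ := (quadraticChar (ZMod p)).ringHomComp (Int.castRingHom ℂ) with hχ
  have hχa : ∀ a : ℤ, χ (a : ZMod p) = (J(a | p) : ℂ) := by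
    intro a
    rw [← jacobiSym.legendreSym.to_jacobiSym, legendreSym]
    simp [hχ]
  have hχ1 : χ ≠ 1 := by
    rw [hχ, Ne, MulChar.ringHomComp_eq_one_iff (Int.cast_injective)]
    exact quadraticChar_ne_one hp2
  have hstd : ∀ j : ℤ, ZMod.stdAddChar (N := p) (j : ZMod p) = cexp (2 * Real.pi * I * j / p) :=
    fun j => ZMod.stdAddChar_coe j
  have hψ : (ZMod.stdAddChar (N := p)) ≠ 1 := by
    have h := ZMod.isPrimitive_stdAddChar p (one_ne_zero)
    intro h0; apply h; rw [h0]; ext; simp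
  have hL : ∑ a ∈ Finset.range p, (J(a | p) : ℂ) * cexp (2 * Real.pi * I * a * k / p)
      = gaussSum χ ((ZMod.stdAddChar (N := p)).mulShift (k : ZMod p)) := by
    rw [gaussSum, ← sum_range_natCast_zmod]
    refine Finset.sum_congr rfl fun a _ => ?_
    have h1 := hχa a
    rw [Int.cast_natCast] at h1
    rw [h1, AddChar.mulShift_apply]
    have h2 := hstd (k * a)
    push_cast at h2
    rw [h2]; ring_nf
  have hG : gaussSum χ (ZMod.stdAddChar (N := p)) = gaussUnit p * Real.sqrt p := by
    have h1 : ∑ x ∈ Finset.range p, cexp (2 * Real.pi * I * (x : ℂ) ^ 2 / p)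
        = ∑ x : ZMod p, ZMod.stdAddChar (x ^ 2) := by
      rw [← sum_range_natCast_zmod]
      refine Finset.sum_congr rfl fun x _ => ?_
      have h2 := hstd ((x : ℤ) ^ 2)
      push_cast at h2
      rw [h2]
    have h2 : ∑ x : ZMod p, ZMod.stdAddChar (x ^ 2) =
        ∑ a : ZMod p, ((χ a + 1) * ZMod.stdAddChar a) := by
      rw [← Finset.sum_fiberwise (s := Finset.univ) (g := fun x : ZMod p => x ^ 2)]
      refine Finset.sum_congr rfl fun a _ => ?_
      rw [Finset.sum_congr rfl (g := fun _ => ZMod.stdAddChar a)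
        (fun x hx => by rw [(Finset.mem_filter.mp hx).2])]
      rw [Finset.sum_const, nsmul_eq_mul]
      congr 1
      have h3 := quadraticChar_card_sqrts hp2 a
      have h4 : ({x : ZMod p | x ^ 2 = a} : Set (ZMod p)).toFinset
          = Finset.univ.filter (fun x : ZMod p => x ^ 2 = a) := by ext; simp
      rw [h4] at h3
      have h5 : χ a = ((quadraticChar (ZMod p) a : ℤ) : ℂ) := by simp [hχ]
      rw [h5, ← Int.cast_natCast, h3]; push_cast; rfl
    have h3 : ∑ a : ZMod p, ZMod.stdAddChar (N := p) a = 0 := AddChar.sum_eq_zero_of_ne_one hψ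
    rw [sum_exp_sq_div hp] at h1
    rw [gaussSum]
    have h4 : ∑ a : ZMod p, ((χ a + 1) * ZMod.stdAddChar a)
        = ∑ a : ZMod p, χ a * ZMod.stdAddChar a := by
      simp only [add_mul, one_mul, Finset.sum_add_distrib, h3, add_zero]
    rw [← h4, ← h2, ← h1, mul_comm]
    congr 1
    have hI : (1 - I : ℂ) ≠ 0 := by
      intro h; have := congrArg re h; simp at this
    rw [div_eq_iff hI, gaussUnit, ← Nat.div_add_mod p 4, pow_add, pow_mul]
    have h5 : (-I) ^ 4 = 1 := by rw [neg_pow, I_pow_four]; norm_num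
    rw [h5, one_pow, one_mul]
    have h6 : p % 4 = 1 ∨ p % 4 = 3 := by rcases hp with ⟨j, rfl⟩; omega
    rcases h6 with h6 | h6
    · simp [h6, Nat.add_mod]; ring
    · simp [h6, Nat.add_mod]
      linear_combination (-I + 1) * I_sq
  rw [hL]
  by_cases hk : (k : ZMod p) = 0
  · rw [hk, AddChar.mulShift_zero, gaussSum_one_right hχ1]
    have : J(k | p) = 0 := by
      rw [← jacobiSym.legendreSym.to_jacobiSym, legendreSym.eq_zero_iff]; exact hk
    rw [this]; simp
  · have h1 := gaussSum_mulShift χ (ZMod.stdAddChar (N := p)) (Units.mk0 _ hk)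
    rw [Units.val_mk0, hχa, hG] at h1
    have h2 : (J(k | p) : ℂ) * J(k | p) = 1 := by
      have h3 : J(k | p) ^ 2 = 1 := by
        rw [← jacobiSym.legendreSym.to_jacobiSym]; exact legendreSym.sq_one p hk
      rw [← Int.cast_mul, ← sq, h3]; simp
    rw [← h1, ← mul_assoc, h2, one_mul]

theorem gaussUnit_mul {m n : ℕ} (hm : Odd m) (hn : Odd n) (h : m.Coprime n) :
    (J((n : ℤ) | m) : ℂ) * J((m : ℤ) | n) * (gaussUnit m * gaussUnit n) = gaussUnit (m * n) := by
  have hrec := jacobiSym.quadratic_reciprocity_if (Nat.odd_iff.mp hm) (Nat.odd_iff.mp hn)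
  have hsq : J((n : ℤ) | m) * J((n : ℤ) | m) = 1 := by
    rw [← sq]; exact jacobiSym.sq_one (by simpa using h.symm)
  have hprod : (J((n : ℤ) | m) : ℂ) * J((m : ℤ) | n) = if m % 4 = 3 ∧ n % 4 = 3 then -1 else 1 := by
    rw [← Int.cast_mul, ← hrec]
    split_ifs with hc
    · rw [mul_neg, hsq]; simp
    · rw [hsq]; simp
  rw [hprod]
  have hm4 : m % 4 = 1 ∨ m % 4 = 3 := by rcases hm with ⟨j, rfl⟩; omega
  have hn4 : n % 4 = 1 ∨ n % 4 = 3 := by rcases hn with ⟨j, rfl⟩; omega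
  rcases hm4 with h1 | h1 <;> rcases hn4 with h2 | h2 <;>
    simp [gaussUnit, Nat.mul_mod, h1, h2]

open Complex in
theorem jacobi_gauss_sum {n : ℕ} (hn : Odd n) (hsq : Squarefree n) (k : ℤ) :
    ∑ a ∈ Finset.range n, (J(a | n) : ℂ) * cexp (2 * Real.pi * I * a * k / n) =
      J(k | n) * (gaussUnit n * Real.sqrt n) := by
  induction n using Nat.strong_induction_on generalizing k with
  | _ n ih =>
  rcases eq_or_ne n 1 with rfl | hn1
  · simp [gaussUnit]
  · have hpp := Nat.minFac_prime hn1
    obtain ⟨m, hm⟩ := Nat.minFac_dvd n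
    set p := n.minFac with hpdef
    have hn0 := hn.pos
    have hm0 : 0 < m := Nat.pos_of_ne_zero (by rintro rfl; omega)
    rw [hm] at hn hsq
    have hcop : p.Coprime m := Nat.coprime_of_squarefree_mul hsq
    have hpo : Odd p := (Nat.odd_mul.mp hn).1
    have hmo : Odd m := (Nat.odd_mul.mp hn).2
    have hlt : m < n := by rw [hm]; exact lt_mul_of_one_lt_left hm0 hpp.one_lt
    have hfact : Fact p.Prime := ⟨hpp⟩
    have IH := fun k => ih m hlt hmo (hsq.of_mul_right) k
    have IP := fun k => jacobi_gauss_sum_prime (p := p) hpo k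
    clear_value p
    rw [hm]
    have hpC : (p : ℂ) ≠ 0 := by exact_mod_cast hpp.ne_zero
    have hmC : (m : ℂ) ≠ 0 := by exact_mod_cast hm0.ne'
    have hbez := Nat.gcd_eq_gcd_ab p m
    rw [hcop, Nat.cast_one] at hbez
    set v := p.gcdA m
    set u := p.gcdB m
    have hbezC : (p : ℂ) * v + m * u = 1 := by exact_mod_cast hbez.symm
    have hsplit : ∀ a ∈ Finset.range (p * m),
        (J(a | p * m) : ℂ) * cexp (2 * Real.pi * I * a * k / ((p * m : ℕ) : ℂ)) =
        ((J(a | p) : ℂ) * cexp (2 * Real.pi * I * a * ((k * u : ℤ) : ℂ) / p)) *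
        ((J(a | m) : ℂ) * cexp (2 * Real.pi * I * a * ((k * v : ℤ) : ℂ) / m)) := by
      intro a _
      have : NeZero p := ⟨hpp.ne_zero⟩
      have : NeZero m := ⟨hm0.ne'⟩
      rw [jacobiSym.mul_right, mul_mul_mul_comm, ← Complex.exp_add]
      push_cast
      congr 2
      field_simp
      linear_combination (-(a * k : ℂ)) * hbezC
    rw [Finset.sum_congr rfl hsplit, sum_range_mul_of_coprime hpp.pos hm0 hcop
      (f := fun a => (J(a | p) : ℂ) * cexp (2 * Real.pi * I * a * ((k * u : ℤ) : ℂ) / p))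
      (g := fun a => (J(a | m) : ℂ) * cexp (2 * Real.pi * I * a * ((k * v : ℤ) : ℂ) / m)),
      IH, IP]
    · have hu : J(u | p) = J((m : ℤ) | p) := by
        have h1 : J((m : ℤ) * u | p) = 1 := by
          rw [jacobiSym.mod_left' (a₂ := 1), jacobiSym.one_left]
          rw [show (m : ℤ) * u = 1 - p * v by linarith, Int.sub_mul_emod_self_left]
        rw [jacobiSym.mul_left] at h1
        rcases jacobiSym.trichotomy (m : ℤ) p with h | h | h <;>
          rw [h] at h1 ⊢ <;> omega
      have hv : J(v | m) = J((p : ℤ) | m) := by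
        have h1 : J((p : ℤ) * v | m) = 1 := by
          rw [jacobiSym.mod_left' (a₂ := 1), jacobiSym.one_left]
          rw [show (p : ℤ) * v = 1 - m * u by linarith, Int.sub_mul_emod_self_left]
        rw [jacobiSym.mul_left] at h1
        rcases jacobiSym.trichotomy (p : ℤ) m with h | h | h <;>
          rw [h] at h1 ⊢ <;> omega
      have : NeZero p := ⟨hpp.ne_zero⟩
      have : NeZero m := ⟨hm0.ne'⟩
      rw [jacobiSym.mul_right, ← gaussUnit_mul hpo hmo hcop, jacobiSym.mul_left, jacobiSym.mul_left,
        hu, hv, Nat.cast_mul, Real.sqrt_mul (Nat.cast_nonneg _)]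
      push_cast
      ring
    · intro a
      rw [cexp_two_pi_int_div_mod hpp.ne_zero, Int.natCast_mod, ← jacobiSym.mod_left]
    · intro a
      rw [cexp_two_pi_int_div_mod hm0.ne', Int.natCast_mod, ← jacobiSym.mod_left]

theorem norm_sum_geometric_exp_le {a q : ℕ} (ha : 0 < a) (haq : a < q) (L : ℕ) :
    ‖∑ j ∈ Finset.range L, Complex.exp (2 * Real.pi * Complex.I * a * j / q)‖ ≤
      (q : ℝ) / 2 * (1 / a + 1 / ((q - a : ℕ) : ℝ)) := by
  have hq : (0 : ℝ) < q := by exact_mod_cast ha.trans haq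
  have ha' : (0 : ℝ) < a := by exact_mod_cast ha
  have hqa : (0 : ℝ) < ((q - a : ℕ) : ℝ) := by exact_mod_cast Nat.sub_pos_of_lt haq
  have hqa' : ((q - a : ℕ) : ℝ) = q - a := by rw [Nat.cast_sub haq.le]
  set x : ℝ := Real.pi * (a / q) with hx
  have hsin : 0 < Real.sin x ∧ 1 / Real.sin x ≤ (q : ℝ) / 2 * (1 / a + 1 / ((q - a : ℕ) : ℝ)) := by
    have hfrac : (0 : ℝ) < a / q := by positivity
    have key : ∀ u : ℝ, 0 < u → u ≤ 1 / 2 → 2 * u ≤ Real.sin (Real.pi * u) := by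
      intro u h0 h1
      have := Real.mul_le_sin (x := Real.pi * u) (by positivity) (by nlinarith [Real.pi_pos])
      calc 2 * u = 2 / Real.pi * (Real.pi * u) := by field_simp
        _ ≤ _ := this
    rcases le_total ((a : ℝ) / q) (1 / 2) with h | h
    · have h1 := key _ hfrac h
      have h2 : 0 < Real.sin x := lt_of_lt_of_le (by positivity) h1
      refine ⟨h2, ?_⟩
      calc 1 / Real.sin x ≤ 1 / (2 * (a / q)) := one_div_le_one_div_of_le (by positivity) h1
        _ = (q : ℝ) / 2 * (1 / a) := by field_simp
        _ ≤ _ := by gcongr; linarith [one_div_pos.mpr hqa]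
    · have hpos : (0 : ℝ) < 1 - a / q := by
        rw [sub_pos, div_lt_one hq]; exact_mod_cast haq
      have h1 := key (1 - a / q) hpos (by linarith)
      have h3 : Real.sin (Real.pi * (1 - a / q)) = Real.sin x := by
        rw [hx, ← Real.sin_pi_sub]; congr 1; ring
      rw [h3] at h1
      have h2 : 0 < Real.sin x := lt_of_lt_of_le (by positivity) h1
      refine ⟨h2, ?_⟩
      calc 1 / Real.sin x ≤ 1 / (2 * (1 - a / q)) := one_div_le_one_div_of_le (by positivity) h1
        _ = (q : ℝ) / 2 * (1 / ((q - a : ℕ) : ℝ)) := by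
          have : (q : ℝ) - a ≠ 0 := by rw [← hqa']; exact hqa.ne'
          rw [hqa']; field_simp
        _ ≤ _ := by gcongr; linarith [one_div_pos.mpr ha']
  set z : ℂ := Complex.exp (Complex.I * ((2 * x : ℝ) : ℂ)) with hz
  have hterm : ∀ j : ℕ, Complex.exp (2 * Real.pi * Complex.I * a * j / q) = z ^ j := by
    intro j
    rw [hz, ← Complex.exp_nat_mul]; congr 1; rw [hx]; push_cast; ring
  have hz1 : ‖z - 1‖ = 2 * Real.sin x := by
    rw [hz, Complex.norm_exp_I_mul_ofReal_sub_one, mul_div_cancel_left₀ _ (two_ne_zero),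
      Real.norm_eq_abs, abs_of_pos (by linarith [hsin.1])]
  have hzn : ‖z‖ = 1 := by rw [hz, mul_comm, Complex.norm_exp_ofReal_mul_I]
  have hne : z ≠ 1 := by
    intro h; rw [h, sub_self, norm_zero] at hz1; linarith [hsin.1]
  rw [Finset.sum_congr rfl (fun j _ => hterm j), geom_sum_eq hne, norm_div, hz1]
  have h2 : ‖z ^ L - 1‖ ≤ 2 := by
    calc ‖z ^ L - 1‖ ≤ ‖z ^ L‖ + ‖(1 : ℂ)‖ := norm_sub_le _ _
      _ = 2 := by rw [norm_pow, hzn]; norm_num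
  calc ‖z ^ L - 1‖ / (2 * Real.sin x) ≤ 2 / (2 * Real.sin x) := by
        apply div_le_div_of_nonneg_right h2; linarith [hsin.1]
    _ = 1 / Real.sin x := by field_simp
    _ ≤ _ := hsin.2

/-- The Pólya–Vinogradov inequality for the Jacobi symbol to an odd squarefree modulus. -/
theorem abs_sum_jacobiSym_interval_le {q : ℕ} (hq : Odd q) (hsq : Squarefree q) (hq1 : 1 < q)
    (c : ℤ) (L : ℕ) :
    |∑ j ∈ Finset.range L, (J(c + j | q) : ℝ)| ≤ √q * (1 + Real.log q) := by
  have hq0 : (0 : ℝ) < q := by exact_mod_cast hq.pos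
  have hsq0 : 0 < √(q : ℝ) := Real.sqrt_pos.mpr hq0
  have hu : ‖gaussUnit q‖ = 1 := by unfold gaussUnit; split_ifs <;> simp
  have h1 : ((∑ j ∈ Finset.range L, (J(c + j | q) : ℝ) : ℝ) : ℂ) * (gaussUnit q * √(q : ℝ)) =
      ∑ a ∈ Finset.range q, (J(a | q) : ℂ) * Complex.exp (2 * Real.pi * Complex.I * a * c / q) *
        ∑ j ∈ Finset.range L, Complex.exp (2 * Real.pi * Complex.I * a * j / q) := by
    push_cast
    rw [Finset.sum_mul]
    simp_rw [Finset.mul_sum]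
    rw [Finset.sum_comm]
    refine Finset.sum_congr rfl fun j _ => ?_
    rw [← jacobi_gauss_sum hq hsq]
    refine Finset.sum_congr rfl fun a _ => ?_
    rw [mul_assoc _ (Complex.exp _) (Complex.exp _), ← Complex.exp_add]
    push_cast
    congr 2; ring
  have h2 : |∑ j ∈ Finset.range L, (J(c + j | q) : ℝ)| * √(q : ℝ) ≤
      ∑ a ∈ Finset.Ico 1 q, (q : ℝ) / 2 * (1 / a + 1 / ((q - a : ℕ) : ℝ)) := by
    have h3 := congrArg norm h1
    rw [norm_mul, norm_mul, hu, one_mul, Complex.norm_real, Complex.norm_real, Real.norm_eq_abs,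
      Real.norm_eq_abs, abs_of_pos hsq0] at h3
    rw [h3, Finset.range_eq_Ico, Finset.sum_eq_sum_Ico_succ_bot hq.pos]
    have h4 : J(((0 : ℕ) : ℤ) | q) = 0 := by simpa using jacobiSym.zero_left hq1
    rw [h4, Int.cast_zero, zero_mul, zero_mul, zero_add, zero_add]
    refine (norm_sum_le _ _).trans (Finset.sum_le_sum fun a ha => ?_)
    have ha := Finset.mem_Ico.mp ha
    rw [norm_mul, norm_mul]
    have h5 : ‖(J(a | q) : ℂ)‖ ≤ 1 := by
      rcases jacobiSym.trichotomy (a : ℤ) q with h | h | h <;> rw [h] <;> simp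
    have h6 : ‖Complex.exp (2 * Real.pi * Complex.I * a * c / q)‖ = 1 := by
      have : (2 * Real.pi * Complex.I * a * c / q : ℂ) = ((2 * Real.pi * a * c / q : ℝ) : ℂ) * Complex.I := by
        push_cast; ring
      rw [this, Complex.norm_exp_ofReal_mul_I]
    rw [h6, mul_one]
    calc _ ≤ 1 * _ := mul_le_mul_of_nonneg_right h5 (norm_nonneg _)
      _ ≤ _ := by rw [one_mul]; exact norm_sum_geometric_exp_le (by omega) ha.2 L
  have h3 : ∑ a ∈ Finset.Ico 1 q, (q : ℝ) / 2 * (1 / a + 1 / ((q - a : ℕ) : ℝ)) ≤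
      q * (1 + Real.log q) := by
    rw [← Finset.mul_sum, Finset.sum_add_distrib]
    have h4 : ∑ a ∈ Finset.Ico 1 q, (1 : ℝ) / ((q - a : ℕ) : ℝ) = ∑ a ∈ Finset.Ico 1 q, (1 : ℝ) / a :=
      Finset.sum_nbij' (fun a => q - a) (fun a => q - a)
        (by intro a ha; simp only [Finset.mem_Ico] at ha ⊢; omega)
        (by intro a ha; simp only [Finset.mem_Ico] at ha ⊢; omega)
        (by intro a ha; simp only [Finset.mem_Ico] at ha; omega)
        (by intro a ha; simp only [Finset.mem_Ico] at ha; omega)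
        (by intro a ha; rfl)
    have h5 : ∑ a ∈ Finset.Ico 1 q, (1 : ℝ) / a ≤ 1 + Real.log q := by
      have h6 := harmonic_le_one_add_log q
      rw [harmonic_eq_sum_Icc] at h6
      push_cast at h6
      refine le_trans ?_ h6
      simp_rw [one_div]
      refine Finset.sum_le_sum_of_subset_of_nonneg ?_ (fun _ _ _ => by positivity)
      intro a ha; simp only [Finset.mem_Ico, Finset.mem_Icc] at ha ⊢; omega
    rw [h4]
    nlinarith
  have h4 : √(q : ℝ) * √q = q := Real.mul_self_sqrt hq0.le
  refine le_of_mul_le_mul_right ?_ hsq0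
  calc _ ≤ q * (1 + Real.log q) := h2.trans h3
    _ = _ := by rw [mul_right_comm, h4]

/-- The multiples of an odd `d` in a residue class modulo `8`. -/
theorem exists_sum_filter_mod_eight_dvd {d : ℕ} (hd : Odd d) (b : ℕ) (hb : b < 8) (t : ℕ) :
    ∃ L b' : ℕ, |(L : ℝ) - t / (8 * d)| ≤ 1 ∧ ∀ F : ℕ → ℝ,
      ∑ n ∈ (Finset.range t).filter (fun n => n % 8 = b ∧ d ∣ n), F n =
        ∑ j ∈ Finset.range L, F (d * (8 * j + b')) := by
  set b' := (b * d) % 8 with hb'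
  have hd0 : 0 < d := hd.pos
  have hb'8 : b' < 8 := Nat.mod_lt _ (by norm_num)
  have hdd : ∀ x : ℕ, (d * (d * x)) % 8 = x % 8 := by
    intro x
    have h1 : d * d % 8 = 1 := by
      have : d % 8 = 1 ∨ d % 8 = 3 ∨ d % 8 = 5 ∨ d % 8 = 7 := by rcases hd with ⟨j, rfl⟩; omega
      rcases this with h | h | h | h <;> simp [Nat.mul_mod, h]
    rw [← mul_assoc, Nat.mul_mod, h1, one_mul, Nat.mod_mod]
  have hmod : ∀ x : ℕ, d * x % 8 = b ↔ x % 8 = b' := by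
    intro x
    constructor
    · intro h
      rw [hb', ← h, Nat.mod_mul_mod, mul_comm (d * x), hdd]
    · intro h
      rw [Nat.mul_mod, h, hb', Nat.mul_mod_mod, Nat.mod_mul_mod, mul_comm b d, hdd]
      exact Nat.mod_eq_of_lt hb
  set x := t - d * b' with hx
  set L := (x + 8 * d - 1) / (8 * d) with hL
  have hjL : ∀ j, j < L ↔ d * (8 * j + b') < t := by
    intro j
    rw [hL, Nat.lt_iff_add_one_le, Nat.le_div_iff_mul_le (by omega)]
    have e1 : (j + 1) * (8 * d) = 8 * (d * j) + 8 * d := by ring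
    have e2 : d * (8 * j + b') = 8 * (d * j) + d * b' := by ring
    rw [e1, e2]; omega
  refine ⟨L, b', ?_, fun F => ?_⟩
  · have h1 : L * (8 * d) ≤ x + 8 * d - 1 := Nat.div_mul_le_self _ _
    have h2 : x ≤ L * (8 * d) := by
      by_contra hcon
      push Not at hcon
      have h3 : L < L + 1 := Nat.lt_succ_self L
      have : L + 1 ≤ L := by
        conv_rhs => rw [hL]
        rw [Nat.le_div_iff_mul_le (by omega)]
        have : (L + 1) * (8 * d) = L * (8 * d) + 8 * d := by ring
        omega
      omega
    have h4 : d * b' ≤ 8 * d := by nlinarith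
    have h5 : L * (8 * d) ≤ t + 8 * d := by omega
    have h6 : t ≤ L * (8 * d) + 8 * d := by omega
    have h5' : (L : ℝ) * (8 * d) ≤ t + 8 * d := by exact_mod_cast h5
    have h6' : (t : ℝ) ≤ L * (8 * d) + 8 * d := by exact_mod_cast h6
    have hd' : (0 : ℝ) < 8 * d := by positivity
    have e : (t : ℝ) / (8 * d) * (8 * d) = t := by field_simp
    rw [abs_le]
    constructor
    · refine le_of_mul_le_mul_right ?_ hd'; rw [sub_mul, e]; linarith
    · refine le_of_mul_le_mul_right ?_ hd'; rw [sub_mul, e]; linarith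
  · symm
    refine Finset.sum_nbij' (fun j => d * (8 * j + b')) (fun n => n / d / 8) ?_ ?_ ?_ ?_ ?_
    · intro j hj
      have hj := Finset.mem_range.mp hj
      refine Finset.mem_filter.mpr ⟨Finset.mem_range.mpr ((hjL j).mp hj), ?_, dvd_mul_right _ _⟩
      rw [hmod]; omega
    · intro n hn
      obtain ⟨h1, h2, y, rfl⟩ := Finset.mem_filter.mp hn
      rw [hmod] at h2
      rw [Finset.mem_range, hjL, Nat.mul_div_cancel_left _ hd0]
      have : 8 * (y / 8) + b' = y := by omega
      rw [this]; exact Finset.mem_range.mp h1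
    · intro j _
      simp only [Nat.mul_div_cancel_left _ hd0]; omega
    · intro n hn
      obtain ⟨h1, h2, y, rfl⟩ := Finset.mem_filter.mp hn
      rw [hmod] at h2
      simp only [Nat.mul_div_cancel_left _ hd0]
      congr 1; omega
    · intro j _; rfl

theorem sum_divisors_moebius (n : ℕ) :
    ∑ d ∈ n.divisors, ArithmeticFunction.moebius d = if n = 1 then 1 else 0 := by
  have h := congrArg (fun f => f n) (ArithmeticFunction.coe_zeta_mul_moebius)
  simp only [ArithmeticFunction.coe_zeta_mul_apply, ArithmeticFunction.one_apply] at h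
  exact h

theorem sum_divisors_filter_dvd_moebius {r : ℕ} (hr : r ≠ 0) (n : ℕ) :
    ∑ d ∈ r.divisors.filter (· ∣ n), (ArithmeticFunction.moebius d : ℝ) =
      if r.Coprime n then 1 else 0 := by
  have h1 : r.divisors.filter (· ∣ n) = (Nat.gcd r n).divisors := by
    ext d
    simp only [Finset.mem_filter, Nat.mem_divisors, Nat.dvd_gcd_iff]
    have : Nat.gcd r n ≠ 0 := Nat.gcd_ne_zero_left hr
    tauto
  rw [h1, ← Int.cast_sum, sum_divisors_moebius]
  simp [Nat.coprime_iff_gcd_eq_one]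

theorem sum_filter_coprime_eq {r : ℕ} (hr : r ≠ 0) (s : Finset ℕ) (F : ℕ → ℝ) :
    ∑ n ∈ s.filter (fun n => r.Coprime n), F n =
      ∑ d ∈ r.divisors, (ArithmeticFunction.moebius d : ℝ) * ∑ n ∈ s.filter (fun n => d ∣ n), F n := by
  simp_rw [Finset.mul_sum, Finset.sum_filter]
  rw [Finset.sum_comm]
  refine Finset.sum_congr rfl fun n _ => ?_
  have h := sum_divisors_filter_dvd_moebius hr n
  rw [Finset.sum_filter] at h
  have h2 : (if r.Coprime n then F n else 0) = (if r.Coprime n then (1 : ℝ) else 0) * F n := by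
    split_ifs <;> simp
  rw [h2, ← h, Finset.sum_mul]
  refine Finset.sum_congr rfl fun d _ => ?_
  split_ifs <;> simp

/-- `∑_{d ∣ r} μ(d) / d`, the density of the integers coprime to `r`. -/
noncomputable def coprimeDensity (r : ℕ) : ℝ :=
  ∑ d ∈ r.divisors, (ArithmeticFunction.moebius d : ℝ) / d

theorem abs_moebius_cast_le (d : ℕ) : |(ArithmeticFunction.moebius d : ℝ)| ≤ 1 := by
  exact_mod_cast ArithmeticFunction.abs_moebius_le_one

theorem card_divisors_cast_le (r : ℕ) : ((r.divisors.card : ℕ) : ℝ) ≤ r := by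
  exact_mod_cast Nat.card_divisors_le_self r

theorem abs_count_coprime_mod_eight_sub_le {r : ℕ} (hr : Odd r) {b : ℕ} (hb : b < 8) (t : ℕ) :
    |∑ _n ∈ ((Finset.range t).filter (fun n => n % 8 = b)).filter (fun n => r.Coprime n), (1 : ℝ)
      - t / 8 * coprimeDensity r| ≤ r := by
  rw [sum_filter_coprime_eq hr.pos.ne', coprimeDensity, Finset.mul_sum, ← Finset.sum_sub_distrib]
  refine (Finset.abs_sum_le_sum_abs _ _).trans
    (le_trans (Finset.sum_le_card_nsmul _ _ 1 fun d hd => ?_) ?_)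
  · have hdo : Odd d := hr.of_dvd_nat (Nat.dvd_of_mem_divisors hd)
    obtain ⟨L, b', hL, hF⟩ := exists_sum_filter_mod_eight_dvd hdo b hb t
    rw [Finset.filter_filter, hF, Finset.sum_const, Finset.card_range, nsmul_eq_mul, mul_one]
    have hd0 : (d : ℝ) ≠ 0 := by exact_mod_cast hdo.pos.ne'
    have : (ArithmeticFunction.moebius d : ℝ) * L - t / 8 * ((ArithmeticFunction.moebius d : ℝ) / d)
      = ArithmeticFunction.moebius d * (L - t / (8 * d)) := by field_simp
    rw [this, abs_mul]
    exact mul_le_one₀ (abs_moebius_cast_le d) (abs_nonneg _) hL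
  · rw [nsmul_eq_mul, mul_one]; exact card_divisors_cast_le r

theorem abs_jacobiSym_cast_le (a : ℤ) (n : ℕ) : |(J(a | n) : ℝ)| ≤ 1 := by
  rcases jacobiSym.trichotomy a n with h | h | h <;> rw [h] <;> simp

/-- Pólya–Vinogradov in a residue class modulo `8`, with a coprimality condition. -/
theorem abs_sum_jacobiSym_coprime_mod_eight_le {q : ℕ} (hq : Odd q) (hsq : Squarefree q)
    (hq1 : 1 < q) {r : ℕ} (hr : Odd r) {b : ℕ} (hb : b < 8) (t : ℕ) :
    |∑ n ∈ ((Finset.range t).filter (fun n => n % 8 = b)).filter (fun n => r.Coprime n),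
      (J((n : ℤ) | q) : ℝ)| ≤ r * (√q * (1 + Real.log q)) := by
  have hB : 0 ≤ √(q : ℝ) * (1 + Real.log q) := by
    have := Real.log_nonneg (x := q) (by exact_mod_cast hq1.le)
    positivity
  rw [sum_filter_coprime_eq hr.pos.ne']
  refine (Finset.abs_sum_le_sum_abs _ _).trans
    (le_trans (Finset.sum_le_card_nsmul _ _ (√(q : ℝ) * (1 + Real.log q)) fun d hd => ?_) ?_)
  · have hdo : Odd d := hr.of_dvd_nat (Nat.dvd_of_mem_divisors hd)
    obtain ⟨L, b', hL, hF⟩ := exists_sum_filter_mod_eight_dvd hdo b hb t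
    rw [Finset.filter_filter, hF, abs_mul]
    refine (mul_le_of_le_one_left (abs_nonneg _) (abs_moebius_cast_le d)).trans ?_
    have h8 : Nat.Coprime 8 q := by
      rw [show 8 = 2 ^ 3 by norm_num]
      exact Nat.Coprime.pow_left 3 (Nat.coprime_two_left.mpr hq)
    obtain ⟨c, hc⟩ : ∃ c : ℤ, ∀ j : ℤ, J(8 * j + b' | q) = J(8 | q) * J(c + j | q) := by
      have hbez := Nat.gcd_eq_gcd_ab 8 q
      rw [h8] at hbez
      refine ⟨Nat.gcdA 8 q * b', fun j => ?_⟩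
      rw [← jacobiSym.mul_left]
      apply jacobiSym.mod_left'
      have h1 : (8 : ℤ) * j + b' = 8 * (Nat.gcdA 8 q * b' + j) + q * (Nat.gcdB 8 q * b') := by
        push_cast at hbez
        linear_combination (b' : ℤ) * hbez
      rw [h1, Int.add_mul_emod_self_left]
    have h2 : ∀ j ∈ Finset.range L, (J(((d * (8 * j + b') : ℕ) : ℤ) | q) : ℝ) =
        (J((d : ℤ) | q) * J(8 | q) : ℝ) * (J(c + j | q) : ℝ) := by
      intro j _
      push_cast
      rw [jacobiSym.mul_left, hc]
      push_cast; ring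
    rw [Finset.sum_congr rfl h2, ← Finset.mul_sum, abs_mul, abs_mul]
    refine le_trans (mul_le_of_le_one_left (abs_nonneg _) ?_)
      (abs_sum_jacobiSym_interval_le hq hsq hq1 c L)
    exact mul_le_one₀ (abs_jacobiSym_cast_le _ _) (abs_nonneg _) (abs_jacobiSym_cast_le _ _)
  · rw [nsmul_eq_mul]
    exact mul_le_mul_of_nonneg_right (card_divisors_cast_le r) hB

/-- Every positive integer is `2 ^ e * (r ^ 2 * q)` with `r`, `q` odd and `q` squarefree. -/
theorem exists_two_pow_sq_mul_squarefree {m : ℕ} (hm : m ≠ 0) :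
    ∃ e r q : ℕ, m = 2 ^ e * (r ^ 2 * q) ∧ Odd r ∧ Odd q ∧ Squarefree q := by
  obtain ⟨e, m', hm', rfl⟩ := Nat.exists_eq_two_pow_mul_odd hm
  obtain ⟨q, r, h, hq⟩ := Nat.sq_mul_squarefree m'
  rw [← h] at hm' ⊢
  exact ⟨e, r, q, rfl, (Nat.odd_mul.mp hm').1 |>.of_dvd_nat (dvd_pow_self r two_ne_zero),
    (Nat.odd_mul.mp hm').2, hq⟩

theorem jacobiSym_mod_eight_eq {e r q n : ℕ} (hn : Odd n) (hq : Odd q) :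
    J(((2 ^ e * (r ^ 2 * q) : ℕ) : ℤ) | n) =
      (if r.Coprime n then 1 else 0) * (ZMod.χ₈ n ^ e * (if q % 4 = 3 ∧ n % 4 = 3 then -1 else 1)) *
        J((n : ℤ) | q) := by
  have hrec := jacobiSym.quadratic_reciprocity_if (Nat.odd_iff.mp hq) (Nat.odd_iff.mp hn)
  push_cast
  rw [jacobiSym.mul_left, jacobiSym.mul_left, jacobiSym.pow_left, jacobiSym.at_two hn, ← hrec]
  have h1 : J((r : ℤ) ^ 2 | n) = if r.Coprime n then 1 else 0 := by
    split_ifs with h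
    · exact jacobiSym.sq_one' (by simpa using h)
    · rw [jacobiSym.pow_left, jacobiSym.eq_zero_iff.mpr ⟨hn.pos.ne', by simpa using h⟩]; simp
  rw [h1]
  split_ifs <;> ring

/-- Pólya–Vinogradov for `n ↦ (m / n)` in a residue class modulo `8`, when `m` is neither a
square nor twice a square. -/
theorem abs_sum_jacobiSym_right_mod_eight_le {m : ℕ} (hm : m ≠ 0) (h1 : ¬ IsSquare m)
    (h2 : ¬ IsSquare (2 * m)) {b : ℕ} (hb : b < 8) (hbo : Odd b) (t : ℕ) :
    |∑ n ∈ (Finset.range t).filter (fun n => n % 8 = b), (J((m : ℤ) | n) : ℝ)| ≤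
      √m * (1 + Real.log m) := by
  obtain ⟨e, r, q, hmeq, hr, hq, hsq⟩ := exists_two_pow_sq_mul_squarefree hm
  have hq1 : 1 < q := by
    by_contra hcon
    have hq1 : q = 1 := by have := hq.pos; omega
    rcases Nat.even_or_odd' e with ⟨f, rfl | rfl⟩
    · exact h1 ⟨2 ^ f * r, by rw [hmeq, hq1]; ring⟩
    · exact h2 ⟨2 ^ (f + 1) * r, by rw [hmeq, hq1]; ring⟩
  have hodd : ∀ n, n % 8 = b → Odd n := by
    intro n hn; rw [Nat.odd_iff] at hbo ⊢; omega
  have key : ∑ n ∈ (Finset.range t).filter (fun n => n % 8 = b), (J((m : ℤ) | n) : ℝ) =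
      ((ZMod.χ₈ b ^ e * (if q % 4 = 3 ∧ b % 4 = 3 then -1 else 1) : ℤ) : ℝ) *
      ∑ n ∈ ((Finset.range t).filter (fun n => n % 8 = b)).filter (fun n => r.Coprime n),
      (J((n : ℤ) | q) : ℝ) := by
    rw [Finset.sum_filter (p := fun n => r.Coprime n), Finset.mul_sum]
    refine Finset.sum_congr rfl fun n hn => ?_
    have hn := (Finset.mem_filter.mp hn).2
    rw [hmeq, jacobiSym_mod_eight_eq (hodd n hn) hq]
    have e1 : ZMod.χ₈ (n : ZMod 8) = ZMod.χ₈ (b : ZMod 8) := by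
      rw [← hn, ZMod.natCast_mod]
    have e2 : n % 4 = b % 4 := by omega
    rw [e1, e2]
    push_cast
    split_ifs <;> simp
  have hc : |((ZMod.χ₈ b ^ e * (if q % 4 = 3 ∧ b % 4 = 3 then -1 else 1) : ℤ) : ℝ)| ≤ 1 := by
    have hχ : |ZMod.χ₈ (b : ZMod 8)| ≤ 1 := by
      have : ∀ x : ZMod 8, |ZMod.χ₈ x| ≤ 1 := by decide
      exact this _
    rw [← Int.cast_abs, abs_mul, abs_pow]
    have h3 : |ZMod.χ₈ (b : ZMod 8)| ^ e ≤ 1 := pow_le_one₀ (abs_nonneg _) hχ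
    split_ifs <;> simp <;> exact_mod_cast h3
  rw [key, abs_mul]
  refine (mul_le_of_le_one_left (abs_nonneg _) hc).trans
    ((abs_sum_jacobiSym_coprime_mod_eight_le hq hsq hq1 hr hb t).trans ?_)
  have hq0 : (0 : ℝ) < q := by exact_mod_cast hq.pos
  have hr1 : (1 : ℝ) ≤ r := by exact_mod_cast hr.pos
  have hm2 : (r : ℝ) ^ 2 * q ≤ m := by
    rw [hmeq]; push_cast
    exact le_mul_of_one_le_left (by positivity) (one_le_pow₀ (by norm_num))
  have hqm : (q : ℝ) ≤ m := le_trans (le_mul_of_one_le_left hq0.le (one_le_pow₀ hr1)) hm2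
  have h4 : (r : ℝ) * √q ≤ √m := by
    rw [← Real.sqrt_sq (by linarith : (0 : ℝ) ≤ r), ← Real.sqrt_mul (by positivity)]
    exact Real.sqrt_le_sqrt hm2
  have h5 : Real.log q ≤ Real.log m := Real.log_le_log hq0 hqm
  have h6 : 0 ≤ Real.log q := Real.log_nonneg (by exact_mod_cast hq1.le)
  rw [← mul_assoc]
  gcongr

/-- The second difference `φ(X + D) - φ(X) - φ(D) + φ(0)`. -/
def secondDiff (φ : ℝ → ℝ) (X D : ℝ) : ℝ := φ (X + D) - φ X - φ D + φ 0

/-- The trapezoidal weight on `[0, X + D]` of height `1` with slopes of width `D` (for `x ≥ 0`). -/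
noncomputable def trapezoid (X D x : ℝ) : ℝ := secondDiff (fun a => max (a - x) 0) X D / D

/-- `cos` if `n ≡ 1 mod 4` and `sin` otherwise. -/
noncomputable def cosOrSin (n : ℕ) (x : ℝ) : ℝ := if n % 4 = 1 then Real.cos x else Real.sin x

theorem abs_cosOrSin_le (n : ℕ) (x : ℝ) : |cosOrSin n x| ≤ 1 := by
  unfold cosOrSin; split_ifs
  · exact Real.abs_cos_le_one x
  · exact Real.abs_sin_le_one x

theorem hasSum_cos_div_sq (y : ℝ) :
    HasSum (fun k : ℕ => 1 / (k : ℝ) ^ 2 * Real.cos (2 * Real.pi * k * y))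
      (Real.pi ^ 2 * (Int.fract y ^ 2 - Int.fract y + 1 / 6)) := by
  have h := hasSum_one_div_nat_pow_mul_cos (k := 1) one_ne_zero (x := Int.fract y)
    ⟨Int.fract_nonneg y, (Int.fract_lt_one y).le⟩
  convert! h using 1
  · ext k
    rw [mul_one]
    congr 1
    have : 2 * Real.pi * k * y = 2 * Real.pi * k * Int.fract y + ((k * ⌊y⌋ : ℤ) : ℝ) * (2 * Real.pi) := by
      conv_lhs => rw [← Int.floor_add_fract y]
      push_cast; ring
    rw [this, Real.cos_add_int_mul_two_pi]
  · have h2 : (Polynomial.bernoulli 2) = Polynomial.X ^ 2 - Polynomial.X + Polynomial.C (1 / 6) := by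
      have hb2 : bernoulli 2 = 1 / 6 := by
        rw [bernoulli_eq_bernoulli'_of_ne_one (by norm_num), bernoulli'_two]
      have hb1 : bernoulli 1 = -1 / 2 := bernoulli_one
      rw [Polynomial.bernoulli]
      simp only [Finset.sum_range_succ, Finset.sum_range_zero, ← Polynomial.C_mul_X_pow_eq_monomial,
        Nat.choose_zero_right, Nat.choose_self, hb2, hb1, bernoulli_zero]
      norm_num
      ring
    rw [mul_one, h2]
    simp only [Polynomial.map_add, Polynomial.map_sub, Polynomial.map_pow, Polynomial.map_X,
      Polynomial.map_C, Polynomial.eval_add, Polynomial.eval_sub, Polynomial.eval_pow,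
      Polynomial.eval_X, Polynomial.eval_C, Nat.factorial]
    rw [show (algebraMap ℚ ℝ) (1 / 6) = 1 / 6 by norm_num]
    push_cast; ring

theorem sum_max_sub_eq {y : ℝ} (hy : 0 ≤ y) {L : ℕ} (hL : ⌊y⌋₊ ≤ L) :
    ∑ j ∈ Finset.range L, max (y - 1 - j) 0 =
      y ^ 2 / 2 - y / 2 + 1 / 12 - (Int.fract y ^ 2 - Int.fract y + 1 / 6) / 2 := by
  have h1 : ∑ j ∈ Finset.range L, max (y - 1 - j) 0 = ∑ j ∈ Finset.range ⌊y⌋₊, (y - 1 - j) := by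
    rw [← Finset.sum_subset (Finset.range_mono hL)]
    · refine Finset.sum_congr rfl fun j hj => max_eq_left ?_
      have : j + 1 ≤ ⌊y⌋₊ := Finset.mem_range.mp hj
      have h2 := (Nat.le_floor_iff hy).mp this
      push_cast at h2; linarith
    · intro j _ hj
      rw [Finset.mem_range, not_lt] at hj
      apply max_eq_right
      have h2 : y < ⌊y⌋₊ + 1 := Nat.lt_floor_add_one y
      have : (⌊y⌋₊ : ℝ) ≤ j := by exact_mod_cast hj
      linarith
  have h3 : ∀ N : ℕ, ∑ j ∈ Finset.range N, (y - 1 - j) = N * y - N * (N + 1) / 2 := by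
    intro N
    induction N with
    | zero => simp
    | succ N ih => rw [Finset.sum_range_succ, ih]; push_cast; ring
  have h4 : Int.fract y = y - ⌊y⌋₊ := by
    rw [Int.fract, ← natCast_floor_eq_intCast_floor hy]
  rw [h1, h3, h4]; ring

theorem sum_range_mul_eq_residues {M : Type*} [AddCommMonoid M] (n B : ℕ) (F : ℕ → M) :
    ∑ m ∈ Finset.range (B * n), F m =
      ∑ r ∈ Finset.range n, ∑ j ∈ Finset.range B, F (r + n * j) := by
  induction B with
  | zero => simp
  | succ B ih =>
    simp_rw [Finset.sum_range_succ, Finset.sum_add_distrib]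
    rw [← ih, add_mul, one_mul, Finset.sum_range_add]
    simp [mul_comm, add_comm]

theorem trapezoid_eq_zero {X D x : ℝ} (hX : 0 ≤ X) (hD : 0 ≤ D) (hx : X + D ≤ x) :
    trapezoid X D x = 0 := by
  unfold trapezoid secondDiff
  simp only []
  rw [max_eq_right (by linarith), max_eq_right (by linarith), max_eq_right (by linarith),
    max_eq_right (by linarith)]
  simp

theorem trapezoid_mul_left (X D x : ℝ) {c : ℝ} (hc : 0 < c) :
    trapezoid X D (c * x) = trapezoid (X / c) (D / c) x := by
  have h : ∀ a, max (a - c * x) 0 = c * max (a / c - x) 0 := by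
    intro a
    rw [mul_max_of_nonneg _ _ hc.le, mul_zero, mul_sub, mul_div_cancel₀ _ hc.ne']
  unfold trapezoid secondDiff
  simp only [h]
  rw [add_div, zero_div]
  rcases eq_or_ne D 0 with rfl | hD
  · simp
  · field_simp

theorem sum_trapezoid_residue {X D : ℝ} (hX : 0 ≤ X) (hD : 0 < D) {n : ℕ} {r : ℕ}
    (hr : r < n) {B : ℕ} (hB : X + D ≤ B) :
    ∑ j ∈ Finset.range (B + 1), trapezoid X D ((r + n * j : ℕ) : ℝ) = X / n - n / (2 * Real.pi ^ 2 * D) *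
      secondDiff (fun a => ∑' k : ℕ, 1 / (k : ℝ) ^ 2 * Real.cos (2 * Real.pi * k * ((a - r) / n))) X D := by
  have hn : (0 : ℝ) < n := by exact_mod_cast (Nat.zero_le r).trans_lt hr
  have hn1 : (1 : ℝ) ≤ n := by exact_mod_cast (Nat.zero_le r).trans_lt hr
  have hrn : (r : ℝ) < n := by exact_mod_cast hr
  have hr0 : (0 : ℝ) ≤ r := Nat.cast_nonneg r
  have key : ∀ a : ℝ, 0 ≤ a → a ≤ B → ∑ j ∈ Finset.range (B + 1), max (a - ((r + n * j : ℕ) : ℝ)) 0 =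
      n * (((a - r) / n + 1) ^ 2 / 2 - ((a - r) / n + 1) / 2 + 1 / 12) - n / (2 * Real.pi ^ 2) *
       ∑' k : ℕ, 1 / (k : ℝ) ^ 2 * Real.cos (2 * Real.pi * k * ((a - r) / n)) := by
    intro a ha haB
    have hy0 : 0 ≤ (a - r) / n + 1 := by
      rw [div_add_one hn.ne']; apply div_nonneg _ hn.le; linarith
    have hyB : ⌊(a - r) / n + 1⌋₊ ≤ B + 1 := by
      apply Nat.floor_le_of_le
      push_cast
      have : (a - r) / n ≤ B := by
        rw [div_le_iff₀ hn]
        nlinarith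
      linarith
    have h1 := sum_max_sub_eq hy0 hyB
    have h2 : ∀ k : ℕ, 1 / (k : ℝ) ^ 2 * Real.cos (2 * Real.pi * k * ((a - r) / n)) =
        1 / (k : ℝ) ^ 2 * Real.cos (2 * Real.pi * k * ((a - r) / n + 1)) := by
      intro k
      rw [mul_add (2 * Real.pi * k : ℝ), mul_one, mul_comm (2 * Real.pi) (k : ℝ),
        Real.cos_add_nat_mul_two_pi]
    simp_rw [h2]
    rw [(hasSum_cos_div_sq _).tsum_eq]
    have h3 : ∀ j : ℕ, max (a - ((r + n * j : ℕ) : ℝ)) 0 = n * max ((a - r) / n + 1 - 1 - j) 0 := by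
      intro j
      rw [mul_max_of_nonneg _ _ hn.le, mul_zero]
      congr 1; push_cast; field_simp; ring
    simp_rw [h3]
    rw [← Finset.mul_sum, h1]
    have := Real.pi_pos.ne'
    field_simp
  have hsum : ∑ j ∈ Finset.range (B + 1), trapezoid X D ((r + n * j : ℕ) : ℝ) =
      secondDiff (fun a => ∑ j ∈ Finset.range (B + 1), max (a - ((r + n * j : ℕ) : ℝ)) 0) X D / D := by
    unfold trapezoid secondDiff
    rw [← Finset.sum_div]
    simp only [Finset.sum_add_distrib, Finset.sum_sub_distrib]
  rw [hsum]
  unfold secondDiff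
  simp only []
  rw [key _ (by positivity) hB, key _ hX (by linarith), key _ hD.le (by linarith),
    key _ le_rfl (by linarith)]
  have := Real.pi_pos.ne'
  field_simp
  ring

/-- `∑_k k⁻² (k / n) cs(2πka/n)`, where `cs` is `cos` or `sin` as `n ≡ 1` or `3 mod 4`. -/
noncomputable def jacobiFourier (n : ℕ) (a : ℝ) : ℝ :=
  ∑' k : ℕ, 1 / (k : ℝ) ^ 2 * (J((k : ℤ) | n) * cosOrSin n (2 * Real.pi * k * a / n))

theorem sum_jacobiSym_mul_cos {n : ℕ} (hn : Odd n) (hsq : Squarefree n) (k : ℕ) (a : ℝ) :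
    ∑ r ∈ Finset.range n, (J(r | n) : ℝ) * Real.cos (2 * Real.pi * k * ((a - r) / n)) =
      √n * (J(k | n) * cosOrSin n (2 * Real.pi * k * a / n)) := by
  have h := jacobi_gauss_sum hn hsq k
  set θ : ℝ := 2 * Real.pi * k * a / n with hθ
  have h1 : ∀ r : ℕ, Real.cos (2 * Real.pi * k * ((a - r) / n)) =
      (Complex.exp (θ * Complex.I) * (starRingEnd ℂ) (Complex.exp (2 * Real.pi * Complex.I * r * (k : ℤ) / n))).re := by
    intro r
    have h2 : (2 * Real.pi * Complex.I * r * (k : ℤ) / n : ℂ) = ((2 * Real.pi * r * k / n : ℝ) : ℂ) * Complex.I := by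
      push_cast; ring
    rw [h2, ← Complex.exp_conj, map_mul, Complex.conj_ofReal, Complex.conj_I, ← Complex.exp_add]
    have h3 : (θ * Complex.I + ((2 * Real.pi * r * k / n : ℝ) : ℂ) * -Complex.I : ℂ)
      = ((2 * Real.pi * k * ((a - r) / n) : ℝ) : ℂ) * Complex.I := by
      rw [hθ]; push_cast; ring
    rw [h3, Complex.exp_ofReal_mul_I_re]
  have h2 := congrArg (fun z => (Complex.exp (θ * Complex.I) * (starRingEnd ℂ) z).re) h
  simp only [map_sum, Finset.mul_sum, Complex.re_sum] at h2
  have h3 : ∀ r ∈ Finset.range n, (J(r | n) : ℝ) * Real.cos (2 * Real.pi * k * ((a - r) / n)) =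
      (Complex.exp (θ * Complex.I) * (starRingEnd ℂ) ((J((r : ℤ) | n) : ℂ) *
        Complex.exp (2 * Real.pi * Complex.I * r * (k : ℤ) / n))).re := by
    intro r _
    rw [h1, map_mul, mul_left_comm, map_intCast, ← Complex.re_ofReal_mul, Complex.ofReal_intCast]
  rw [Finset.sum_congr rfl h3, h2]
  simp only [map_mul, map_intCast, Complex.conj_ofReal]
  have h4 : (Complex.exp (θ * Complex.I) * ((J((k : ℤ) | n) : ℂ) * ((starRingEnd ℂ) (gaussUnit n) * (√(n : ℝ) : ℂ)))).re
    = √n * (J(k | n) * (Complex.exp (θ * Complex.I) * (starRingEnd ℂ) (gaussUnit n)).re) := by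
    rw [← Complex.re_ofReal_mul, ← Complex.re_ofReal_mul]
    congr 1; push_cast; ring
  rw [h4]
  congr 2
  unfold gaussUnit cosOrSin
  split_ifs
  · rw [map_one, mul_one, Complex.exp_ofReal_mul_I_re]
  · rw [Complex.conj_I, mul_neg, Complex.neg_re, Complex.mul_I_re, neg_neg,
      Complex.exp_ofReal_mul_I_im]

theorem summable_one_div_sq_mul_of_abs_le {f : ℕ → ℝ} {C : ℝ} (hf : ∀ k, |f k| ≤ C) :
    Summable (fun k : ℕ => 1 / (k : ℝ) ^ 2 * f k) := by
  refine Summable.of_norm_bounded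
    ((Real.summable_one_div_nat_pow.mpr one_lt_two).mul_left C) fun k => ?_
  rw [norm_mul, mul_comm]
  refine mul_le_mul (hf k) ?_ (norm_nonneg _) ((abs_nonneg _).trans (hf k))
  rw [Real.norm_of_nonneg (by positivity)]

theorem abs_jacobiSym_mul_cosOrSin_le (j : ℤ) (n n' : ℕ) (x : ℝ) :
    |(J(j | n) : ℝ) * cosOrSin n' x| ≤ 1 := by
  rw [abs_mul]
  exact mul_le_one₀ (abs_jacobiSym_cast_le _ _) (abs_nonneg _) (abs_cosOrSin_le _ _)

theorem sum_trapezoid_mul_jacobiSym {X D : ℝ} (hX : 0 ≤ X) (hD : 0 < D) {n : ℕ} (hn : Odd n)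
    (hsq : Squarefree n) {B : ℕ} (hB : X + D ≤ B) :
    ∑ m ∈ Finset.range (B + 1), trapezoid X D m * J(m | n) =
      (if n = 1 then X else 0) - n * √n / (2 * Real.pi ^ 2 * D) * secondDiff (jacobiFourier n) X D := by
  have hn0 := hn.pos
  have hnR : (n : ℝ) ≠ 0 := by exact_mod_cast hn0.ne'
  have h1 : ∑ m ∈ Finset.range (B + 1), trapezoid X D m * J(m | n) =
      ∑ m ∈ Finset.range ((B + 1) * n), trapezoid X D m * J(m | n) := by
    refine Finset.sum_subset (Finset.range_mono (Nat.le_mul_of_pos_right _ hn0)) fun m _ hm => ?_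
    rw [Finset.mem_range, not_lt] at hm
    have : (B : ℝ) ≤ m := by exact_mod_cast (Nat.le_succ B).trans hm
    rw [trapezoid_eq_zero hX hD.le (hB.trans this), zero_mul]
  rw [h1, sum_range_mul_eq_residues]
  have h2 : ∀ r ∈ Finset.range n, ∑ j ∈ Finset.range (B + 1),
      trapezoid X D ((r + n * j : ℕ) : ℝ) * (J(((r + n * j : ℕ) : ℤ) | n) : ℝ) =
      J(r | n) * (X / n) - n / (2 * Real.pi ^ 2 * D) * (J(r | n) * secondDiff (fun a => ∑' k : ℕ,
        1 / (k : ℝ) ^ 2 * Real.cos (2 * Real.pi * k * ((a - r) / n))) X D) := by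
    intro r hr
    have h3 : ∀ j : ℕ, J(((r + n * j : ℕ) : ℤ) | n) = J(r | n) := by
      intro j
      apply jacobiSym.mod_left'
      push_cast
      rw [Int.add_mul_emod_self_left]
    simp_rw [h3]
    rw [← Finset.sum_mul, sum_trapezoid_residue hX hD (Finset.mem_range.mp hr) hB]
    ring
  rw [Finset.sum_congr rfl h2, Finset.sum_sub_distrib, ← Finset.sum_mul, ← Finset.mul_sum]
  congr 1
  · have h4 := jacobi_gauss_sum hn hsq 0
    simp only [Int.cast_zero, mul_zero, zero_div, Complex.exp_zero, mul_one] at h4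
    have h5 : ∑ r ∈ Finset.range n, (J(r | n) : ℝ) = if n = 1 then 1 else 0 := by
      split_ifs with h
      · subst h; simp
      · have : J(0 | n) = 0 := jacobiSym.zero_left (by omega)
        rw [this, Int.cast_zero, zero_mul] at h4
        exact_mod_cast h4
    rw [h5]
    split_ifs with h
    · subst h; simp
    · simp
  · have h6 : ∀ a : ℝ, ∑ r ∈ Finset.range n, (J(r | n) : ℝ) * ∑' k : ℕ,
        1 / (k : ℝ) ^ 2 * Real.cos (2 * Real.pi * k * ((a - r) / n)) = √n * jacobiFourier n a := by
      intro a
      unfold jacobiFourier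
      simp_rw [← tsum_mul_left]
      rw [← Summable.tsum_finsetSum]
      · refine tsum_congr fun k => ?_
        rw [mul_left_comm (√(n : ℝ)), ← sum_jacobiSym_mul_cos hn hsq, Finset.mul_sum]
        refine Finset.sum_congr rfl fun r _ => by ring
      · intro r _
        exact (hasSum_cos_div_sq _).summable.mul_left _
    have h7 : ∑ r ∈ Finset.range n, (J(r | n) : ℝ) * secondDiff (fun a => ∑' k : ℕ,
        1 / (k : ℝ) ^ 2 * Real.cos (2 * Real.pi * k * ((a - r) / n))) X D =
        √n * secondDiff (jacobiFourier n) X D := by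
      unfold secondDiff
      simp only [mul_add, mul_sub, Finset.sum_add_distrib, Finset.sum_sub_distrib, h6]
    rw [h7]; ring

/-- The alternating sum `∑_k (-1)^k k⁻² (k / n) cs(πka/n)`. -/
noncomputable def jacobiFourierAlt (n : ℕ) (a : ℝ) : ℝ :=
  ∑' k : ℕ, 1 / (k : ℝ) ^ 2 * ((-1) ^ k * (J((k : ℤ) | n) * cosOrSin n (Real.pi * k * a / n)))

theorem jacobiFourierAlt_eq {n : ℕ} (a : ℝ) :
    jacobiFourierAlt n a = J(2 | n) / 2 * jacobiFourier n a - jacobiFourier n (a / 2) := by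
  set F : ℕ → ℝ := fun k => 1 / (k : ℝ) ^ 2 * (J((k : ℤ) | n) * cosOrSin n (Real.pi * k * a / n)) with hF
  have hFs : Summable F := summable_one_div_sq_mul_of_abs_le fun k => abs_jacobiSym_mul_cosOrSin_le _ _ _ _
  have hinj : Function.Injective (fun k : ℕ => 2 * k) := fun a b h => by simpa using h
  have hinj' : Function.Injective (fun k : ℕ => 2 * k + 1) := fun a b h => by simpa using h
  have he : Summable fun k => F (2 * k) := hFs.comp_injective hinj
  have ho : Summable fun k => F (2 * k + 1) := hFs.comp_injective hinj'
  have h1 : jacobiFourier n (a / 2) = ∑' k, F (2 * k) + ∑' k, F (2 * k + 1) := by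
    rw [tsum_even_add_odd he ho]
    refine tsum_congr fun k => ?_
    simp only [hF]
    congr 3; ring
  have h2 : jacobiFourierAlt n a = ∑' k, F (2 * k) - ∑' k, F (2 * k + 1) := by
    have h3 : jacobiFourierAlt n a = ∑' k, (-1) ^ k * F k := by
      refine tsum_congr fun k => ?_
      simp only [hF]; ring
    rw [h3, ← tsum_even_add_odd (f := fun k => (-1) ^ k * F k)]
    · simp [pow_add, pow_mul, tsum_neg, sub_eq_add_neg]
    · simpa [pow_mul] using he
    · simpa [pow_add, pow_mul] using ho.neg
  have h3 : J(2 | n) / 2 * jacobiFourier n a = 2 * ∑' k, F (2 * k) := by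
    unfold jacobiFourier
    rw [← tsum_mul_left, ← tsum_mul_left]
    refine tsum_congr fun k => ?_
    simp only [hF]
    push_cast
    rw [jacobiSym.mul_left, show Real.pi * (2 * k) * a / n = 2 * Real.pi * k * a / n by ring]
    push_cast
    rw [mul_pow, one_div, one_div, mul_inv]
    ring
  rw [h3, h1, h2]; ring

theorem sum_trapezoid_mul_jacobiSym_odd {X D : ℝ} (hX : 0 ≤ X) (hD : 0 < D) {n : ℕ} (hn : Odd n)
    (hsq : Squarefree n) {B : ℕ} (hB : X + D ≤ B) :
    ∑ m ∈ (Finset.range ((B + 1) * 2)).filter (fun m => Odd m), trapezoid X D m * J(m | n) =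
      (if n = 1 then X / 2 else 0) -
        n * √n / (Real.pi ^ 2 * D) * (J(2 | n) * secondDiff (jacobiFourierAlt n) X D) := by
  have h1 := sum_trapezoid_mul_jacobiSym hX hD hn hsq (B := 2 * B + 1) (by push_cast; nlinarith)
  rw [show 2 * B + 1 + 1 = (B + 1) * 2 by ring, sum_range_mul_eq_residues, Finset.sum_range_succ,
    Finset.sum_range_one] at h1
  have h2 := sum_trapezoid_mul_jacobiSym (X := X / 2) (D := D / 2) (by positivity) (by positivity)
    hn hsq (B := B) (by linarith)
  have h3 : ∑ j ∈ Finset.range (B + 1), trapezoid X D ((0 + 2 * j : ℕ) : ℝ) *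
      (J(((0 + 2 * j : ℕ) : ℤ) | n) : ℝ) =
      J(2 | n) * ∑ m ∈ Finset.range (B + 1), trapezoid (X / 2) (D / 2) m * J(m | n) := by
    rw [Finset.mul_sum]
    refine Finset.sum_congr rfl fun j _ => ?_
    push_cast
    rw [zero_add, zero_add, trapezoid_mul_left _ _ _ two_pos, jacobiSym.mul_left]
    push_cast; ring
  rw [h3, h2] at h1
  rw [Finset.sum_filter, sum_range_mul_eq_residues, Finset.sum_range_succ, Finset.sum_range_one]
  have h4 : ∑ j ∈ Finset.range (B + 1), (if Odd (0 + 2 * j) then trapezoid X D ((0 + 2 * j : ℕ) : ℝ) *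
      (J(((0 + 2 * j : ℕ) : ℤ) | n) : ℝ) else 0) = 0 := by
    refine Finset.sum_eq_zero fun j _ => ?_
    rw [if_neg]; simp
  have h5 : ∑ j ∈ Finset.range (B + 1), (if Odd (1 + 2 * j) then trapezoid X D ((1 + 2 * j : ℕ) : ℝ) *
      (J(((1 + 2 * j : ℕ) : ℤ) | n) : ℝ) else 0) =
      ∑ j ∈ Finset.range (B + 1), trapezoid X D ((1 + 2 * j : ℕ) : ℝ) * (J(((1 + 2 * j : ℕ) : ℤ) | n) : ℝ) := by
    refine Finset.sum_congr rfl fun j _ => ?_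
    rw [if_pos]; exact ⟨j, by ring⟩
  rw [h4, h5, zero_add, eq_sub_of_add_eq' h1]
  have hJ : (J(2 | n) : ℝ) * J(2 | n) = 1 := by
    have : J(2 | n) ^ 2 = 1 := jacobiSym.sq_one (by
      have := Nat.coprime_two_left.mpr hn
      exact_mod_cast this)
    rw [← sq]; exact_mod_cast this
  have h6 : (J(2 | n) : ℝ) * secondDiff (jacobiFourierAlt n) X D =
      1 / 2 * secondDiff (jacobiFourier n) X D
        - J(2 | n) * secondDiff (jacobiFourier n) (X / 2) (D / 2) := by
    unfold secondDiff
    simp only [jacobiFourierAlt_eq]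
    rw [← add_div, zero_div]
    linear_combination (1 / 2 * (jacobiFourier n (X + D) - jacobiFourier n X - jacobiFourier n D
      + jacobiFourier n 0)) * hJ
  rw [h6]
  have := Real.pi_pos.ne'
  split_ifs with h
  · subst h
    simp only [jacobiSym.one_right]
    push_cast
    field_simp
    ring
  · field_simp
    ring

/-- The completed Jacobi symbol `∑_{l² ∣ M, l² ∣ N} l ((M / l²) / (N / l²))`. -/
noncomputable def completedJacobi (M N : ℕ) : ℝ :=
  ∑ l ∈ N.divisors.filter (fun l => l * l ∣ N ∧ l * l ∣ M),
    (l : ℝ) * J(((M / (l * l) : ℕ) : ℤ) | N / (l * l))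

theorem mul_self_dvd_sq_mul_squarefree_iff {s q l : ℕ} (hs : 0 < s) (hq : Squarefree q) :
    l * l ∣ s ^ 2 * q ↔ l ∣ s := by
  constructor
  · intro h
    rcases Nat.eq_zero_or_pos l with rfl | hl
    · have : s ^ 2 * q = 0 := by simpa using h
      have hq0 : q ≠ 0 := hq.ne_zero
      have : 0 < s ^ 2 * q := by positivity
      omega
    obtain ⟨g, l', s', hg, hcop, rfl, rfl⟩ := Nat.exists_coprime' (m := l) (n := s) (Nat.gcd_pos_of_pos_left _ hl)
    have h1 : l' * l' ∣ s' ^ 2 * q := by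
      have e1 : l' * g * (l' * g) = g ^ 2 * (l' * l') := by ring
      have e2 : (s' * g) ^ 2 * q = g ^ 2 * (s' ^ 2 * q) := by ring
      rw [e1, e2] at h
      exact Nat.dvd_of_mul_dvd_mul_left (by positivity) h
    have h2 : l' * l' ∣ q := by
      have : Nat.Coprime (l' * l') (s' ^ 2) := (Nat.Coprime.mul_left hcop hcop).pow_right 2
      exact this.dvd_of_dvd_mul_left h1
    have h3 : l' = 1 := Nat.isUnit_iff.mp (hq l' h2)
    rw [h3, one_mul]
    exact Dvd.intro_left s' rfl
  · rintro ⟨c, rfl⟩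
    exact ⟨c ^ 2 * q, by ring⟩

theorem mem_divisors_and_mem_divisors_div_iff {s l d : ℕ} :
    (l ∈ s.divisors ∧ d ∈ (s / l).divisors) ↔ (l * d ∣ s ∧ s ≠ 0) := by
  simp only [Nat.mem_divisors]
  constructor
  · rintro ⟨⟨⟨c, rfl⟩, h0⟩, h1, h2⟩
    have hl : 0 < l := Nat.pos_of_ne_zero (by rintro rfl; simp at h0)
    rw [Nat.mul_div_cancel_left _ hl] at h1
    exact ⟨Nat.mul_dvd_mul_left _ h1, h0⟩
  · rintro ⟨⟨c, rfl⟩, h0⟩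
    have hl : 0 < l := Nat.pos_of_ne_zero (by rintro rfl; simp at h0)
    rw [mul_assoc, Nat.mul_div_cancel_left _ hl]
    rw [mul_assoc] at h0
    exact ⟨⟨Dvd.intro _ rfl, h0⟩, Dvd.intro _ rfl, right_ne_zero_of_mul h0⟩

theorem sum_divisors_divisors_comm {R : Type*} [AddCommMonoid R] (s : ℕ) (f : ℕ → ℕ → R) :
    ∑ l ∈ s.divisors, ∑ d ∈ (s / l).divisors, f l d =
      ∑ d ∈ s.divisors, ∑ l ∈ (s / d).divisors, f l d := by
  refine Finset.sum_comm' fun l d => ?_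
  rw [mem_divisors_and_mem_divisors_div_iff, and_comm (a := l ∈ _),
    mem_divisors_and_mem_divisors_div_iff, mul_comm]

/-- The involution `(l, d) ↦ (s / (l d), d)` on factorizations. -/
theorem sum_divisors_divisors_flip {R : Type*} [AddCommMonoid R] (s : ℕ) (f : ℕ → ℕ → R) :
    ∑ l ∈ s.divisors, ∑ d ∈ (s / l).divisors, f l d =
      ∑ e ∈ s.divisors, ∑ d ∈ (s / e).divisors, f (s / d / e) d := by
  rw [sum_divisors_divisors_comm, sum_divisors_divisors_comm s (fun e d => f (s / d / e) d)]
  refine Finset.sum_congr rfl fun d _ => ?_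
  exact (Nat.sum_div_divisors (s / d) (fun l => f l d)).symm

theorem sum_divisors_coprimeDensity {s : ℕ} (hs : s ≠ 0) :
    ∑ l ∈ s.divisors, 1 / (l : ℝ) * coprimeDensity (s / l) = 1 := by
  unfold coprimeDensity
  simp_rw [Finset.mul_sum]
  rw [sum_divisors_divisors_flip]
  have h1 : ∀ e ∈ s.divisors, ∑ d ∈ (s / e).divisors,
      1 / ((s / d / e : ℕ) : ℝ) * ((ArithmeticFunction.moebius d : ℝ) / d) =
      (e : ℝ) / s * (if s / e = 1 then 1 else 0) := by
    intro e he
    have hsum := sum_divisors_moebius (s / e)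
    have hsum' : ∑ d ∈ (s / e).divisors, (ArithmeticFunction.moebius d : ℝ) = if s / e = 1 then 1 else 0 := by
      rw [← Int.cast_sum, hsum]; simp
    rw [← hsum', Finset.mul_sum]
    refine Finset.sum_congr rfl fun d hd => ?_
    obtain ⟨⟨c, hc⟩, -⟩ := mem_divisors_and_mem_divisors_div_iff.mp ⟨he, hd⟩
    have he0 : e ≠ 0 := by rintro rfl; simp at hc; exact hs hc
    have hd0 : d ≠ 0 := by rintro rfl; simp at hc; exact hs hc
    have hc0 : c ≠ 0 := by rintro rfl; simp at hc; exact hs hc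
    have : s / d / e = c := by
      rw [hc, Nat.div_div_eq_div_mul, mul_comm d e, Nat.mul_div_cancel_left _ (by positivity)]
    rw [this, hc]; push_cast
    have : (e : ℝ) ≠ 0 := by exact_mod_cast he0
    have : (d : ℝ) ≠ 0 := by exact_mod_cast hd0
    have : (c : ℝ) ≠ 0 := by exact_mod_cast hc0
    field_simp
  rw [Finset.sum_congr rfl h1, Finset.sum_eq_single s]
  · have : (s : ℝ) ≠ 0 := by exact_mod_cast hs
    rw [Nat.div_self (Nat.pos_of_ne_zero hs)]; simp [this]
  · intro e he hes
    rw [if_neg, mul_zero]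
    intro h
    apply hes
    have h2 := Nat.div_mul_cancel (Nat.dvd_of_mem_divisors he)
    rw [h, one_mul] at h2; exact h2
  · intro h; exact absurd (Nat.mem_divisors_self s hs) h

theorem completedJacobi_eq {s q : ℕ} (hs : 0 < s) (hq : Squarefree q) (M : ℕ) :
    completedJacobi M (s ^ 2 * q) = ∑ l ∈ s.divisors, ∑ d ∈ (s / l).divisors,
      ((l : ℝ) * ArithmeticFunction.moebius d * J((d : ℤ) | q)) *
        if l ^ 2 * d ∣ M then (J(((M / (l ^ 2 * d) : ℕ) : ℤ) | q) : ℝ) else 0 := by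
  have hq0 : q ≠ 0 := hq.ne_zero
  have hN : s ^ 2 * q ≠ 0 := by positivity
  have hset : (s ^ 2 * q).divisors.filter (fun l => l * l ∣ s ^ 2 * q ∧ l * l ∣ M) =
      s.divisors.filter (fun l => l * l ∣ M) := by
    ext l
    simp only [Finset.mem_filter, Nat.mem_divisors, mul_self_dvd_sq_mul_squarefree_iff hs hq]
    constructor
    · rintro ⟨-, h1, h2⟩; exact ⟨⟨h1, hs.ne'⟩, h2⟩
    · rintro ⟨⟨h1, -⟩, h2⟩
      exact ⟨⟨(h1.trans (dvd_pow_self s two_ne_zero)).mul_right _, hN⟩, h1, h2⟩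
  rw [completedJacobi, hset, Finset.sum_filter]
  refine Finset.sum_congr rfl fun l hl => ?_
  obtain ⟨⟨s', hs'⟩, -⟩ := Nat.mem_divisors.mp hl
  have hl0 : 0 < l := Nat.pos_of_ne_zero (by rintro rfl; simp at hs'; omega)
  have hs'0 : 0 < s' := Nat.pos_of_ne_zero (by rintro rfl; simp at hs'; omega)
  have hsl : s / l = s' := by rw [hs', Nat.mul_div_cancel_left _ hl0]
  rw [hsl]
  split_ifs with hlM
  · obtain ⟨M', rfl⟩ := hlM
    have e1 : l * l * M' / (l * l) = M' := Nat.mul_div_cancel_left _ (by positivity)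
    have e2 : s ^ 2 * q / (l * l) = s' ^ 2 * q := by
      rw [hs', show (l * s') ^ 2 * q = l * l * (s' ^ 2 * q) by ring, Nat.mul_div_cancel_left _ (by positivity)]
    have : NeZero s' := ⟨hs'0.ne'⟩
    have : NeZero q := ⟨hq0⟩
    rw [e1, e2, jacobiSym.mul_right, jacobiSym.pow_right]
    have h1 : (J((M' : ℤ) | s') ^ 2 : ℤ) = if s'.Coprime M' then 1 else 0 := by
      split_ifs with h
      · exact jacobiSym.sq_one (by simpa using h.symm)
      · rw [jacobiSym.eq_zero_iff_not_coprime.mpr (by simpa [Nat.coprime_comm] using h)]; simp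
    have h2 := sum_divisors_filter_dvd_moebius hs'0.ne' M'
    have h1' : ((J((M' : ℤ) | s') ^ 2 : ℤ) : ℝ) = ∑ d ∈ s'.divisors.filter (· ∣ M'), (ArithmeticFunction.moebius d : ℝ) := by
      rw [h1, h2]; simp
    rw [Int.cast_mul, h1', Finset.sum_filter, Finset.sum_mul, Finset.mul_sum]
    refine Finset.sum_congr rfl fun d hd => ?_
    have hd0 : 0 < d := Nat.pos_of_mem_divisors hd
    have h3 : l ^ 2 * d ∣ l * l * M' ↔ d ∣ M' := by
      rw [sq]; exact Nat.mul_dvd_mul_iff_left (by positivity)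
    simp only [h3]
    split_ifs with hdM
    · obtain ⟨c, rfl⟩ := hdM
      rw [show l * l * (d * c) = l ^ 2 * d * c by ring, Nat.mul_div_cancel_left _ (by positivity)]
      push_cast
      rw [jacobiSym.mul_left]; push_cast; ring
    · simp
  · symm
    refine Finset.sum_eq_zero fun d _ => ?_
    rw [if_neg, mul_zero]
    intro h
    exact hlM ((sq l ▸ Dvd.intro d rfl : l * l ∣ l ^ 2 * d).trans h)

/-- `∑_k (-1)^k k⁻² a(k, N) cs_N(πka/N)` with `a` the completed Jacobi symbol. -/
noncomputable def completedFourier (N : ℕ) (a : ℝ) : ℝ :=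
  ∑' k : ℕ, 1 / (k : ℝ) ^ 2 * ((-1) ^ k * (completedJacobi k N * cosOrSin N (Real.pi * k * a / N)))

theorem tsum_ite_dvd {c : ℕ} (hc : 0 < c) (f : ℕ → ℝ) :
    ∑' k : ℕ, (if c ∣ k then f k else 0) = ∑' j : ℕ, f (c * j) := by
  have hinj : Function.Injective (fun j : ℕ => c * j) := fun a b h => Nat.eq_of_mul_eq_mul_left hc h
  rw [← hinj.tsum_eq (f := fun k => if c ∣ k then f k else 0)]
  · simp
  · intro k hk
    have : c ∣ k := by
      by_contra h; simp [h] at hk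
    obtain ⟨j, rfl⟩ := this
    exact ⟨j, rfl⟩

theorem summable_ite_dvd_jacobi {c n n' : ℕ} {g : ℕ → ℕ} {x : ℕ → ℝ} :
    Summable fun k : ℕ => 1 / (k : ℝ) ^ 2 * ((-1) ^ k * ((if c ∣ k then (J((g k : ℤ) | n) : ℝ) else 0)
      * cosOrSin n' (x k))) := by
  refine summable_one_div_sq_mul_of_abs_le (C := 1) fun k => ?_
  rw [abs_mul, abs_pow, abs_neg, abs_one, one_pow, one_mul]
  split_ifs
  · exact abs_jacobiSym_mul_cosOrSin_le _ _ _ _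
  · simp

theorem cosOrSin_congr {n n' : ℕ} (h : n % 4 = n' % 4) (x : ℝ) : cosOrSin n x = cosOrSin n' x := by
  unfold cosOrSin; rw [h]

theorem sq_mul_mod_four {s q : ℕ} (hs : Odd s) : (s ^ 2 * q) % 4 = q % 4 := by
  obtain ⟨j, rfl⟩ := hs
  have : (2 * j + 1) ^ 2 * q = q + 4 * ((j ^ 2 + j) * q) := by ring
  rw [this, Nat.add_mul_mod_self_left]

theorem tsum_completed_term {s q : ℕ} (hs : Odd s) (hqo : Odd q) {e d : ℕ} (hed : e * d ∣ s) (a : ℝ) :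
    ∑' k : ℕ, 1 / (k : ℝ) ^ 2 * ((-1) ^ k * ((if e ^ 2 * d ∣ k then
      (J(((k / (e ^ 2 * d) : ℕ) : ℤ) | q) : ℝ) else 0) *
        cosOrSin (s ^ 2 * q) (Real.pi * k * a / ((s ^ 2 * q : ℕ) : ℝ)))) =
      1 / ((e : ℝ) ^ 2 * d) ^ 2 * jacobiFourierAlt q (a / ((s / d / e : ℕ) ^ 2 * d)) := by
  obtain ⟨l, hl⟩ := hed
  have hs0 := hs.pos
  have he0 : 0 < e := Nat.pos_of_ne_zero (by rintro rfl; simp at hl; omega)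
  have hd0 : 0 < d := Nat.pos_of_ne_zero (by rintro rfl; simp at hl; omega)
  have hl0 : 0 < l := Nat.pos_of_ne_zero (by rintro rfl; simp at hl; omega)
  have hsl : s / d / e = l := by
    rw [hl, Nat.div_div_eq_div_mul, mul_comm d e, Nat.mul_div_cancel_left _ (by positivity)]
  have hco : Odd (e ^ 2 * d) := by
    rw [hl] at hs
    have h1 := (Nat.odd_mul.mp (Nat.odd_mul.mp hs).1)
    exact (h1.1.pow).mul h1.2
  have hc0 : 0 < e ^ 2 * d := by positivity
  have h1 : ∀ k : ℕ, 1 / (k : ℝ) ^ 2 * ((-1) ^ k * ((if e ^ 2 * d ∣ k then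
      (J(((k / (e ^ 2 * d) : ℕ) : ℤ) | q) : ℝ) else 0) *
        cosOrSin (s ^ 2 * q) (Real.pi * k * a / ((s ^ 2 * q : ℕ) : ℝ)))) =
      if e ^ 2 * d ∣ k then 1 / (k : ℝ) ^ 2 * ((-1) ^ k * (
      (J(((k / (e ^ 2 * d) : ℕ) : ℤ) | q) : ℝ) *
        cosOrSin (s ^ 2 * q) (Real.pi * k * a / ((s ^ 2 * q : ℕ) : ℝ)))) else 0 := by
    intro k; split_ifs <;> simp
  simp_rw [h1]
  rw [tsum_ite_dvd hc0, hsl, jacobiFourierAlt, ← tsum_mul_left]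
  refine tsum_congr fun j => ?_
  rw [Nat.mul_div_cancel_left _ hc0, pow_mul, hco.neg_one_pow, cosOrSin_congr (sq_mul_mod_four hs)]
  have e1 : Real.pi * ((e ^ 2 * d * j : ℕ) : ℝ) * a / ((s ^ 2 * q : ℕ) : ℝ) =
      Real.pi * j * (a / ((l : ℝ) ^ 2 * d)) / q := by
    rw [hl]; push_cast
    have : (e : ℝ) ≠ 0 := by exact_mod_cast he0.ne'
    have : (d : ℝ) ≠ 0 := by exact_mod_cast hd0.ne'
    have : (l : ℝ) ≠ 0 := by exact_mod_cast hl0.ne'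
    have : (q : ℝ) ≠ 0 := by exact_mod_cast hqo.pos.ne'
    field_simp
  rw [e1]
  push_cast
  rw [mul_pow, one_div, one_div, one_div, mul_inv]
  ring

theorem completedFourier_eq {s q : ℕ} (hs : Odd s) (hqo : Odd q) (hq : Squarefree q) (a : ℝ) :
    ∑ l ∈ s.divisors, ∑ d ∈ (s / l).divisors,
      ((l : ℝ) * ArithmeticFunction.moebius d * J((d : ℤ) | q)) * ((l : ℝ) ^ 2 * d) *
        jacobiFourierAlt q (a / ((l : ℝ) ^ 2 * d)) =
      (s : ℝ) ^ 3 * completedFourier (s ^ 2 * q) a := by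
  have hs0 := hs.pos
  have h1 : completedFourier (s ^ 2 * q) a = ∑ e ∈ s.divisors, ∑ d ∈ (s / e).divisors,
      ((e : ℝ) * ArithmeticFunction.moebius d * J((d : ℤ) | q)) *
       (1 / ((e : ℝ) ^ 2 * d) ^ 2 * jacobiFourierAlt q (a / ((s / d / e : ℕ) ^ 2 * d))) := by
    have h2 : ∀ k : ℕ, 1 / (k : ℝ) ^ 2 * ((-1) ^ k * (completedJacobi k (s ^ 2 * q) *
        cosOrSin (s ^ 2 * q) (Real.pi * k * a / ((s ^ 2 * q : ℕ) : ℝ)))) =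
        ∑ e ∈ s.divisors, ∑ d ∈ (s / e).divisors,
        ((e : ℝ) * ArithmeticFunction.moebius d * J((d : ℤ) | q)) *
         (1 / (k : ℝ) ^ 2 * ((-1) ^ k * ((if e ^ 2 * d ∣ k then
      (J(((k / (e ^ 2 * d) : ℕ) : ℤ) | q) : ℝ) else 0) *
        cosOrSin (s ^ 2 * q) (Real.pi * k * a / ((s ^ 2 * q : ℕ) : ℝ))))) := by
      intro k
      rw [completedJacobi_eq hs0 hq]
      simp only [Finset.sum_mul, Finset.mul_sum]
      refine Finset.sum_congr rfl fun e _ => Finset.sum_congr rfl fun d _ => by ring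
    unfold completedFourier
    simp_rw [h2]
    rw [Summable.tsum_finsetSum (fun e _ => summable_sum fun d _ => Summable.mul_left _ summable_ite_dvd_jacobi)]
    refine Finset.sum_congr rfl fun e he => ?_
    rw [Summable.tsum_finsetSum (fun d _ => Summable.mul_left _ summable_ite_dvd_jacobi)]
    refine Finset.sum_congr rfl fun d hd => ?_
    rw [tsum_mul_left, tsum_completed_term hs hqo
      (mem_divisors_and_mem_divisors_div_iff.mp ⟨he, hd⟩).1]
  rw [sum_divisors_divisors_flip, h1, Finset.mul_sum]
  refine Finset.sum_congr rfl fun e he => ?_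
  rw [Finset.mul_sum]
  refine Finset.sum_congr rfl fun d hd => ?_
  obtain ⟨⟨l, hl⟩, -⟩ := mem_divisors_and_mem_divisors_div_iff.mp ⟨he, hd⟩
  have he0 : 0 < e := Nat.pos_of_ne_zero (by rintro rfl; simp at hl; omega)
  have hd0 : 0 < d := Nat.pos_of_ne_zero (by rintro rfl; simp at hl; omega)
  have hsl : s / d / e = l := by
    rw [hl, Nat.div_div_eq_div_mul, mul_comm d e, Nat.mul_div_cancel_left _ (by positivity)]
  rw [hsl]
  have : (e : ℝ) ≠ 0 := by exact_mod_cast he0.ne'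
  have : (d : ℝ) ≠ 0 := by exact_mod_cast hd0.ne'
  rw [hl]; push_cast
  field_simp

theorem sum_range_filter_odd_dvd {c : ℕ} (hc : Odd c) {R : ℕ} {F : ℕ → ℝ} (hF : ∀ m, R ≤ m → F m = 0) :
    ∑ M ∈ (Finset.range R).filter (fun M => Odd M), (if c ∣ M then F M else 0) =
      ∑ m ∈ (Finset.range R).filter (fun m => Odd m), F (c * m) := by
  have hc0 := hc.pos
  rw [← Finset.sum_filter, Finset.filter_filter]
  have h1 : ∑ m ∈ (Finset.range R).filter (fun m => Odd m), F (c * m) =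
      ∑ m ∈ ((Finset.range R).filter (fun m => Odd m)).filter (fun m => c * m < R), F (c * m) := by
    symm
    apply Finset.sum_filter_of_ne
    intro m _ hm
    by_contra h
    exact hm (hF _ (not_lt.mp h))
  rw [h1]
  symm
  refine Finset.sum_nbij' (fun m => c * m) (fun M => M / c) ?_ ?_ ?_ ?_ ?_
  · intro m hm
    simp only [Finset.mem_filter, Finset.mem_range] at hm ⊢
    exact ⟨hm.2, hc.mul hm.1.2, Dvd.intro _ rfl⟩
  · intro M hM
    simp only [Finset.mem_filter, Finset.mem_range] at hM ⊢
    obtain ⟨h1, h2, m, rfl⟩ := hM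
    rw [Nat.mul_div_cancel_left _ hc0]
    exact ⟨⟨lt_of_le_of_lt (Nat.le_mul_of_pos_left _ hc0) h1, (Nat.odd_mul.mp h2).2⟩, h1⟩
  · intro m _; exact Nat.mul_div_cancel_left _ hc0
  · intro M hM
    simp only [Finset.mem_filter, Finset.mem_range] at hM
    exact Nat.mul_div_cancel' hM.2.2
  · intro m _; rfl

theorem isSquare_sq_mul_squarefree_iff {s q : ℕ} (hs : 0 < s) (hq : Squarefree q) :
    IsSquare (s ^ 2 * q) ↔ q = 1 := by
  constructor
  · rintro ⟨t, ht⟩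
    have h1 : s ∣ t := by
      have : s ^ 2 ∣ t ^ 2 := ⟨q, by rw [sq t, ← ht]⟩
      exact (Nat.pow_dvd_pow_iff two_ne_zero).mp this
    obtain ⟨u, rfl⟩ := h1
    have h2 : q = u * u := by
      have : s ^ 2 * q = s ^ 2 * (u * u) := by rw [ht]; ring
      exact Nat.eq_of_mul_eq_mul_left (by positivity) this
    have h3 := Nat.isUnit_iff.mp (hq u ⟨1, by rw [mul_one, h2]⟩)
    rw [h2, h3]
  · rintro rfl; exact ⟨s, by ring⟩

/-- Poisson summation for the completed Jacobi symbol with a trapezoidal weight. -/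
theorem sum_trapezoid_mul_completedJacobi {X D : ℝ} (hX : 0 ≤ X) (hD : 0 < D) {N : ℕ} (hN : Odd N)
    {B : ℕ} (hB : X + D ≤ B) :
    ∑ M ∈ (Finset.range ((B + 1) * 2)).filter (fun M => Odd M), trapezoid X D M * completedJacobi M N =
      (if IsSquare N then X / 2 else 0) -
        N * √N / (Real.pi ^ 2 * D) * (J(2 | N) * secondDiff (completedFourier N) X D) := by
  obtain ⟨q, s, hsq, hq⟩ := Nat.sq_mul_squarefree N
  subst hsq
  have hqo : Odd q := (Nat.odd_mul.mp hN).2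
  have hs : Odd s := (Nat.odd_mul.mp hN).1.of_dvd_nat (dvd_pow_self s two_ne_zero)
  have hs0 := hs.pos
  have hBR : X + D ≤ ((B + 1) * 2 : ℕ) := by push_cast; linarith
  have hterm : ∀ l ∈ s.divisors, ∀ d ∈ (s / l).divisors,
      ∑ M ∈ (Finset.range ((B + 1) * 2)).filter (fun M => Odd M), trapezoid X D M *
        (if l ^ 2 * d ∣ M then (J(((M / (l ^ 2 * d) : ℕ) : ℤ) | q) : ℝ) else 0) =
      (if q = 1 then X / 2 else 0) / ((l : ℝ) ^ 2 * d) - q * √q / (Real.pi ^ 2 * D) * (J(2 | q) *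
        (((l : ℝ) ^ 2 * d) * secondDiff (fun a => jacobiFourierAlt q (a / ((l : ℝ) ^ 2 * d))) X D)) := by
    intro l hl d hd
    obtain ⟨⟨c, hc⟩, -⟩ := mem_divisors_and_mem_divisors_div_iff.mp ⟨hl, hd⟩
    have hl0 : 0 < l := Nat.pos_of_mem_divisors hl
    have hd0 : 0 < d := Nat.pos_of_mem_divisors hd
    have hlR : (1 : ℝ) ≤ l := by exact_mod_cast hl0
    have hdR : (1 : ℝ) ≤ d := by exact_mod_cast hd0
    have hco : Odd (l ^ 2 * d) := by
      rw [hc] at hs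
      have h1 := (Nat.odd_mul.mp (Nat.odd_mul.mp hs).1)
      exact (h1.1.pow).mul h1.2
    have hcR : (1 : ℝ) ≤ (l : ℝ) ^ 2 * d := one_le_mul_of_one_le_of_one_le (one_le_pow₀ hlR) hdR
    have hcR0 : (0 : ℝ) < (l : ℝ) ^ 2 * d := by linarith
    have h1 := sum_range_filter_odd_dvd hco (R := (B + 1) * 2)
      (F := fun M => trapezoid X D M * (J(((M / (l ^ 2 * d) : ℕ) : ℤ) | q) : ℝ)) (by
        intro m hm
        rw [trapezoid_eq_zero hX hD.le (hBR.trans (by exact_mod_cast hm)), zero_mul])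
    have h2 : ∀ M : ℕ, trapezoid X D M *
        (if l ^ 2 * d ∣ M then (J(((M / (l ^ 2 * d) : ℕ) : ℤ) | q) : ℝ) else 0) =
        if l ^ 2 * d ∣ M then trapezoid X D M * (J(((M / (l ^ 2 * d) : ℕ) : ℤ) | q) : ℝ) else 0 := by
      intro M; split_ifs <;> simp
    simp_rw [h2]
    rw [h1]
    have h3 : ∀ m : ℕ, trapezoid X D ((l ^ 2 * d * m : ℕ) : ℝ) *
        (J(((l ^ 2 * d * m / (l ^ 2 * d) : ℕ) : ℤ) | q) : ℝ) =
        trapezoid (X / ((l : ℝ) ^ 2 * d)) (D / ((l : ℝ) ^ 2 * d)) m * J(m | q) := by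
      intro m
      rw [Nat.mul_div_cancel_left _ hco.pos]
      push_cast
      rw [trapezoid_mul_left _ _ _ hcR0]
    simp_rw [h3]
    rw [sum_trapezoid_mul_jacobiSym_odd (by positivity) (by positivity) hqo hq]
    · have h4 : secondDiff (jacobiFourierAlt q) (X / ((l : ℝ) ^ 2 * d)) (D / ((l : ℝ) ^ 2 * d)) =
          secondDiff (fun a => jacobiFourierAlt q (a / ((l : ℝ) ^ 2 * d))) X D := by
        unfold secondDiff
        simp only [add_div, zero_div]
      rw [h4]
      have := Real.pi_pos.ne'
      congr 1
      · split_ifs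
        · field_simp
        · simp
      · field_simp
    · rw [← add_div]
      exact (div_le_self (by linarith) hcR).trans hB
  have hswap : ∑ M ∈ (Finset.range ((B + 1) * 2)).filter (fun M => Odd M),
      trapezoid X D M * completedJacobi M (s ^ 2 * q) =
      ∑ l ∈ s.divisors, ∑ d ∈ (s / l).divisors,
      ((l : ℝ) * ArithmeticFunction.moebius d * J((d : ℤ) | q)) *
      ∑ M ∈ (Finset.range ((B + 1) * 2)).filter (fun M => Odd M), trapezoid X D M *
        (if l ^ 2 * d ∣ M then (J(((M / (l ^ 2 * d) : ℕ) : ℤ) | q) : ℝ) else 0) := by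
    simp_rw [completedJacobi_eq hs0 hq, Finset.mul_sum]
    rw [Finset.sum_comm]
    refine Finset.sum_congr rfl fun l _ => ?_
    rw [Finset.sum_comm]
    refine Finset.sum_congr rfl fun d _ => Finset.sum_congr rfl fun M _ => by ring
  rw [hswap, Finset.sum_congr rfl (fun l hl => Finset.sum_congr rfl (fun d hd => by
    rw [hterm l hl d hd]))]
  simp_rw [mul_sub, Finset.sum_sub_distrib]
  congr 1
  · rw [show (if IsSquare (s ^ 2 * q) then X / 2 else 0) = if q = 1 then X / 2 else 0 by
      simp only [isSquare_sq_mul_squarefree_iff hs0 hq]]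
    split_ifs with h
    · subst h
      have h1 := sum_divisors_coprimeDensity hs0.ne'
      have h2 : ∀ l ∈ s.divisors, ∑ d ∈ (s / l).divisors,
          (l : ℝ) * (ArithmeticFunction.moebius d : ℝ) * (J((d : ℤ) | 1) : ℝ) * (X / 2 / ((l : ℝ) ^ 2 * d)) =
          X / 2 * (1 / (l : ℝ) * coprimeDensity (s / l)) := by
        intro l hl
        have hl0 : (l : ℝ) ≠ 0 := by exact_mod_cast (Nat.pos_of_mem_divisors hl).ne'
        rw [coprimeDensity, Finset.mul_sum, Finset.mul_sum]
        refine Finset.sum_congr rfl fun d hd => ?_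
        have hd0 : (d : ℝ) ≠ 0 := by exact_mod_cast (Nat.pos_of_mem_divisors hd).ne'
        rw [jacobiSym.one_right]; push_cast
        field_simp
      rw [Finset.sum_congr rfl h2, ← Finset.mul_sum, h1, mul_one]
    · simp
  · have hcong : J(2 | s ^ 2 * q) = J(2 | q) := by
      have : NeZero s := ⟨hs0.ne'⟩
      have : NeZero q := ⟨hqo.pos.ne'⟩
      rw [jacobiSym.mul_right, jacobiSym.pow_right, jacobiSym.sq_one, one_mul]
      have := Nat.coprime_two_left.mpr hs
      exact_mod_cast this
    have h5 := completedFourier_eq hs hqo hq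
    have h6 : secondDiff (completedFourier (s ^ 2 * q)) X D * (s : ℝ) ^ 3 =
       ∑ l ∈ s.divisors, ∑ d ∈ (s / l).divisors,
      ((l : ℝ) * ArithmeticFunction.moebius d * J((d : ℤ) | q)) * ((l : ℝ) ^ 2 * d) *
        secondDiff (fun a => jacobiFourierAlt q (a / ((l : ℝ) ^ 2 * d))) X D := by
      unfold secondDiff
      simp only [mul_add, mul_sub, Finset.sum_add_distrib, Finset.sum_sub_distrib, h5]
      ring
    have h7 : (((s ^ 2 * q : ℕ) : ℝ)) * √((s ^ 2 * q : ℕ) : ℝ) = (s : ℝ) ^ 3 * (q * √q) := by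
      push_cast
      rw [Real.sqrt_mul (by positivity), Real.sqrt_sq (by positivity)]; ring
    rw [h7, hcong]
    calc _ = q * √q / (Real.pi ^ 2 * D) * J(2 | q) * (∑ l ∈ s.divisors, ∑ d ∈ (s / l).divisors,
      ((l : ℝ) * ArithmeticFunction.moebius d * J((d : ℤ) | q)) * ((l : ℝ) ^ 2 * d) *
        secondDiff (fun a => jacobiFourierAlt q (a / ((l : ℝ) ^ 2 * d))) X D) := by
          rw [Finset.mul_sum]
          refine Finset.sum_congr rfl fun l _ => ?_
          rw [Finset.mul_sum]
          refine Finset.sum_congr rfl fun d _ => by ring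
      _ = _ := by rw [← h6]; ring

/-- The odd `l` with `l² ∣ k`. -/
def oddSquareDivisors (k : ℕ) : Finset ℕ := k.divisors.filter (fun l => Odd l ∧ l * l ∣ k)

theorem mem_oddSquareDivisors {k l : ℕ} (hk : k ≠ 0) :
    l ∈ oddSquareDivisors k ↔ Odd l ∧ l * l ∣ k := by
  simp only [oddSquareDivisors, Finset.mem_filter, Nat.mem_divisors]
  exact ⟨fun h => h.2, fun h => ⟨⟨(Dvd.intro l rfl).trans h.2, hk⟩, h⟩⟩

theorem completedJacobi_eq_sum_oddSquareDivisors {k N : ℕ} (hk : k ≠ 0) (hN : Odd N) :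
    completedJacobi k N = ∑ l ∈ oddSquareDivisors k,
      if l * l ∣ N then (l : ℝ) * J(((k / (l * l) : ℕ) : ℤ) | N / (l * l)) else 0 := by
  rw [completedJacobi, ← Finset.sum_filter]
  congr 1
  ext l
  simp only [Finset.mem_filter, Nat.mem_divisors, mem_oddSquareDivisors hk]
  constructor
  · rintro ⟨-, h1, h2⟩
    exact ⟨⟨(Nat.odd_mul.mp (hN.of_dvd_nat h1)).1, h2⟩, h1⟩
  · rintro ⟨⟨-, h2⟩, h1⟩
    exact ⟨⟨(Dvd.intro l rfl).trans h1, hN.pos.ne'⟩, h1, h2⟩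

theorem sq_odd_mod_eight {l : ℕ} (hl : Odd l) (n : ℕ) : (l * l * n) % 8 = n % 8 := by
  have h1 : l * l % 8 = 1 := by
    have : l % 8 = 1 ∨ l % 8 = 3 ∨ l % 8 = 5 ∨ l % 8 = 7 := by rcases hl with ⟨j, rfl⟩; omega
    rcases this with h | h | h | h <;> simp [Nat.mul_mod, h]
  rw [Nat.mul_mod, h1, one_mul, Nat.mod_mod]

theorem exists_sum_filter_mod_four_sq_dvd {l : ℕ} (hl : Odd l) (b t : ℕ) :
    ∃ T : ℕ, |(T : ℝ) - t / (l : ℝ) ^ 2| ≤ 1 ∧ ∀ F : ℕ → ℝ,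
      ∑ N ∈ (Finset.range t).filter (fun N => N % 4 = b), (if l * l ∣ N then F N else 0) =
        ∑ n ∈ (Finset.range T).filter (fun n => n % 4 = b), F (l * l * n) := by
  have hl0 := hl.pos
  have hll : 0 < l * l := by positivity
  set T := (t + l * l - 1) / (l * l) with hT
  have hlt : ∀ n, n < T ↔ l * l * n < t := by
    intro n
    rw [hT, Nat.lt_iff_add_one_le, Nat.le_div_iff_mul_le hll]
    have e1 : (n + 1) * (l * l) = l * l * n + l * l := by ring
    rw [e1]; omega
  refine ⟨T, ?_, fun F => ?_⟩
  · have h1 : T * (l * l) ≤ t + l * l - 1 := Nat.div_mul_le_self _ _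
    have h2 : t ≤ T * (l * l) := by
      by_contra hcon
      push Not at hcon
      have := (hlt T).mpr (by rw [mul_comm]; exact hcon)
      omega
    have h1' : (T : ℝ) * (l : ℝ) ^ 2 ≤ t + (l : ℝ) ^ 2 := by
      have : T * (l * l) ≤ t + l * l := by omega
      rw [sq]; exact_mod_cast this
    have h2' : (t : ℝ) ≤ T * (l : ℝ) ^ 2 := by rw [sq]; exact_mod_cast h2
    have hlR : (0 : ℝ) < (l : ℝ) ^ 2 := by positivity
    have e : (t : ℝ) / (l : ℝ) ^ 2 * (l : ℝ) ^ 2 = t := by field_simp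
    rw [abs_le]
    constructor
    · refine le_of_mul_le_mul_right ?_ hlR; rw [sub_mul, e]; linarith
    · refine le_of_mul_le_mul_right ?_ hlR; rw [sub_mul, e]; linarith
  · rw [← Finset.sum_filter, Finset.filter_filter]
    symm
    have hmod : ∀ n, (l * l * n) % 4 = n % 4 := by
      intro n; have := sq_odd_mod_eight hl n; omega
    refine Finset.sum_nbij' (fun n => l * l * n) (fun N => N / (l * l)) ?_ ?_ ?_ ?_ ?_
    · intro n hn
      simp only [Finset.mem_filter, Finset.mem_range] at hn ⊢
      exact ⟨(hlt n).mp hn.1, (hmod n).trans hn.2, Dvd.intro _ rfl⟩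
    · intro N hN
      simp only [Finset.mem_filter, Finset.mem_range] at hN ⊢
      obtain ⟨h1, h2, n, rfl⟩ := hN
      rw [Nat.mul_div_cancel_left _ hll]
      exact ⟨(hlt n).mpr h1, (hmod n).symm.trans h2⟩
    · intro n _; exact Nat.mul_div_cancel_left _ hll
    · intro N hN
      simp only [Finset.mem_filter] at hN
      exact Nat.mul_div_cancel' hN.2.2
    · intro n _; rfl

theorem sum_mod_four_eq_mod_eight {b : ℕ} (hb : b < 4) (t : ℕ) (F : ℕ → ℝ) :
    ∑ n ∈ (Finset.range t).filter (fun n => n % 4 = b), F n =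
      ∑ n ∈ (Finset.range t).filter (fun n => n % 8 = b), F n +
      ∑ n ∈ (Finset.range t).filter (fun n => n % 8 = b + 4), F n := by
  rw [Finset.sum_filter, Finset.sum_filter, Finset.sum_filter, ← Finset.sum_add_distrib]
  refine Finset.sum_congr rfl fun n _ => ?_
  by_cases h : n % 4 = b
  · have h2 : n % 8 = b ∨ n % 8 = b + 4 := by omega
    rcases h2 with h2 | h2
    · rw [if_pos h, if_pos h2, if_neg (by omega), add_zero]
    · rw [if_pos h, if_neg (by omega), if_pos h2, zero_add]
  · rw [if_neg h, if_neg (by omega), if_neg (by omega), add_zero]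

theorem sqrt_mul_one_add_log_le {m : ℕ} (hm : m ≠ 0) : √(m : ℝ) * (1 + Real.log m) ≤ 2 * m := by
  have hm1 : (1 : ℝ) ≤ m := by exact_mod_cast Nat.one_le_iff_ne_zero.mpr hm
  have hs : (1 : ℝ) ≤ √m := Real.one_le_sqrt.mpr hm1
  have h1 : Real.log m = 2 * Real.log (√m) := by
    rw [Real.log_sqrt (by linarith)]; ring
  have h2 : Real.log (√m) ≤ √m - 1 := Real.log_le_sub_one_of_pos (by linarith)
  have h3 : √(m : ℝ) * √m = m := Real.mul_self_sqrt (by linarith)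
  nlinarith

theorem abs_sum_jacobiSym_mod_four_le {m : ℕ} (hm : m ≠ 0) (h1 : ¬ IsSquare m)
    (h2 : ¬ IsSquare (2 * m)) {b : ℕ} (hb : b < 4) (hbo : Odd b) (t : ℕ) :
    |∑ n ∈ (Finset.range t).filter (fun n => n % 4 = b), (J((m : ℤ) | n) : ℝ)| ≤ 4 * m := by
  rw [sum_mod_four_eq_mod_eight hb]
  have hA := abs_sum_jacobiSym_right_mod_eight_le hm h1 h2 (b := b) (by omega) hbo t
  have hB := abs_sum_jacobiSym_right_mod_eight_le hm h1 h2 (b := b + 4) (by omega)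
    (hbo.add_even (by decide)) t
  have hC := sqrt_mul_one_add_log_le hm
  exact (abs_add_le _ _).trans (by linarith)

theorem jacobiSym_two_pow_mul_sq {e r n : ℕ} (hn : Odd n) :
    (J(((2 ^ e * r ^ 2 : ℕ) : ℤ) | n) : ℝ) = (ZMod.χ₈ n ^ e : ℤ) * (if r.Coprime n then 1 else 0) := by
  have h := jacobiSym_mod_eight_eq (e := e) (r := r) (q := 1) hn odd_one
  rw [mul_one, jacobiSym.one_right, mul_one, if_neg (by omega : ¬ (1 % 4 = 3 ∧ n % 4 = 3)), mul_one] at h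
  rw [h]; push_cast; ring

theorem sum_jacobiSym_two_pow_mul_sq {e r : ℕ} {b : ℕ} (hbo : Odd b) (t : ℕ) :
    ∑ n ∈ (Finset.range t).filter (fun n => n % 8 = b), (J(((2 ^ e * r ^ 2 : ℕ) : ℤ) | n) : ℝ) =
      (ZMod.χ₈ (b : ZMod 8) ^ e : ℤ) *
        ∑ _n ∈ ((Finset.range t).filter (fun n => n % 8 = b)).filter (fun n => r.Coprime n), (1 : ℝ) := by
  rw [Finset.sum_filter (p := fun n => r.Coprime n), Finset.mul_sum]
  refine Finset.sum_congr rfl fun n hn => ?_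
  have hn := (Finset.mem_filter.mp hn).2
  have hno : Odd n := by rw [Nat.odd_iff] at hbo ⊢; omega
  rw [jacobiSym_two_pow_mul_sq hno]
  have e1 : ZMod.χ₈ (n : ZMod 8) = ZMod.χ₈ (b : ZMod 8) := by rw [← hn, ZMod.natCast_mod]
  rw [e1]

theorem abs_sum_jacobiSym_even_pow_mul_sq_sub_le {f r : ℕ} (hr : Odd r) {b : ℕ} (hb : b < 4) (hbo : Odd b)
    (t : ℕ) :
    |∑ n ∈ (Finset.range t).filter (fun n => n % 4 = b), (J(((2 ^ (2 * f) * r ^ 2 : ℕ) : ℤ) | n) : ℝ)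
      - t / 4 * coprimeDensity r| ≤ 2 * r := by
  have hχ : ∀ b : ℕ, Odd b → (ZMod.χ₈ (b : ZMod 8)) ^ (2 * f) = 1 := by
    intro b hb
    rw [← jacobiSym.at_two hb, pow_mul, jacobiSym.sq_one, one_pow]
    exact_mod_cast Nat.coprime_two_left.mpr hb
  have hbo' : Odd (b + 4) := hbo.add_even (by decide)
  rw [sum_mod_four_eq_mod_eight hb, sum_jacobiSym_two_pow_mul_sq hbo,
    sum_jacobiSym_two_pow_mul_sq hbo', hχ _ hbo, hχ _ hbo']
  have hA := abs_count_coprime_mod_eight_sub_le hr (b := b) (by omega) t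
  have hB := abs_count_coprime_mod_eight_sub_le hr (b := b + 4) (by omega) t
  rw [abs_le] at hA hB ⊢
  push_cast
  constructor <;> linarith [hA.1, hA.2, hB.1, hB.2]

theorem abs_sum_jacobiSym_odd_pow_mul_sq_le {f r : ℕ} (hr : Odd r) {b : ℕ} (hb : b < 4) (hbo : Odd b)
    (t : ℕ) :
    |∑ n ∈ (Finset.range t).filter (fun n => n % 4 = b),
      (J(((2 ^ (2 * f + 1) * r ^ 2 : ℕ) : ℤ) | n) : ℝ)| ≤ 2 * r := by
  have hbo' : Odd (b + 4) := hbo.add_even (by decide)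
  have hA := abs_count_coprime_mod_eight_sub_le hr (b := b) (by omega) t
  have hB := abs_count_coprime_mod_eight_sub_le hr (b := b + 4) (by omega) t
  have hneg : ZMod.χ₈ ((b + 4 : ℕ) : ZMod 8) = - ZMod.χ₈ (b : ZMod 8) := by
    interval_cases b
    · exact absurd hbo (by decide)
    · decide
    · exact absurd hbo (by decide)
    · decide
  have h1 : |((ZMod.χ₈ (b : ZMod 8) ^ (2 * f + 1) : ℤ) : ℝ)| ≤ 1 := by
    have : ∀ x : ZMod 8, |ZMod.χ₈ x| ≤ 1 := by decide
    have h := pow_le_one₀ (n := 2 * f + 1) (abs_nonneg _) (this b)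
    rw [← abs_pow] at h
    exact_mod_cast h
  rw [sum_mod_four_eq_mod_eight hb, sum_jacobiSym_two_pow_mul_sq hbo,
    sum_jacobiSym_two_pow_mul_sq hbo', hneg, Odd.neg_pow ⟨f, rfl⟩, Int.cast_neg, neg_mul,
    ← sub_eq_add_neg, ← mul_sub, abs_mul]
  refine (mul_le_of_le_one_left (abs_nonneg _) h1).trans ?_
  rw [abs_le] at hA hB ⊢
  constructor <;> linarith [hA.1, hA.2, hB.1, hB.2]

theorem abs_coprimeDensity_le (r : ℕ) : |coprimeDensity r| ≤ r := by
  refine (Finset.abs_sum_le_sum_abs _ _).trans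
    (le_trans (Finset.sum_le_card_nsmul _ _ 1 fun d hd => ?_) ?_)
  · have hd0 : (1 : ℝ) ≤ d := by exact_mod_cast Nat.pos_of_mem_divisors hd
    rw [abs_div, abs_of_pos (by linarith : (0 : ℝ) < d)]
    exact (div_le_one (by linarith)).mpr ((abs_moebius_cast_le d).trans hd0)
  · rw [nsmul_eq_mul, mul_one]; exact card_divisors_cast_le r

theorem sum_completedJacobi_eq {k : ℕ} (hk : k ≠ 0) {b : ℕ} (hbo : Odd b) (t : ℕ) :
    ∃ T : ℕ → ℕ, (∀ l ∈ oddSquareDivisors k, |(T l : ℝ) - t / (l : ℝ) ^ 2| ≤ 1) ∧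
    ∑ N ∈ (Finset.range t).filter (fun N => N % 4 = b), J(2 | N) * completedJacobi k N =
      ∑ l ∈ oddSquareDivisors k, (l : ℝ) * ∑ n ∈ (Finset.range (T l)).filter (fun n => n % 4 = b),
        (J(((2 * (k / (l * l)) : ℕ) : ℤ) | n) : ℝ) := by
  have hodd : ∀ N, N % 4 = b → Odd N := by
    intro n hn; rw [Nat.odd_iff] at hbo ⊢; omega
  choose! T hT using fun l (hl : Odd l) => exists_sum_filter_mod_four_sq_dvd hl b t
  refine ⟨T, fun l hl => (hT l ((mem_oddSquareDivisors hk).mp hl).1).1, ?_⟩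
  have h1 : ∀ N ∈ (Finset.range t).filter (fun N => N % 4 = b), (J(2 | N) : ℝ) * completedJacobi k N =
      ∑ l ∈ oddSquareDivisors k, if l * l ∣ N then
        (J(2 | N) : ℝ) * ((l : ℝ) * J(((k / (l * l) : ℕ) : ℤ) | N / (l * l))) else 0 := by
    intro N hN
    rw [completedJacobi_eq_sum_oddSquareDivisors hk (hodd N (Finset.mem_filter.mp hN).2), Finset.mul_sum]
    refine Finset.sum_congr rfl fun l _ => ?_
    split_ifs <;> simp
  rw [Finset.sum_congr rfl h1, Finset.sum_comm]
  refine Finset.sum_congr rfl fun l hl => ?_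
  have hlo := ((mem_oddSquareDivisors hk).mp hl).1
  rw [(hT l hlo).2 (fun N => (J(2 | N) : ℝ) * ((l : ℝ) * J(((k / (l * l) : ℕ) : ℤ) | N / (l * l)))),
    Finset.mul_sum]
  refine Finset.sum_congr rfl fun n hn => ?_
  have hno := hodd n (Finset.mem_filter.mp hn).2
  have hl0 := hlo.pos
  rw [Nat.mul_div_cancel_left _ (by positivity)]
  have : NeZero l := ⟨hl0.ne'⟩
  have : NeZero n := ⟨hno.pos.ne'⟩
  have h2 : J(2 | l) * J(2 | l) = 1 := by
    rw [← sq]; apply jacobiSym.sq_one; exact_mod_cast Nat.coprime_two_left.mpr hlo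
  rw [jacobiSym.mul_right, jacobiSym.mul_right, h2, one_mul]
  push_cast
  rw [jacobiSym.mul_left]
  push_cast; ring

theorem card_oddSquareDivisors_le (k : ℕ) : ((oddSquareDivisors k).card : ℝ) ≤ k := by
  have h1 : (oddSquareDivisors k).card ≤ k.divisors.card := Finset.card_filter_le _ _
  exact_mod_cast h1.trans (Nat.card_divisors_le_self k)

theorem abs_sum_completedJacobi_le_of_not_square {k : ℕ} (hk : k ≠ 0) (h1 : ¬ IsSquare k)
    (h2 : ¬ IsSquare (2 * k)) {b : ℕ} (hb : b < 4) (hbo : Odd b) (t : ℕ) :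
    |∑ N ∈ (Finset.range t).filter (fun N => N % 4 = b), J(2 | N) * completedJacobi k N| ≤
      8 * (k : ℝ) ^ 2 := by
  obtain ⟨T, -, hT⟩ := sum_completedJacobi_eq hk hbo t
  rw [hT]
  refine (Finset.abs_sum_le_sum_abs _ _).trans
    (le_trans (Finset.sum_le_card_nsmul _ _ (8 * (k : ℝ)) fun l hl => ?_) ?_)
  · obtain ⟨hlo, k', hk'⟩ := (mem_oddSquareDivisors hk).mp hl
    have hl0 := hlo.pos
    have hk0 : k' ≠ 0 := by rintro rfl; simp at hk'; exact hk hk'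
    have e1 : k / (l * l) = k' := by rw [hk', Nat.mul_div_cancel_left _ (by positivity)]
    have hlR : (1 : ℝ) ≤ l := by exact_mod_cast hl0
    rw [e1, abs_mul, Nat.abs_cast]
    have h3 := abs_sum_jacobiSym_mod_four_le (m := 2 * k') (by omega)
      (fun ⟨v, hv⟩ => h2 ⟨l * v, by rw [hk']; linear_combination (l * l) * hv⟩)
      (fun ⟨v, hv⟩ => h1 (by
        have : Even v := by
          have : Even (v * v) := by rw [← hv]; exact ⟨2 * k', by ring⟩
          rcases Nat.even_mul.mp this with h | h <;> exact h
        obtain ⟨w, rfl⟩ := this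
        exact ⟨l * w, by rw [hk']; have : k' = w * w := by linarith
                         rw [this]; ring⟩)) hb hbo (T l)
    calc _ ≤ (l : ℝ) * (4 * ((2 * k' : ℕ) : ℝ)) := by gcongr
      _ ≤ 8 * k := by
        rw [hk']; push_cast
        have : (l : ℝ) ≤ l * l := by nlinarith
        nlinarith [(Nat.cast_nonneg k' : (0 : ℝ) ≤ k')]
  · rw [nsmul_eq_mul]
    have := card_oddSquareDivisors_le k
    nlinarith [(Nat.cast_nonneg k : (0 : ℝ) ≤ k)]

theorem mul_self_dvd_two_pow_mul_sq_iff {l g r : ℕ} (hl : Odd l) :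
    l * l ∣ 2 ^ g * r ^ 2 ↔ l ∣ r := by
  have hc : Nat.Coprime (l * l) (2 ^ g) :=
    Nat.Coprime.pow_right g (Nat.coprime_two_right.mpr (hl.mul hl))
  rw [hc.dvd_mul_left, ← sq, Nat.pow_dvd_pow_iff two_ne_zero]

theorem abs_sum_completedJacobi_sub_le_of_two_mul_square {f r : ℕ} (hr : Odd r) {b : ℕ} (hb : b < 4)
    (hbo : Odd b) (t : ℕ) :
    |∑ N ∈ (Finset.range t).filter (fun N => N % 4 = b),
      J(2 | N) * completedJacobi (2 ^ (2 * f + 1) * r ^ 2) N - t / 4| ≤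
      8 * ((2 ^ (2 * f + 1) * r ^ 2 : ℕ) : ℝ) ^ 2 := by
  have hr0 := hr.pos
  have hk : 2 ^ (2 * f + 1) * r ^ 2 ≠ 0 := by positivity
  obtain ⟨T, hT1, hT⟩ := sum_completedJacobi_eq hk hbo t
  have hset : oddSquareDivisors (2 ^ (2 * f + 1) * r ^ 2) = r.divisors := by
    ext l
    rw [mem_oddSquareDivisors hk, Nat.mem_divisors]
    constructor
    · rintro ⟨h1, h2⟩; exact ⟨(mul_self_dvd_two_pow_mul_sq_iff h1).mp h2, hr0.ne'⟩
    · rintro ⟨h1, -⟩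
      have hlo := hr.of_dvd_nat h1
      exact ⟨hlo, (mul_self_dvd_two_pow_mul_sq_iff hlo).mpr h1⟩
  rw [hset] at hT hT1
  have hmain : (t : ℝ) / 4 = ∑ l ∈ r.divisors, t / 4 * (1 / (l : ℝ) * coprimeDensity (r / l)) := by
    rw [← Finset.mul_sum, sum_divisors_coprimeDensity hr0.ne', mul_one]
  rw [hT, hmain, ← Finset.sum_sub_distrib]
  refine (Finset.abs_sum_le_sum_abs _ _).trans
    (le_trans (Finset.sum_le_card_nsmul _ _ (3 * (r : ℝ)) fun l hl => ?_) ?_)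
  · obtain ⟨⟨r', hr'⟩, -⟩ := Nat.mem_divisors.mp hl
    have hl0 := Nat.pos_of_mem_divisors hl
    have hr'o : Odd r' := by rw [hr'] at hr; exact (Nat.odd_mul.mp hr).2
    have e1 : 2 * (2 ^ (2 * f + 1) * r ^ 2 / (l * l)) = 2 ^ (2 * (f + 1)) * r' ^ 2 := by
      have : 2 ^ (2 * f + 1) * r ^ 2 = l * l * (2 ^ (2 * f + 1) * r' ^ 2) := by rw [hr']; ring
      rw [this, Nat.mul_div_cancel_left _ (by positivity)]; ring
    have e2 : r / l = r' := by rw [hr', Nat.mul_div_cancel_left _ hl0]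
    rw [e1, e2]
    have h3 := abs_sum_jacobiSym_even_pow_mul_sq_sub_le (f := f + 1) hr'o hb hbo (T l)
    have h4 := hT1 l hl
    have h5 := abs_coprimeDensity_le r'
    have hlR : (0 : ℝ) < l := by exact_mod_cast hl0
    have hr'R : (0 : ℝ) ≤ r' := Nat.cast_nonneg _
    set S := ∑ n ∈ (Finset.range (T l)).filter (fun n => n % 4 = b),
      (J(((2 ^ (2 * (f + 1)) * r' ^ 2 : ℕ) : ℤ) | n) : ℝ)
    have e3 : (l : ℝ) * S - t / 4 * (1 / (l : ℝ) * coprimeDensity r') =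
        l * ((S - T l / 4 * coprimeDensity r') + 1 / 4 * ((T l - t / (l : ℝ) ^ 2) * coprimeDensity r')) := by
      field_simp; ring
    have h6 : |(T l - t / (l : ℝ) ^ 2) * coprimeDensity r'| ≤ r' := by
      rw [abs_mul]
      calc _ ≤ 1 * (r' : ℝ) := mul_le_mul h4 h5 (abs_nonneg _) zero_le_one
        _ = _ := one_mul _
    rw [e3, abs_mul, abs_of_pos hlR, hr']
    push_cast
    have h7 : |(S - T l / 4 * coprimeDensity r') + 1 / 4 * ((T l - t / (l : ℝ) ^ 2) * coprimeDensity r')|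
        ≤ 3 * (r' : ℝ) := by
      refine (abs_add_le _ _).trans ?_
      rw [abs_mul, abs_of_pos (by norm_num : (0 : ℝ) < 1 / 4)]
      linarith
    calc _ ≤ (l : ℝ) * (3 * r') := by gcongr
      _ = _ := by ring
  · rw [nsmul_eq_mul]
    have h3 := card_divisors_cast_le r
    have h4 : (1 : ℝ) ≤ 2 ^ (2 * f + 1) := one_le_pow₀ (by norm_num)
    have h5 : (1 : ℝ) ≤ (r : ℝ) ^ 2 := one_le_pow₀ (by exact_mod_cast hr0)
    push_cast
    have h6 : (r : ℝ) ^ 2 ≤ 2 ^ (2 * f + 1) * (r : ℝ) ^ 2 := le_mul_of_one_le_left (by positivity) h4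
    have h7 : (r.divisors.card : ℝ) * (3 * r) ≤ 3 * (r : ℝ) ^ 2 := by
      nlinarith [(Nat.cast_nonneg r : (0 : ℝ) ≤ r)]
    nlinarith

theorem abs_sum_completedJacobi_le_of_square {f r : ℕ} (hr : Odd r) {b : ℕ} (hb : b < 4)
    (hbo : Odd b) (t : ℕ) :
    |∑ N ∈ (Finset.range t).filter (fun N => N % 4 = b),
      J(2 | N) * completedJacobi (2 ^ (2 * f) * r ^ 2) N| ≤
      8 * ((2 ^ (2 * f) * r ^ 2 : ℕ) : ℝ) ^ 2 := by
  have hr0 := hr.pos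
  have hk : 2 ^ (2 * f) * r ^ 2 ≠ 0 := by positivity
  obtain ⟨T, -, hT⟩ := sum_completedJacobi_eq hk hbo t
  rw [hT]
  refine (Finset.abs_sum_le_sum_abs _ _).trans
    (le_trans (Finset.sum_le_card_nsmul _ _ (2 * (r : ℝ)) fun l hl => ?_) ?_)
  · obtain ⟨hlo, hl2⟩ := (mem_oddSquareDivisors hk).mp hl
    obtain ⟨r', hr'⟩ := (mul_self_dvd_two_pow_mul_sq_iff hlo).mp hl2
    have hl0 := hlo.pos
    have hr'o : Odd r' := by rw [hr'] at hr; exact (Nat.odd_mul.mp hr).2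
    have e1 : 2 * (2 ^ (2 * f) * r ^ 2 / (l * l)) = 2 ^ (2 * f + 1) * r' ^ 2 := by
      have : 2 ^ (2 * f) * r ^ 2 = l * l * (2 ^ (2 * f) * r' ^ 2) := by rw [hr']; ring
      rw [this, Nat.mul_div_cancel_left _ (by positivity)]; ring
    rw [e1, abs_mul, Nat.abs_cast, hr']
    push_cast
    have h3 := abs_sum_jacobiSym_odd_pow_mul_sq_le (f := f) hr'o hb hbo (T l)
    push_cast at h3
    calc _ ≤ (l : ℝ) * (2 * r') := by gcongr
      _ = _ := by ring
  · rw [nsmul_eq_mul]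
    have h3 := card_oddSquareDivisors_le (2 ^ (2 * f) * r ^ 2)
    have h4 : (1 : ℝ) ≤ 2 ^ (2 * f) := one_le_pow₀ (by norm_num)
    have hrR : (1 : ℝ) ≤ r := by exact_mod_cast hr0
    have h5 : (r : ℝ) ≤ ((2 ^ (2 * f) * r ^ 2 : ℕ) : ℝ) := by
      push_cast; nlinarith [mul_le_mul h4 (le_refl ((r : ℝ) ^ 2)) (by positivity) (by positivity)]
    calc _ ≤ ((2 ^ (2 * f) * r ^ 2 : ℕ) : ℝ) * (2 * ((2 ^ (2 * f) * r ^ 2 : ℕ) : ℝ)) := by gcongr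
      _ ≤ _ := by nlinarith [sq_nonneg ((2 ^ (2 * f) * r ^ 2 : ℕ) : ℝ)]

theorem eq_one_and_even_of_isSquare {g r q : ℕ} (h : IsSquare (2 ^ g * (r ^ 2 * q))) (hr : Odd r)
    (hqo : Odd q) (hq : Squarefree q) : q = 1 ∧ Even g := by
  have hr0 := hr.pos
  rcases Nat.even_or_odd' g with ⟨f, rfl | rfl⟩
  · have e : 2 ^ (2 * f) * (r ^ 2 * q) = (2 ^ f * r) ^ 2 * q := by ring
    rw [e, isSquare_sq_mul_squarefree_iff (by positivity) hq] at h
    exact ⟨h, even_two_mul f⟩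
  · have e : 2 ^ (2 * f + 1) * (r ^ 2 * q) = (2 ^ f * r) ^ 2 * (2 * q) := by ring
    have hq2 : Squarefree (2 * q) :=
      (Nat.squarefree_mul (Nat.coprime_two_left.mpr hqo)).mpr ⟨Nat.prime_two.prime.squarefree, hq⟩
    rw [e, isSquare_sq_mul_squarefree_iff (by positivity) hq2] at h
    omega

/-- The mean of `(2 / N) a(k, N)` over `N ≡ b mod 4`: a main term occurs only if `2 k` is a square. -/
theorem abs_sum_completedJacobi_sub_le {k : ℕ} (hk : k ≠ 0) {b : ℕ} (hb : b < 4) (hbo : Odd b) (t : ℕ) :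
    |∑ N ∈ (Finset.range t).filter (fun N => N % 4 = b), J(2 | N) * completedJacobi k N -
      (if IsSquare (2 * k) then 1 / 4 else 0) * t| ≤ 8 * (k : ℝ) ^ 2 := by
  by_cases h2 : IsSquare (2 * k)
  · rw [if_pos h2]
    obtain ⟨e, r, q, hkeq, hr, hqo, hq⟩ := exists_two_pow_sq_mul_squarefree hk
    have e1 : 2 * k = 2 ^ (e + 1) * (r ^ 2 * q) := by rw [hkeq]; ring
    rw [e1] at h2
    obtain ⟨rfl, hg⟩ := eq_one_and_even_of_isSquare h2 hr hqo hq
    obtain ⟨f, rfl⟩ : ∃ f, e = 2 * f + 1 := by obtain ⟨w, hw⟩ := hg; exact ⟨w - 1, by omega⟩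
    rw [mul_one] at hkeq
    have h3 := abs_sum_completedJacobi_sub_le_of_two_mul_square (f := f) hr hb hbo t
    rw [← hkeq] at h3
    rwa [one_div_mul_eq_div]
  · rw [if_neg h2, zero_mul, sub_zero]
    by_cases h1 : IsSquare k
    · obtain ⟨e, r, q, hkeq, hr, hqo, hq⟩ := exists_two_pow_sq_mul_squarefree hk
      have h1' := h1
      rw [hkeq] at h1'
      obtain ⟨rfl, hg⟩ := eq_one_and_even_of_isSquare h1' hr hqo hq
      obtain ⟨f, rfl⟩ := hg.two_dvd
      rw [mul_one] at hkeq
      have h3 := abs_sum_completedJacobi_le_of_square (f := f) hr hb hbo t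
      rwa [← hkeq] at h3
    · exact abs_sum_completedJacobi_le_of_not_square hk h1 h2 hb hbo t

open MeasureTheory intervalIntegral in
/-- Partial summation against a sequence with mean value `κ`. -/
theorem abs_sum_mul_sub_integral_le {c : ℕ → ℝ} {κ B Y : ℝ} (hY : 1 ≤ Y) (hc0 : c 0 = 0) (hκ : |κ| ≤ B)
    (hB : ∀ t : ℝ, 1 ≤ t → |∑ k ∈ Finset.Icc 0 ⌊t⌋₊, c k - κ * t| ≤ B)
    {f f' g : ℝ → ℝ} (hf : ∀ t ∈ Set.Icc 1 Y, HasDerivAt f (f' t) t)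
    (hf' : ContinuousOn f' (Set.Icc 1 Y)) (hg : ContinuousOn g (Set.Icc 1 Y))
    (hfg : ∀ t ∈ Set.Icc 1 Y, |f' t| ≤ g t) :
    |∑ k ∈ Finset.Icc 0 ⌊Y⌋₊, f k * c k - κ * ∫ t in (1 : ℝ)..Y, f t| ≤
      B * (|f Y| + |f 1| + ∫ t in (1 : ℝ)..Y, g t) := by
  have hu : Set.uIcc 1 Y = Set.Icc 1 Y := Set.uIcc_of_le hY
  have hB0 : 0 ≤ B := (abs_nonneg _).trans hκ
  have hderiv : ∀ t ∈ Set.Icc 1 Y, deriv f t = f' t := fun t ht => (hf t ht).deriv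
  have hint : IntegrableOn f' (Set.Icc 1 Y) := hf'.integrableOn_Icc
  have hint2 : IntegrableOn (deriv f) (Set.Icc 1 Y) :=
    hint.congr_fun (fun t ht => (hderiv t ht).symm) measurableSet_Icc
  have hA := sum_mul_eq_sub_integral_mul₀ c hc0 Y (fun t ht => (hf t ht).differentiableAt) hint2
  have hii : IntervalIntegrable (fun t => f' t * ∑ k ∈ Finset.Icc 0 ⌊t⌋₊, c k) volume 1 Y := by
    rw [intervalIntegrable_iff_integrableOn_Icc_of_le hY]
    exact integrableOn_mul_sum_Icc c zero_le_one hint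
  have hif' : IntervalIntegrable f' volume 1 Y := by
    rw [intervalIntegrable_iff_integrableOn_Icc_of_le hY]; exact hint
  have hfc : ContinuousOn f (Set.Icc 1 Y) := fun t ht => (hf t ht).continuousAt.continuousWithinAt
  have hif't : IntervalIntegrable (fun t => f' t * t) volume 1 Y := by
    apply ContinuousOn.intervalIntegrable; rw [hu]; exact hf'.mul continuousOn_id
  have hif : IntervalIntegrable f volume 1 Y := by
    apply ContinuousOn.intervalIntegrable; rw [hu]; exact hfc
  have hig : IntervalIntegrable g volume 1 Y := by
    apply ContinuousOn.intervalIntegrable; rw [hu]; exact hg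
  have hparts : ∫ t in (1 : ℝ)..Y, (f' t * t + f t * 1) = f Y * Y - f 1 * 1 := by
    apply integral_eq_sub_of_hasDerivAt (f := fun t => f t * t)
    · intro t ht; rw [hu] at ht
      exact (hf t ht).mul (hasDerivAt_id t)
    · exact hif't.add (by simpa using hif)
  rw [integral_add hif't (by simpa using hif)] at hparts
  simp only [mul_one] at hparts
  have e1 : ∫ t in Set.Ioc 1 Y, deriv f t * ∑ k ∈ Finset.Icc 0 ⌊t⌋₊, c k =
      ∫ t in (1 : ℝ)..Y, f' t * ∑ k ∈ Finset.Icc 0 ⌊t⌋₊, c k := by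
    rw [integral_of_le hY]
    refine setIntegral_congr_fun measurableSet_Ioc fun t ht => ?_
    simp only [hderiv t (Set.Ioc_subset_Icc_self ht)]
  have e2 : ∑ k ∈ Finset.Icc 0 ⌊Y⌋₊, f k * c k - κ * ∫ t in (1 : ℝ)..Y, f t =
      f Y * (∑ k ∈ Finset.Icc 0 ⌊Y⌋₊, c k - κ * Y) + κ * f 1 -
        ∫ t in (1 : ℝ)..Y, f' t * (∑ k ∈ Finset.Icc 0 ⌊t⌋₊, c k - κ * t) := by
    have e3 : ∫ t in (1 : ℝ)..Y, f' t * (∑ k ∈ Finset.Icc 0 ⌊t⌋₊, c k - κ * t) =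
        (∫ t in (1 : ℝ)..Y, f' t * ∑ k ∈ Finset.Icc 0 ⌊t⌋₊, c k) - κ * ∫ t in (1 : ℝ)..Y, f' t * t := by
      rw [← intervalIntegral.integral_const_mul, ← integral_sub hii (hif't.const_mul κ)]
      congr 1; ext t; ring
    rw [hA, e1, e3]
    linear_combination (-κ) * hparts
  rw [e2]
  have h1 : |f Y * (∑ k ∈ Finset.Icc 0 ⌊Y⌋₊, c k - κ * Y)| ≤ |f Y| * B := by
    rw [abs_mul]; exact mul_le_mul_of_nonneg_left (hB Y hY) (abs_nonneg _)
  have h2 : |κ * f 1| ≤ B * |f 1| := by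
    rw [abs_mul]; exact mul_le_mul_of_nonneg_right hκ (abs_nonneg _)
  have h3 : |∫ t in (1 : ℝ)..Y, f' t * (∑ k ∈ Finset.Icc 0 ⌊t⌋₊, c k - κ * t)| ≤
      B * ∫ t in (1 : ℝ)..Y, g t := by
    rw [← intervalIntegral.integral_const_mul, ← Real.norm_eq_abs]
    refine norm_integral_le_of_norm_le hY ?_ (hig.const_mul B)
    refine ae_of_all _ fun t ht => ?_
    rw [Real.norm_eq_abs, abs_mul, mul_comm B]
    exact mul_le_mul (hfg t (Set.Ioc_subset_Icc_self ht)) (hB t ht.1.le) (abs_nonneg _)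
      ((abs_nonneg _).trans (hfg t (Set.Ioc_subset_Icc_self ht)))
  have h4 := abs_add_three (f Y * (∑ k ∈ Finset.Icc 0 ⌊Y⌋₊, c k - κ * Y)) (κ * f 1)
    (- ∫ t in (1 : ℝ)..Y, f' t * (∑ k ∈ Finset.Icc 0 ⌊t⌋₊, c k - κ * t))
  rw [abs_neg] at h4
  rw [sub_eq_add_neg]
  linarith

open MeasureTheory intervalIntegral in
theorem intervalIntegrable_mul_comp_div {p h : ℝ → ℝ} (hp : Continuous p) (hh : Measurable h)
    (hb : ∀ x, |h x| ≤ 1) (ω a b : ℝ) :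
    IntervalIntegrable (fun t => p t * h (ω / t)) volume a b := by
  refine (hp.intervalIntegrable (μ := volume) a b).mono_fun ?_ ?_
  · exact (hp.measurable.mul (hh.comp (measurable_const.div measurable_id))).aestronglyMeasurable
  · refine Filter.Eventually.of_forall fun t => ?_
    simp only [norm_mul]
    exact mul_le_of_le_one_right (norm_nonneg _) (hb _)

open MeasureTheory intervalIntegral in
theorem abs_sum_mul_sqrt_mul_comp_div_sub_le {c : ℕ → ℝ} {κ B Y : ℝ} (hY : 1 ≤ Y) (hc0 : c 0 = 0)
    (hκ : |κ| ≤ B) (hB : ∀ t : ℝ, 1 ≤ t → |∑ k ∈ Finset.Icc 0 ⌊t⌋₊, c k - κ * t| ≤ B)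
    {h h' : ℝ → ℝ} (hh : ∀ x, HasDerivAt h (h' x) x) (hh'c : Continuous h') (hb : ∀ x, |h x| ≤ 1)
    (hb' : ∀ x, |h' x| ≤ 1) {ω : ℝ} (hω : 0 ≤ ω) :
    |∑ k ∈ Finset.Icc 0 ⌊Y⌋₊, (k * √k * h (ω / k)) * c k - κ * ∫ t in (0 : ℝ)..Y, t * √t * h (ω / t)| ≤
      B * (4 * (Y * √Y) + 2 * ω * √Y) := by
  have hcont : Continuous h := continuous_iff_continuousAt.mpr fun x => (hh x).continuousAt
  have hB0 : 0 ≤ B := (abs_nonneg _).trans hκ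
  set f : ℝ → ℝ := fun t => t * √t * h (ω / t) with hfdef
  set f' : ℝ → ℝ := fun t => 3 / 2 * √t * h (ω / t) + t * √t * (h' (ω / t) * (-ω / t ^ 2)) with hf'def
  have hii : ∀ a b, IntervalIntegrable f volume a b := fun a b =>
    intervalIntegrable_mul_comp_div (p := fun t => t * √t) (by fun_prop) hcont.measurable hb ω a b
  have hsq : ∀ t : ℝ, 0 < t → √t * √t = t := fun t ht => Real.mul_self_sqrt ht.le
  have hf : ∀ t ∈ Set.Icc 1 Y, HasDerivAt f (f' t) t := by
    intro t ht
    have ht0 : (0 : ℝ) < t := by linarith [ht.1]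
    have hs0 : 0 < √t := Real.sqrt_pos.mpr ht0
    have d1 : HasDerivAt (fun t : ℝ => ω / t) (-ω / t ^ 2) t := by
      have := (hasDerivAt_const t ω).div (hasDerivAt_id t) ht0.ne'
      exact (this.congr_deriv (by simp)).congr_of_eventuallyEq (Filter.Eventually.of_forall fun _ => rfl)
    have d2 : HasDerivAt (fun t : ℝ => t * √t) (3 / 2 * √t) t := by
      have := (hasDerivAt_id t).mul (Real.hasDerivAt_sqrt ht0.ne')
      refine this.congr_deriv ?_
      simp only [id]
      field_simp
      nlinarith [hsq t ht0]
    exact d2.mul ((hh _).comp t d1)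
  have hne : ∀ t ∈ Set.Icc 1 Y, t ≠ 0 := fun t ht => by linarith [ht.1]
  have hdiv : ContinuousOn (fun t : ℝ => ω / t) (Set.Icc 1 Y) := continuousOn_const.div continuousOn_id hne
  have hf'c : ContinuousOn f' (Set.Icc 1 Y) := by
    refine ContinuousOn.add ?_ ?_
    · exact ((continuous_const.mul Real.continuous_sqrt).continuousOn).mul (hcont.comp_continuousOn hdiv)
    · exact ((continuous_id.mul Real.continuous_sqrt).continuousOn).mul ((hh'c.comp_continuousOn hdiv).mul
        (continuousOn_const.div (continuousOn_id.pow 2) fun t ht => pow_ne_zero 2 (hne t ht)))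
  set g : ℝ → ℝ := fun t => 3 / 2 * √t + ω * (1 / √t) with hgdef
  have hgc : ContinuousOn g (Set.Icc 1 Y) := by
    have : ContinuousOn (fun t : ℝ => 1 / √t) (Set.Icc 1 Y) :=
      continuousOn_const.div Real.continuous_sqrt.continuousOn fun t ht =>
        (Real.sqrt_pos.mpr (by linarith [ht.1])).ne'
    fun_prop
  have hfg : ∀ t ∈ Set.Icc 1 Y, |f' t| ≤ g t := by
    intro t ht
    have ht0 : (0 : ℝ) < t := by linarith [ht.1]
    have hs0 : 0 < √t := Real.sqrt_pos.mpr ht0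
    have h1 : |3 / 2 * √t * h (ω / t)| ≤ 3 / 2 * √t := by
      rw [abs_mul, abs_of_pos (by positivity : 0 < 3 / 2 * √t)]
      exact mul_le_of_le_one_right (by positivity) (hb _)
    have h2 : |t * √t * (h' (ω / t) * (-ω / t ^ 2))| ≤ ω * (1 / √t) := by
      have e : t * √t * (h' (ω / t) * (-ω / t ^ 2)) = h' (ω / t) * (-(ω * (1 / √t))) := by
        field_simp
        rw [Real.sq_sqrt ht0.le]
      rw [e, abs_mul, abs_neg, abs_of_nonneg (by positivity : 0 ≤ ω * (1 / √t))]
      exact mul_le_of_le_one_left (by positivity) (hb' _)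
    have := (abs_add_le (3 / 2 * √t * h (ω / t)) (t * √t * (h' (ω / t) * (-ω / t ^ 2))))
    simp only [hf'def, hgdef]
    linarith
  have hP := abs_sum_mul_sub_integral_le hY hc0 hκ hB hf hf'c hgc hfg
  have hu : Set.uIcc 1 Y = Set.Icc 1 Y := Set.uIcc_of_le hY
  have hG : ∫ t in (1 : ℝ)..Y, g t = (Y * √Y + 2 * ω * √Y) - (1 * √1 + 2 * ω * √1) := by
    apply integral_eq_sub_of_hasDerivAt (f := fun t => t * √t + 2 * ω * √t)
    · intro t ht
      rw [hu] at ht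
      have ht0 : (0 : ℝ) < t := by linarith [ht.1]
      have hs0 : 0 < √t := Real.sqrt_pos.mpr ht0
      have := ((hasDerivAt_id t).mul (Real.hasDerivAt_sqrt ht0.ne')).add
        ((Real.hasDerivAt_sqrt ht0.ne').const_mul (2 * ω))
      refine this.congr_deriv ?_
      simp only [hgdef, id]
      field_simp
      nlinarith [hsq t ht0]
    · apply ContinuousOn.intervalIntegrable; rw [hu]; exact hgc
  have hfb : ∀ t : ℝ, 0 ≤ t → |f t| ≤ t * √t := by
    intro t ht
    simp only [hfdef]
    rw [abs_mul, abs_of_nonneg (by positivity : 0 ≤ t * √t)]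
    exact mul_le_of_le_one_right (by positivity) (hb _)
  have hf1 : |f 1| ≤ 1 := by simpa using hfb 1 zero_le_one
  have hfY := hfb Y (by linarith)
  have h01 : |∫ t in (0 : ℝ)..1, f t| ≤ 1 := by
    have := norm_integral_le_of_norm_le_const (a := (0 : ℝ)) (b := 1) (f := f) (C := 1) (fun t ht => by
      rw [Set.uIoc_of_le zero_le_one] at ht
      rw [Real.norm_eq_abs]
      refine (hfb t ht.1.le).trans ?_
      exact mul_le_one₀ ht.2 (Real.sqrt_nonneg _) (Real.sqrt_le_one.mpr ht.2))
    simpa using this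
  have hsplit := integral_add_adjacent_intervals (hii 0 1) (hii 1 Y)
  have hYY : 1 ≤ Y * √Y := by
    have : 1 ≤ √Y := Real.one_le_sqrt.mpr hY
    nlinarith
  rw [← hsplit]
  have e : ∑ k ∈ Finset.Icc 0 ⌊Y⌋₊, (k * √k * h (ω / k)) * c k -
      κ * ((∫ t in (0 : ℝ)..1, f t) + ∫ t in (1 : ℝ)..Y, f t) =
      (∑ k ∈ Finset.Icc 0 ⌊Y⌋₊, f k * c k - κ * ∫ t in (1 : ℝ)..Y, f t) +
        - (κ * ∫ t in (0 : ℝ)..1, f t) := by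
    simp only [hfdef]; ring
  rw [e]
  have hk1 : |κ * ∫ t in (0 : ℝ)..1, f t| ≤ B * 1 := by
    rw [abs_mul]; exact mul_le_mul hκ h01 (abs_nonneg _) hB0
  refine (abs_add_le _ _).trans ?_
  rw [abs_neg]
  refine (add_le_add hP hk1).trans ?_
  rw [hG, ← mul_add]
  refine mul_le_mul_of_nonneg_left ?_ hB0
  rw [Real.sqrt_one]
  linarith

/-- The sum over odd `N ≤ Y` of the `k`-th dual terms at `x`. -/
noncomputable def dualColumn (Y : ℝ) (k : ℕ) (x : ℝ) : ℝ :=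
  ∑ N ∈ (Finset.Icc 0 ⌊Y⌋₊).filter (fun N => Odd N),
    J(2 | N) * completedJacobi k N * (N * √N * cosOrSin N (Real.pi * k * x / N))

noncomputable def phaseIntegral (Y w : ℝ) : ℝ :=
  ∫ t in (0 : ℝ)..Y, t * √t * (Real.cos (w / t) + Real.sin (w / t))

noncomputable def dualDensity (k : ℕ) : ℝ := if IsSquare (2 * k) then 1 / 4 else 0

theorem dualDensity_nonneg (k : ℕ) : 0 ≤ dualDensity k := by
  unfold dualDensity; split_ifs <;> norm_num

theorem dualDensity_le (k : ℕ) : dualDensity k ≤ 1 / 4 := by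
  unfold dualDensity; split_ifs <;> norm_num

theorem abs_sum_class_sub_le {k : ℕ} (hk : k ≠ 0) {b : ℕ} (hb : b < 4) (hbo : Odd b) {t : ℝ} (ht : 1 ≤ t) :
    |∑ N ∈ Finset.Icc 0 ⌊t⌋₊, (if N % 4 = b then (J(2 | N) * completedJacobi k N : ℝ) else 0) -
      dualDensity k * t| ≤ 9 * (k : ℝ) ^ 2 := by
  have h := abs_sum_completedJacobi_sub_le hk hb hbo (⌊t⌋₊ + 1)
  rw [Finset.sum_filter, Nat.range_succ_eq_Icc_zero] at h
  have h1 := Nat.floor_le (by linarith : 0 ≤ t)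
  have h2 := Nat.lt_floor_add_one t
  have hk1 : (1 : ℝ) ≤ (k : ℝ) ^ 2 := one_le_pow₀ (by exact_mod_cast Nat.pos_of_ne_zero hk)
  have hd := dualDensity_nonneg k
  have hd' := dualDensity_le k
  change |_ - dualDensity k * _| ≤ _ at h
  push_cast at h
  rw [abs_le] at h ⊢
  constructor <;> nlinarith [h.1, h.2]

open MeasureTheory intervalIntegral in
theorem abs_dualColumn_sub_le {k : ℕ} (hk : k ≠ 0) {Y : ℝ} (hY : 1 ≤ Y) {x : ℝ} (hx : 0 ≤ x) :
    |dualColumn Y k x - dualDensity k * phaseIntegral Y (Real.pi * k * x)| ≤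
      18 * (k : ℝ) ^ 2 * (4 * (Y * √Y) + 2 * (Real.pi * k * x) * √Y) := by
  have hω : 0 ≤ Real.pi * k * x := by positivity
  have hk1 : (1 : ℝ) ≤ (k : ℝ) ^ 2 := one_le_pow₀ (by exact_mod_cast Nat.pos_of_ne_zero hk)
  have hκ : |dualDensity k| ≤ 9 * (k : ℝ) ^ 2 := by
    rw [abs_of_nonneg (dualDensity_nonneg k)]; linarith [dualDensity_le k]
  have h1 := abs_sum_mul_sqrt_mul_comp_div_sub_le hY (by simp) hκ
    (fun t ht => abs_sum_class_sub_le hk (b := 1) (by norm_num) odd_one ht) (h := Real.cos)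
    (h' := fun x => - Real.sin x) Real.hasDerivAt_cos (by fun_prop) Real.abs_cos_le_one
    (fun x => by rw [abs_neg]; exact Real.abs_sin_le_one x) hω
  have h3 := abs_sum_mul_sqrt_mul_comp_div_sub_le hY (by simp) hκ
    (fun t ht => abs_sum_class_sub_le hk (b := 3) (by norm_num) (by decide) ht) (h := Real.sin)
    (h' := Real.cos) Real.hasDerivAt_sin (by fun_prop) Real.abs_sin_le_one Real.abs_cos_le_one hω
  have e1 : phaseIntegral Y (Real.pi * k * x) = (∫ t in (0 : ℝ)..Y, t * √t * Real.cos (Real.pi * k * x / t)) +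
      ∫ t in (0 : ℝ)..Y, t * √t * Real.sin (Real.pi * k * x / t) := by
    rw [phaseIntegral, ← intervalIntegral.integral_add]
    · congr 1; ext t; ring
    · exact intervalIntegrable_mul_comp_div (p := fun t => t * √t) (by fun_prop)
        Real.measurable_cos Real.abs_cos_le_one _ _ _
    · exact intervalIntegrable_mul_comp_div (p := fun t => t * √t) (by fun_prop)
        Real.measurable_sin Real.abs_sin_le_one _ _ _
  have e2 : dualColumn Y k x =
      (∑ N ∈ Finset.Icc 0 ⌊Y⌋₊, (N * √N * Real.cos (Real.pi * k * x / N)) *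
        (if N % 4 = 1 then (J(2 | N) * completedJacobi k N : ℝ) else 0)) +
      ∑ N ∈ Finset.Icc 0 ⌊Y⌋₊, (N * √N * Real.sin (Real.pi * k * x / N)) *
        (if N % 4 = 3 then (J(2 | N) * completedJacobi k N : ℝ) else 0) := by
    rw [dualColumn, Finset.sum_filter, ← Finset.sum_add_distrib]
    refine Finset.sum_congr rfl fun N _ => ?_
    unfold cosOrSin
    by_cases h1 : N % 4 = 1
    · rw [if_pos (by rw [Nat.odd_iff]; omega), if_pos h1, if_pos h1, if_neg (by omega)]; ring
    · by_cases h3 : N % 4 = 3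
      · rw [if_pos (by rw [Nat.odd_iff]; omega), if_neg h1, if_neg h1, if_pos h3]; ring
      · rw [if_neg (by rw [Nat.odd_iff]; omega), if_neg h1, if_neg h3]; ring
  rw [e1, e2]
  rw [abs_le] at h1 h3 ⊢
  constructor <;> linarith [h1.1, h1.2, h3.1, h3.2]

noncomputable def sumInvOddSquareDivisors (k : ℕ) : ℝ := ∑ l ∈ oddSquareDivisors k, 1 / (l : ℝ)

theorem one_le_sumInvOddSquareDivisors {k : ℕ} (hk : k ≠ 0) : 1 ≤ sumInvOddSquareDivisors k := by
  have h1 : 1 ∈ oddSquareDivisors k := (mem_oddSquareDivisors hk).mpr ⟨odd_one, by simp⟩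
  have := Finset.single_le_sum (f := fun l : ℕ => 1 / (l : ℝ)) (fun _ _ => by positivity) h1
  simpa [sumInvOddSquareDivisors] using this

theorem sum_abs_completedJacobi_le {k : ℕ} (hk : k ≠ 0) {Y : ℝ} (hY : 0 ≤ Y) :
    ∑ N ∈ (Finset.Icc 0 ⌊Y⌋₊).filter (fun N => Odd N), |completedJacobi k N| ≤
      Y * sumInvOddSquareDivisors k := by
  have h1 : ∀ N ∈ (Finset.Icc 0 ⌊Y⌋₊).filter (fun N => Odd N), |completedJacobi k N| ≤
      ∑ l ∈ oddSquareDivisors k, if l * l ∣ N then (l : ℝ) else 0 := by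
    intro N hN
    rw [completedJacobi_eq_sum_oddSquareDivisors hk (Finset.mem_filter.mp hN).2]
    refine (Finset.abs_sum_le_sum_abs _ _).trans (Finset.sum_le_sum fun l _ => ?_)
    split_ifs
    · rw [abs_mul, Nat.abs_cast]
      exact mul_le_of_le_one_right (Nat.cast_nonneg _) (abs_jacobiSym_cast_le _ _)
    · simp
  refine (Finset.sum_le_sum h1).trans ?_
  rw [Finset.sum_comm, sumInvOddSquareDivisors, Finset.mul_sum]
  refine Finset.sum_le_sum fun l hl => ?_
  have hl0 := ((mem_oddSquareDivisors hk).mp hl).1.pos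
  have hlR : (0 : ℝ) < l := by exact_mod_cast hl0
  have hc : (((Finset.Icc 0 ⌊Y⌋₊).filter (fun N => Odd N)).filter (fun N => l * l ∣ N)).card ≤ ⌊Y⌋₊ / (l * l) := by
    rw [← Nat.Ioc_filter_dvd_card_eq_div]
    refine Finset.card_le_card fun N hN => ?_
    simp only [Finset.mem_filter, Finset.mem_Icc, Finset.mem_Ioc] at hN ⊢
    exact ⟨⟨hN.1.2.pos, hN.1.1.2⟩, hN.2⟩
  rw [← Finset.sum_filter, Finset.sum_const, nsmul_eq_mul]
  calc _ ≤ ((⌊Y⌋₊ / (l * l) : ℕ) : ℝ) * l := by gcongr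
    _ ≤ (Y / (l * l)) * l := by
      gcongr
      refine Nat.cast_div_le.trans ?_
      push_cast
      gcongr
      exact Nat.floor_le hY
    _ = _ := by field_simp

theorem abs_dualColumn_le {k : ℕ} (hk : k ≠ 0) {Y : ℝ} (hY : 0 ≤ Y) (x : ℝ) :
    |dualColumn Y k x| ≤ Y ^ 2 * √Y * sumInvOddSquareDivisors k := by
  refine (Finset.abs_sum_le_sum_abs _ _).trans ?_
  calc _ ≤ ∑ N ∈ (Finset.Icc 0 ⌊Y⌋₊).filter (fun N => Odd N), |completedJacobi k N| * (Y * √Y) := by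
        refine Finset.sum_le_sum fun N hN => ?_
        have hNY : (N : ℝ) ≤ Y :=
          (Nat.cast_le.mpr (Finset.mem_Icc.mp (Finset.mem_filter.mp hN).1).2).trans (Nat.floor_le hY)
        rw [abs_mul, abs_mul, abs_mul, abs_of_nonneg (by positivity : (0 : ℝ) ≤ N * √N)]
        have h1 := abs_jacobiSym_cast_le 2 N
        have h2 := abs_cosOrSin_le N (Real.pi * k * x / N)
        have h3 : (N : ℝ) * √N ≤ Y * √Y := by gcongr
        calc _ ≤ (1 * |completedJacobi k N|) * ((Y * √Y) * 1) := by gcongr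
          _ = _ := by ring
    _ ≤ _ := by
      rw [← Finset.sum_mul]
      calc _ ≤ Y * sumInvOddSquareDivisors k * (Y * √Y) :=
            mul_le_mul_of_nonneg_right (sum_abs_completedJacobi_le hk hY) (by positivity)
        _ = _ := by ring

open MeasureTheory intervalIntegral in
theorem abs_phaseIntegral_le {Y : ℝ} (hY : 0 ≤ Y) (w : ℝ) : |phaseIntegral Y w| ≤ 2 * (Y ^ 2 * √Y) := by
  have := norm_integral_le_of_norm_le_const (a := (0 : ℝ)) (b := Y) (C := 2 * (Y * √Y))
    (f := fun t => t * √t * (Real.cos (w / t) + Real.sin (w / t))) (fun t ht => by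
      rw [Set.uIoc_of_le hY] at ht
      rw [norm_mul, Real.norm_eq_abs, Real.norm_eq_abs, abs_of_nonneg (by have := ht.1; positivity : 0 ≤ t * √t)]
      have h1 : |Real.cos (w / t) + Real.sin (w / t)| ≤ 2 := (abs_add_le _ _).trans (by
        linarith [Real.abs_cos_le_one (w / t), Real.abs_sin_le_one (w / t)])
      have h2 : t * √t ≤ Y * √Y := by have := ht.1; have := ht.2; gcongr
      have := ht.1
      calc _ ≤ (Y * √Y) * 2 := by gcongr
        _ = _ := by ring)
  rw [phaseIntegral, ← Real.norm_eq_abs]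
  refine this.trans (le_of_eq ?_)
  rw [sub_zero, abs_of_nonneg hY]; ring

theorem sum_filter_dvd_inv_sq_le {q : ℕ} (hq : 0 < q) (K n : ℕ) :
    ∑ k ∈ (Finset.Ioc K n).filter (fun k => q ∣ k), 1 / (k : ℝ) ^ 2 ≤ 2 / ((q : ℝ) * (K + 1)) := by
  have hqR : (0 : ℝ) < q := by exact_mod_cast hq
  have h1 : ∑ k ∈ (Finset.Ioc K n).filter (fun k => q ∣ k), 1 / (k : ℝ) ^ 2 =
      ∑ j ∈ ((Finset.Ioc K n).filter (fun k => q ∣ k)).image (fun k => k / q), 1 / (q : ℝ) ^ 2 * ((j : ℝ) ^ 2)⁻¹ := by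
    rw [Finset.sum_image]
    · refine Finset.sum_congr rfl fun k hk => ?_
      obtain ⟨j, rfl⟩ := (Finset.mem_filter.mp hk).2
      rw [Nat.mul_div_cancel_left _ hq]; push_cast; rw [mul_pow, one_div, one_div, mul_inv]
    · intro a ha b hb hab
      obtain ⟨j, rfl⟩ := (Finset.mem_filter.mp ha).2
      obtain ⟨i, rfl⟩ := (Finset.mem_filter.mp hb).2
      simp only [Nat.mul_div_cancel_left _ hq] at hab
      rw [hab]
  rw [h1, ← Finset.mul_sum]
  have h2 : ((Finset.Ioc K n).filter (fun k => q ∣ k)).image (fun k => k / q) ⊆ Finset.Ioo (K / q) (n + 1) := by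
    intro j hj
    obtain ⟨k, hk, rfl⟩ := Finset.mem_image.mp hj
    obtain ⟨hk1, i, rfl⟩ := Finset.mem_filter.mp hk
    rw [Finset.mem_Ioc] at hk1
    rw [Nat.mul_div_cancel_left _ hq, Finset.mem_Ioo]
    refine ⟨(Nat.div_lt_iff_lt_mul hq).mpr (by linarith [hk1.1, mul_comm q i]), ?_⟩
    have : i ≤ q * i := Nat.le_mul_of_pos_left _ hq
    omega
  have h3 := (Finset.sum_le_sum_of_subset_of_nonneg h2 (f := fun j : ℕ => ((j : ℝ) ^ 2)⁻¹)
    (fun _ _ _ => by positivity)).trans (sum_Ioo_inv_sq_le (α := ℝ) (K / q) (n + 1))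
  have h4 : ((K : ℝ) + 1) / q ≤ (K / q : ℕ) + 1 := by
    rw [div_le_iff₀ hqR]
    have := Nat.lt_mul_of_div_lt (Nat.lt_succ_self (K / q)) hq
    rw [Nat.succ_eq_add_one] at this
    have h5 : K + 1 ≤ (K / q + 1) * q := by linarith [mul_comm q (K / q + 1)]
    exact_mod_cast h5
  calc _ ≤ 1 / (q : ℝ) ^ 2 * (2 / ((K / q : ℕ) + 1)) := by gcongr
    _ ≤ 1 / (q : ℝ) ^ 2 * (2 / (((K : ℝ) + 1) / q)) := by gcongr
    _ = _ := by field_simp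

theorem sum_Icc_inv_sq_le (n : ℕ) : ∑ l ∈ Finset.Icc 1 n, 1 / (l : ℝ) ^ 2 ≤ 2 := by
  have := sum_Ioo_inv_sq_le (α := ℝ) 0 (n + 1)
  have e : Finset.Ioo 0 (n + 1) = Finset.Icc 1 n := by
    ext l; simp only [Finset.mem_Ioo, Finset.mem_Icc]; omega
  rw [e] at this
  simpa using this

theorem sum_inv_sq_mul_sumInvOddSquareDivisors_le (K n : ℕ) :
    ∑ k ∈ Finset.Ioc K n, 1 / (k : ℝ) ^ 2 * sumInvOddSquareDivisors k ≤ 4 / ((K : ℝ) + 1) := by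
  have h1 : ∀ k ∈ Finset.Ioc K n, 1 / (k : ℝ) ^ 2 * sumInvOddSquareDivisors k ≤
      ∑ l ∈ Finset.Icc 1 n, 1 / (l : ℝ) * (if l * l ∣ k then 1 / (k : ℝ) ^ 2 else 0) := by
    intro k hk
    rw [Finset.mem_Ioc] at hk
    have hk0 : k ≠ 0 := by omega
    rw [sumInvOddSquareDivisors, Finset.mul_sum]
    have hsub : oddSquareDivisors k ⊆ Finset.Icc 1 n := fun l hl => by
      obtain ⟨h1, h2⟩ := (mem_oddSquareDivisors hk0).mp hl
      have h3 := Nat.le_of_dvd (by omega) h2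
      have h4 := h1.pos
      rw [Finset.mem_Icc]
      exact ⟨h4, by nlinarith⟩
    refine le_trans (le_of_eq ?_) (Finset.sum_le_sum_of_subset_of_nonneg hsub fun l _ _ => ?_)
    · refine Finset.sum_congr rfl fun l hl => ?_
      rw [if_pos ((mem_oddSquareDivisors hk0).mp hl).2, mul_comm]
    · split_ifs <;> positivity
  refine (Finset.sum_le_sum h1).trans ?_
  rw [Finset.sum_comm]
  calc _ ≤ ∑ l ∈ Finset.Icc 1 n, 1 / (l : ℝ) ^ 2 * (2 / ((K : ℝ) + 1)) := by
        refine Finset.sum_le_sum fun l hl => ?_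
        have hl0 : 0 < l := (Finset.mem_Icc.mp hl).1
        have hlR : (1 : ℝ) ≤ l := by exact_mod_cast hl0
        rw [← Finset.mul_sum, ← Finset.sum_filter]
        calc _ ≤ 1 / (l : ℝ) * (2 / (((l * l : ℕ) : ℝ) * ((K : ℝ) + 1))) := by
              gcongr
              exact sum_filter_dvd_inv_sq_le (by positivity) K n
          _ ≤ 1 * (2 / (((l * l : ℕ) : ℝ) * ((K : ℝ) + 1))) := by
              gcongr
              exact (div_le_one (by linarith)).mpr hlR
          _ = _ := by push_cast; field_simp
    _ ≤ 2 * (2 / ((K : ℝ) + 1)) := by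
        rw [← Finset.sum_mul]
        gcongr
        exact sum_Icc_inv_sq_le n
    _ = _ := by ring

theorem summable_and_tsum_le_of_split {f : ℕ → ℝ} (hf : ∀ k, 0 ≤ f k) {K : ℕ} {H R : ℝ}
    (hH : ∑ k ∈ Finset.range (K + 1), f k ≤ H) (hR : ∀ n, ∑ k ∈ Finset.Ioc K n, f k ≤ R) :
    Summable f ∧ ∑' k, f k ≤ H + R := by
  have h : ∀ n, ∑ k ∈ Finset.range n, f k ≤ H + R := by
    intro n
    have hsub : Finset.range n ⊆ Finset.range (K + 1) ∪ Finset.Ioc K n := by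
      intro k hk
      simp only [Finset.mem_range, Finset.mem_union, Finset.mem_Ioc] at hk ⊢; omega
    refine (Finset.sum_le_sum_of_subset_of_nonneg hsub fun _ _ _ => hf _).trans ?_
    rw [Finset.sum_union]
    · exact add_le_add hH (hR n)
    · rw [Finset.disjoint_left]; intro k hk
      simp only [Finset.mem_range, Finset.mem_Ioc] at hk ⊢; omega
  exact ⟨summable_of_sum_range_le hf h, Real.tsum_le_of_sum_range_le hf h⟩

noncomputable def phaseDerivIntegral (Y w : ℝ) : ℝ :=
  ∫ t in (0 : ℝ)..Y, √t * (Real.sin (w / t) - Real.cos (w / t))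

open MeasureTheory in
theorem hasDerivAt_phaseIntegral {Y : ℝ} (hY : 0 ≤ Y) (w : ℝ) :
    HasDerivAt (phaseIntegral Y) (-phaseDerivIntegral Y w) w := by
  have hm : ∀ x : ℝ, Measurable fun t : ℝ => x / t := fun x => measurable_const.div measurable_id
  have h := intervalIntegral.hasDerivAt_integral_of_dominated_loc_of_deriv_le (μ := volume) (a := 0) (b := Y)
    (F := fun w t => t * √t * (Real.cos (w / t) + Real.sin (w / t)))
    (F' := fun w t => -(√t * (Real.sin (w / t) - Real.cos (w / t)))) (bound := fun t => 2 * √t)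
    (x₀ := w) (s := Set.univ) Filter.univ_mem ?_ ?_ ?_ ?_ ?_ ?_
  · have h2 := h.2
    rw [intervalIntegral.integral_neg] at h2
    exact h2
  · refine Filter.Eventually.of_forall fun x => Measurable.aestronglyMeasurable ?_
    have := hm x
    fun_prop
  · have h1 := intervalIntegrable_mul_comp_div (p := fun t => t * √t) (by fun_prop)
        Real.measurable_cos Real.abs_cos_le_one w 0 Y
    have h2 := intervalIntegrable_mul_comp_div (p := fun t => t * √t) (by fun_prop)
        Real.measurable_sin Real.abs_sin_le_one w 0 Y
    have h3 := h1.add h2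
    simp only [← mul_add] at h3
    exact h3
  · refine Measurable.aestronglyMeasurable ?_
    have := hm w
    fun_prop
  · refine ae_of_all _ fun t _ x _ => ?_
    rw [norm_neg, norm_mul, Real.norm_eq_abs, Real.norm_eq_abs, abs_of_nonneg (Real.sqrt_nonneg _), mul_comm]
    gcongr
    exact (abs_sub _ _).trans (by linarith [Real.abs_cos_le_one (x / t), Real.abs_sin_le_one (x / t)])
  · exact (continuous_const.mul Real.continuous_sqrt).intervalIntegrable _ _
  · refine ae_of_all _ fun t ht x _ => ?_
    rw [Set.uIoc_of_le hY] at ht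
    have ht0 := ht.1
    have d1 : HasDerivAt (fun x : ℝ => x / t) (1 / t) x := (hasDerivAt_id x).div_const t
    have := ((d1.cos.add d1.sin).const_mul (t * √t))
    refine this.congr_deriv ?_
    field_simp
    ring

theorem abs_phaseDerivIntegral_le {Y : ℝ} (hY : 0 ≤ Y) (w : ℝ) : |phaseDerivIntegral Y w| ≤ 2 * (Y * √Y) := by
  have := intervalIntegral.norm_integral_le_of_norm_le_const (a := (0 : ℝ)) (b := Y) (C := 2 * √Y)
    (f := fun t => √t * (Real.sin (w / t) - Real.cos (w / t))) (fun t ht => by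
      rw [Set.uIoc_of_le hY] at ht
      rw [norm_mul, Real.norm_eq_abs, Real.norm_eq_abs, abs_of_nonneg (Real.sqrt_nonneg _)]
      have h1 : |Real.sin (w / t) - Real.cos (w / t)| ≤ 2 := (abs_sub _ _).trans (by
        linarith [Real.abs_cos_le_one (w / t), Real.abs_sin_le_one (w / t)])
      have h2 : √t ≤ √Y := Real.sqrt_le_sqrt ht.2
      calc _ ≤ √Y * 2 := by gcongr
        _ = _ := by ring)
  rw [phaseDerivIntegral, ← Real.norm_eq_abs]
  refine this.trans (le_of_eq ?_)
  rw [sub_zero, abs_of_nonneg hY]; ring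

/-- The main term of the completed sum, up to a constant. -/
noncomputable def mainTerm (Y x : ℝ) : ℝ :=
  x * √Y / 4 + 1 / (8 * Real.pi) * ∑' j : ℕ, 1 / (j : ℝ) ^ 2 * phaseDerivIntegral Y (2 * Real.pi * j ^ 2 * x)

noncomputable def mainTermAntideriv (Y x : ℝ) : ℝ :=
  x ^ 2 * √Y / 8 - 1 / (16 * Real.pi ^ 2) *
    ∑' j : ℕ, 1 / (j : ℝ) ^ 4 * phaseIntegral Y (2 * Real.pi * j ^ 2 * x)

theorem summable_phaseIntegral {Y : ℝ} (hY : 0 ≤ Y) (x : ℝ) :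
    Summable fun j : ℕ => 1 / (j : ℝ) ^ 4 * phaseIntegral Y (2 * Real.pi * j ^ 2 * x) := by
  refine Summable.of_norm_bounded ((Real.summable_one_div_nat_pow.mpr (by norm_num : 1 < 4)).mul_right
    (2 * (Y ^ 2 * √Y))) fun j => ?_
  rw [norm_mul, Real.norm_of_nonneg (by positivity)]
  exact mul_le_mul_of_nonneg_left (abs_phaseIntegral_le hY _) (by positivity)

theorem hasDerivAt_mainTermAntideriv {Y : ℝ} (hY : 0 ≤ Y) (x : ℝ) :
    HasDerivAt (mainTermAntideriv Y) (mainTerm Y x) x := by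
  have h1 : HasDerivAt (fun x : ℝ => ∑' j : ℕ, 1 / (j : ℝ) ^ 4 * phaseIntegral Y (2 * Real.pi * j ^ 2 * x))
      (∑' j : ℕ, -(2 * Real.pi) * (1 / (j : ℝ) ^ 2 * phaseDerivIntegral Y (2 * Real.pi * j ^ 2 * x))) x := by
    refine hasDerivAt_tsum (y₀ := 0) (u := fun j : ℕ => 1 / (j : ℝ) ^ 2 * (2 * Real.pi * (2 * (Y * √Y))))
      (g := fun (j : ℕ) (x : ℝ) => 1 / (j : ℝ) ^ 4 * phaseIntegral Y (2 * Real.pi * j ^ 2 * x))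
      (g' := fun (j : ℕ) (x : ℝ) =>
        -(2 * Real.pi) * (1 / (j : ℝ) ^ 2 * phaseDerivIntegral Y (2 * Real.pi * j ^ 2 * x)))
      ((Real.summable_one_div_nat_pow.mpr (by norm_num : 1 < 2)).mul_right _) ?_ ?_ (summable_phaseIntegral hY 0) x
    · intro j y
      have d1 : HasDerivAt (fun y : ℝ => 2 * Real.pi * j ^ 2 * y) (2 * Real.pi * j ^ 2) y := by
        simpa using (hasDerivAt_id y).const_mul (2 * Real.pi * (j : ℝ) ^ 2)
      have d2 := ((hasDerivAt_phaseIntegral hY _).comp y d1).const_mul (1 / (j : ℝ) ^ 4)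
      refine d2.congr_deriv ?_
      rcases Nat.eq_zero_or_pos j with rfl | hj
      · simp
      · have : (j : ℝ) ≠ 0 := by positivity
        field_simp
    · intro j y
      rw [norm_mul, norm_mul, Real.norm_of_nonneg (by positivity : 0 ≤ 1 / (j : ℝ) ^ 2), norm_neg,
        Real.norm_of_nonneg (by positivity : 0 ≤ 2 * Real.pi), ← mul_assoc, mul_comm (2 * Real.pi), mul_assoc]
      gcongr
      exact abs_phaseDerivIntegral_le hY _
  have h2 : HasDerivAt (fun x : ℝ => x ^ 2 * √Y / 8) (2 * x * √Y / 8) x := by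
    simpa using ((hasDerivAt_pow 2 x).mul_const (√Y)).div_const 8
  refine (h2.sub (h1.const_mul (1 / (16 * Real.pi ^ 2)))).congr_deriv ?_
  rw [tsum_mul_left, mainTerm]
  have := Real.pi_pos
  field_simp
  ring

theorem exists_secondDiff_mainTermAntideriv {Y X D : ℝ} (hY : 0 ≤ Y) (hD : 0 < D) :
    ∃ ξ ∈ Set.Ioo X (X + D), ∃ η ∈ Set.Ioo 0 D,
      secondDiff (mainTermAntideriv Y) X D / D = mainTerm Y ξ - mainTerm Y η := by
  have hc : Continuous (mainTermAntideriv Y) :=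
    continuous_iff_continuousAt.mpr fun x => (hasDerivAt_mainTermAntideriv hY x).continuousAt
  obtain ⟨ξ, hξ, h1⟩ := exists_hasDerivAt_eq_slope (mainTermAntideriv Y) (mainTerm Y)
    (by linarith : X < X + D) hc.continuousOn fun x _ => hasDerivAt_mainTermAntideriv hY x
  obtain ⟨η, hη, h2⟩ := exists_hasDerivAt_eq_slope (mainTermAntideriv Y) (mainTerm Y)
    hD hc.continuousOn fun x _ => hasDerivAt_mainTermAntideriv hY x
  refine ⟨ξ, hξ, η, hη, ?_⟩
  rw [h1, h2, secondDiff]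
  rw [add_sub_cancel_left, sub_zero]
  ring

theorem secondDiff_const_mul (c : ℝ) (φ : ℝ → ℝ) (X D : ℝ) :
    secondDiff (fun x => c * φ x) X D = c * secondDiff φ X D := by
  unfold secondDiff; ring

theorem secondDiff_sub (φ ψ : ℝ → ℝ) (X D : ℝ) :
    secondDiff (fun x => φ x - ψ x) X D = secondDiff φ X D - secondDiff ψ X D := by
  unfold secondDiff; ring

theorem secondDiff_sum {ι : Type*} (s : Finset ι) (φ : ι → ℝ → ℝ) (X D : ℝ) :
    secondDiff (fun x => ∑ i ∈ s, φ i x) X D = ∑ i ∈ s, secondDiff (φ i) X D := by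
  simp only [secondDiff, Finset.sum_add_distrib, Finset.sum_sub_distrib]

theorem hasSum_secondDiff {φ : ℕ → ℝ → ℝ} (h : ∀ x, Summable fun k => φ k x) (X D : ℝ) :
    HasSum (fun k => secondDiff (φ k) X D) (secondDiff (fun x => ∑' k, φ k x) X D) :=
  (((h _).hasSum.sub (h _).hasSum).sub (h _).hasSum).add (h _).hasSum

theorem abs_secondDiff_le {φ : ℝ → ℝ} {X D C : ℝ} (h0 : |φ 0| ≤ C) (h1 : |φ X| ≤ C) (h2 : |φ D| ≤ C)
    (h3 : |φ (X + D)| ≤ C) : |secondDiff φ X D| ≤ 4 * C := by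
  unfold secondDiff
  rw [abs_le] at *
  constructor <;> linarith [h0.1, h0.2, h1.1, h1.2, h2.1, h2.2, h3.1, h3.2]

theorem abs_completedJacobi_le (k N : ℕ) : |completedJacobi k N| ≤ ∑ l ∈ N.divisors, (l : ℝ) := by
  refine (Finset.abs_sum_le_sum_abs _ _).trans ?_
  refine le_trans (Finset.sum_le_sum fun l _ => ?_)
    (Finset.sum_le_sum_of_subset_of_nonneg (Finset.filter_subset _ _) fun l _ _ => Nat.cast_nonneg l)
  rw [abs_mul, Nat.abs_cast]
  exact mul_le_of_le_one_right (Nat.cast_nonneg _) (abs_jacobiSym_cast_le _ _)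

theorem summable_completedFourier (N : ℕ) (a : ℝ) :
    Summable fun k : ℕ => 1 / (k : ℝ) ^ 2 *
      ((-1) ^ k * (completedJacobi k N * cosOrSin N (Real.pi * k * a / N))) := by
  refine summable_one_div_sq_mul_of_abs_le (C := ∑ l ∈ N.divisors, (l : ℝ)) fun k => ?_
  rw [abs_mul, abs_pow, abs_neg, abs_one, one_pow, one_mul, abs_mul]
  calc _ ≤ |completedJacobi k N| * 1 := by gcongr; exact abs_cosOrSin_le _ _
    _ ≤ _ := by rw [mul_one]; exact abs_completedJacobi_le k N

theorem hasSum_sum_secondDiff_completedFourier (Y X D : ℝ) :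
    HasSum (fun k : ℕ => 1 / (k : ℝ) ^ 2 * ((-1) ^ k * secondDiff (dualColumn Y k) X D))
      (∑ N ∈ (Finset.Icc 0 ⌊Y⌋₊).filter (fun N => Odd N),
        N * √N * (J(2 | N) * secondDiff (completedFourier N) X D)) := by
  have h : HasSum (fun k : ℕ => ∑ N ∈ (Finset.Icc 0 ⌊Y⌋₊).filter (fun N => Odd N), N * √N * (J(2 | N) *
      secondDiff (fun a => 1 / (k : ℝ) ^ 2 *
        ((-1) ^ k * (completedJacobi k N * cosOrSin N (Real.pi * k * a / N)))) X D)) _ :=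
    hasSum_sum fun N _ => (((hasSum_secondDiff (summable_completedFourier N) X D).mul_left _).mul_left _)
  convert! h using 1
  ext k
  unfold dualColumn
  rw [secondDiff_sum, Finset.mul_sum, Finset.mul_sum]
  refine Finset.sum_congr rfl fun N _ => ?_
  unfold secondDiff
  ring

theorem tsum_dualDensity (F : ℕ → ℝ) :
    ∑' k : ℕ, 1 / (k : ℝ) ^ 2 * ((-1) ^ k * (dualDensity k * F k)) =
      1 / 16 * ∑' j : ℕ, 1 / (j : ℝ) ^ 4 * F (2 * j ^ 2) := by
  have hinj : Function.Injective fun j : ℕ => 2 * j ^ 2 := fun a b hab => by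
    have : a ^ 2 = b ^ 2 := by simpa using hab
    exact (Nat.pow_left_injective two_ne_zero) this
  rw [← tsum_mul_left, ← hinj.tsum_eq]
  · refine tsum_congr fun j => ?_
    rw [dualDensity, if_pos ⟨2 * j, by ring⟩, (even_two_mul (j ^ 2)).neg_one_pow]
    push_cast
    rcases Nat.eq_zero_or_pos j with rfl | hj
    · simp
    · have : (j : ℝ) ≠ 0 := by positivity
      field_simp; ring
  · intro k hk
    rw [Function.mem_support] at hk
    by_contra hcon
    apply hk
    rw [dualDensity, if_neg, zero_mul, mul_zero, mul_zero]
    rintro ⟨r, hr⟩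
    have : Even r := by
      have : Even (r * r) := by rw [← hr]; exact even_two_mul k
      rcases Nat.even_mul.mp this with h | h <;> exact h
    obtain ⟨j, rfl⟩ := this
    exact hcon ⟨j, by simp only []; nlinarith⟩

theorem sum_isSquare_eq (n : ℕ) :
    ∑ N ∈ (Finset.Icc 0 n).filter (fun N => Odd N), (if IsSquare N then (1 : ℝ) else 0) = ((n.sqrt + 1) / 2 : ℕ) := by
  have hcard : ∀ m : ℕ, ((Finset.range (m + 1)).filter (fun s => Odd s)).card = (m + 1) / 2 := by
    intro m
    induction m with
    | zero => simp
    | succ m ih =>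
      rw [Finset.range_add_one, Finset.filter_insert]
      split_ifs with h
      · rw [Finset.card_insert_of_notMem (by simp), ih]
        rw [Nat.odd_iff] at h; omega
      · rw [ih]; rw [Nat.odd_iff] at h; omega
  rw [← Finset.sum_filter, Finset.sum_const, nsmul_eq_mul, mul_one, ← hcard]
  congr 1
  symm
  refine Finset.card_bij (fun s _ => s * s) ?_ ?_ ?_
  · intro s hs
    simp only [Finset.mem_filter, Finset.mem_range, Finset.mem_Icc] at hs ⊢
    exact ⟨⟨⟨by omega, Nat.le_sqrt.mp (by omega)⟩, hs.2.mul hs.2⟩, s, rfl⟩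
  · intro a _ b _ hab
    exact Nat.mul_self_inj.mp hab
  · intro N hN
    simp only [Finset.mem_filter, Finset.mem_Icc] at hN
    obtain ⟨⟨⟨_, h1⟩, h2⟩, s, rfl⟩ := hN
    refine ⟨s, ?_, rfl⟩
    simp only [Finset.mem_filter, Finset.mem_range]
    exact ⟨by have := Nat.le_sqrt.mpr h1; omega, (Nat.odd_mul.mp h2).1⟩

theorem abs_sum_isSquare_sub_le {Y : ℝ} (hY : 0 ≤ Y) :
    |∑ N ∈ (Finset.Icc 0 ⌊Y⌋₊).filter (fun N => Odd N), (if IsSquare N then (1 : ℝ) else 0) - √Y / 2| ≤ 1 := by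
  rw [sum_isSquare_eq]
  set s := Nat.sqrt ⌊Y⌋₊
  have h1 : (s : ℝ) ≤ √Y := by
    rw [Real.le_sqrt (Nat.cast_nonneg _) hY]
    have : s ^ 2 ≤ ⌊Y⌋₊ := by rw [sq]; exact Nat.sqrt_le _
    exact (by exact_mod_cast this : (s : ℝ) ^ 2 ≤ ⌊Y⌋₊).trans (Nat.floor_le hY)
  have h2 : √Y < s + 1 := by
    rw [Real.sqrt_lt' (by positivity)]
    have : ⌊Y⌋₊ + 1 ≤ (s + 1) ^ 2 := by rw [sq]; exact Nat.succ_le_succ_sqrt _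
    exact (Nat.lt_floor_add_one Y).trans_le (by exact_mod_cast this)
  have h3 : (s : ℝ) ≤ 2 * ((s + 1) / 2 : ℕ) := by exact_mod_cast (by omega : s ≤ 2 * ((s + 1) / 2))
  have h4 : 2 * (((s + 1) / 2 : ℕ) : ℝ) ≤ s + 1 := by exact_mod_cast (by omega : 2 * ((s + 1) / 2) ≤ s + 1)
  rw [abs_le]
  constructor <;> linarith

theorem summable_and_abs_tsum_dualColumn_sub_le {X Y D K : ℝ} (hY : 1 ≤ Y) (hD : 0 < D) (hDX : D ≤ X)
    (hK : 0 < K) :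
    (Summable fun k : ℕ => 1 / (k : ℝ) ^ 2 * |secondDiff (dualColumn Y k) X D -
      dualDensity k * secondDiff (fun x => phaseIntegral Y (Real.pi * k * x)) X D|) ∧
    ∑' k : ℕ, 1 / (k : ℝ) ^ 2 * |secondDiff (dualColumn Y k) X D -
      dualDensity k * secondDiff (fun x => phaseIntegral Y (Real.pi * k * x)) X D| ≤
      1080 * (K ^ 2 * √Y * (X + Y)) + 24 * (Y ^ 2 * √Y / K) := by
  have hX : 0 < X := hD.trans_le hDX
  have hY0 : 0 < Y := by linarith
  have hπ := Real.pi_pos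
  have hπ4 : Real.pi ≤ 3.15 := Real.pi_lt_d2.le
  set K0 := ⌊K⌋₊ with hK0
  have hK0K : (K0 : ℝ) ≤ K := Nat.floor_le hK.le
  have hK0K' : K < K0 + 1 := Nat.lt_floor_add_one K
  have hsd : ∀ k : ℕ, secondDiff (dualColumn Y k) X D -
      dualDensity k * secondDiff (fun x => phaseIntegral Y (Real.pi * k * x)) X D =
      secondDiff (fun x => dualColumn Y k x - dualDensity k * phaseIntegral Y (Real.pi * k * x)) X D := by
    intro k
    rw [secondDiff_sub, secondDiff_const_mul]
  have hs := Real.sqrt_nonneg Y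
  have hhead : ∑ k ∈ Finset.range (K0 + 1), 1 / (k : ℝ) ^ 2 * |secondDiff (dualColumn Y k) X D -
      dualDensity k * secondDiff (fun x => phaseIntegral Y (Real.pi * k * x)) X D| ≤
      1080 * (K ^ 2 * √Y * (X + Y)) := by
    rw [Finset.sum_range_succ']
    simp only [Nat.cast_zero, ne_eq, OfNat.ofNat_ne_zero, not_false_eq_true, zero_pow, div_zero, zero_mul,
      add_zero]
    have hterm : ∀ k ∈ Finset.range K0, 1 / ((k + 1 : ℕ) : ℝ) ^ 2 * |secondDiff (dualColumn Y (k + 1)) X D -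
        dualDensity (k + 1) * secondDiff (fun x => phaseIntegral Y (Real.pi * ((k + 1 : ℕ) : ℝ) * x)) X D| ≤
        1080 * (K * √Y * (X + Y)) := by
      intro k hk
      have hkK : ((k + 1 : ℕ) : ℝ) ≤ K := by
        have : k + 1 ≤ K0 := Finset.mem_range.mp hk
        exact (by exact_mod_cast this : ((k + 1 : ℕ) : ℝ) ≤ K0).trans hK0K
      have hk1 : (1 : ℝ) ≤ ((k + 1 : ℕ) : ℝ) := by exact_mod_cast Nat.succ_pos k
      rw [hsd]
      generalize hq : k + 1 = q at *
      have hq0 : q ≠ 0 := by omega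
      have hb : ∀ x, 0 ≤ x → x ≤ 2 * X →
          |dualColumn Y q x - dualDensity q * phaseIntegral Y (Real.pi * q * x)| ≤
          18 * (q : ℝ) ^ 2 * (4 * (Y * √Y) + 2 * (Real.pi * q * (2 * X)) * √Y) := by
        intro x h0 h1
        refine (abs_dualColumn_sub_le hq0 hY h0).trans ?_
        gcongr
      have h4 := abs_secondDiff_le (X := X) (D := D)
        (φ := fun x => dualColumn Y q x - dualDensity q * phaseIntegral Y (Real.pi * q * x))
        (hb 0 le_rfl (by linarith)) (hb X hX.le (by linarith)) (hb D hD.le (by linarith))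
        (hb (X + D) (by linarith) (by linarith))
      calc _ ≤ 1 / (q : ℝ) ^ 2 *
            (4 * (18 * (q : ℝ) ^ 2 * (4 * (Y * √Y) + 2 * (Real.pi * q * (2 * X)) * √Y))) := by gcongr
        _ = 72 * √Y * (4 * (1 * Y) + 4 * (Real.pi * (q * X))) := by field_simp; ring
        _ ≤ 72 * √Y * (4 * (K * Y) + 4 * (3.15 * (K * X))) := by
          have : 1 ≤ K := hk1.trans hkK
          gcongr
        _ ≤ _ := by
          nlinarith [mul_nonneg (mul_nonneg hK.le hX.le) hs, mul_nonneg (mul_nonneg hK.le hY0.le) hs]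
    refine (Finset.sum_le_card_nsmul _ _ _ hterm).trans ?_
    rw [Finset.card_range, nsmul_eq_mul]
    calc _ ≤ K * (1080 * (K * √Y * (X + Y))) := by gcongr
      _ = _ := by ring
  have htail : ∀ n, ∑ k ∈ Finset.Ioc K0 n, 1 / (k : ℝ) ^ 2 * |secondDiff (dualColumn Y k) X D -
      dualDensity k * secondDiff (fun x => phaseIntegral Y (Real.pi * k * x)) X D| ≤
      24 * (Y ^ 2 * √Y / K) := by
    intro n
    have hterm : ∀ k ∈ Finset.Ioc K0 n, 1 / (k : ℝ) ^ 2 * |secondDiff (dualColumn Y k) X D -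
        dualDensity k * secondDiff (fun x => phaseIntegral Y (Real.pi * k * x)) X D| ≤
        6 * (Y ^ 2 * √Y) * (1 / (k : ℝ) ^ 2 * sumInvOddSquareDivisors k) := by
      intro k hk
      have hk0 : k ≠ 0 := by have := (Finset.mem_Ioc.mp hk).1; omega
      rw [hsd]
      have h1 := one_le_sumInvOddSquareDivisors hk0
      have hb : ∀ x, |dualColumn Y k x - dualDensity k * phaseIntegral Y (Real.pi * k * x)| ≤
          3 / 2 * (Y ^ 2 * √Y * sumInvOddSquareDivisors k) := by
        intro x
        refine (abs_sub _ _).trans ?_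
        have h2 := abs_dualColumn_le hk0 hY0.le x
        have h3 : |dualDensity k * phaseIntegral Y (Real.pi * k * x)| ≤ 1 / 4 * (2 * (Y ^ 2 * √Y)) := by
          rw [abs_mul, abs_of_nonneg (dualDensity_nonneg k)]
          exact mul_le_mul (dualDensity_le k) (abs_phaseIntegral_le hY0.le _) (abs_nonneg _) (by norm_num)
        have h5 : Y ^ 2 * √Y ≤ Y ^ 2 * √Y * sumInvOddSquareDivisors k :=
          le_mul_of_one_le_right (by positivity) h1
        linarith
      have h4 := abs_secondDiff_le (X := X) (D := D)
        (φ := fun x => dualColumn Y k x - dualDensity k * phaseIntegral Y (Real.pi * k * x))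
        (hb 0) (hb X) (hb D) (hb (X + D))
      calc _ ≤ 1 / (k : ℝ) ^ 2 * (4 * (3 / 2 * (Y ^ 2 * √Y * sumInvOddSquareDivisors k))) := by gcongr
        _ = _ := by ring
    refine (Finset.sum_le_sum hterm).trans ?_
    rw [← Finset.mul_sum]
    calc _ ≤ 6 * (Y ^ 2 * √Y) * (4 / ((K0 : ℝ) + 1)) := by
          gcongr
          exact sum_inv_sq_mul_sumInvOddSquareDivisors_le K0 n
      _ ≤ 6 * (Y ^ 2 * √Y) * (4 / K) := by gcongr
      _ = _ := by ring
  exact summable_and_tsum_le_of_split (fun k => by positivity) hhead htail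

theorem secondDiff_mainTermAntideriv {Y : ℝ} (hY : 0 ≤ Y) (X D : ℝ) :
    secondDiff (mainTermAntideriv Y) X D = X * D * √Y / 4 - 1 / Real.pi ^ 2 *
      ∑' k : ℕ, 1 / (k : ℝ) ^ 2 * ((-1) ^ k * (dualDensity k *
        secondDiff (fun x => phaseIntegral Y (Real.pi * k * x)) X D)) := by
  rw [tsum_dualDensity (fun k => secondDiff (fun x => phaseIntegral Y (Real.pi * k * x)) X D)]
  have h := (hasSum_secondDiff (summable_phaseIntegral hY) X D).tsum_eq
  have e : ∀ j : ℕ, secondDiff (fun x => 1 / (j : ℝ) ^ 4 * phaseIntegral Y (2 * Real.pi * j ^ 2 * x)) X D =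
      1 / (j : ℝ) ^ 4 * secondDiff (fun x => phaseIntegral Y (Real.pi * ((2 * j ^ 2 : ℕ) : ℝ) * x)) X D := by
    intro j
    rw [secondDiff_const_mul]
    congr 3
    ext x
    push_cast
    ring_nf
  rw [tsum_congr e] at h
  rw [h]
  unfold mainTermAntideriv secondDiff
  ring

/-- The smoothed completed sum is a difference of two values of the main term. -/
theorem exists_abs_sum_trapezoid_sub_le {X Y D K : ℝ} (hY : 1 ≤ Y) (hD : 0 < D) (hDX : D ≤ X) (hK : 0 < K)
    {B : ℕ} (hB : X + D ≤ B) :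
    ∃ ξ ∈ Set.Ioo X (X + D), ∃ η ∈ Set.Ioo 0 D,
      |∑ N ∈ (Finset.Icc 0 ⌊Y⌋₊).filter (fun N => Odd N),
          ∑ M ∈ (Finset.range ((B + 1) * 2)).filter (fun M => Odd M), trapezoid X D M * completedJacobi M N -
        (mainTerm Y ξ - mainTerm Y η)| ≤
      X + 120 * ((K ^ 2 * √Y * (X + Y) + Y ^ 2 * √Y / K) / D) := by
  have hX : 0 < X := hD.trans_le hDX
  have hY0 : 0 < Y := by linarith
  have hπ := Real.pi_pos
  obtain ⟨ξ, hξ, η, hη, hM⟩ := exists_secondDiff_mainTermAntideriv (X := X) hY0.le hD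
  refine ⟨ξ, hξ, η, hη, ?_⟩
  obtain ⟨hsum, hle⟩ := summable_and_abs_tsum_dualColumn_sub_le hY hD hDX hK
  have hV := hasSum_sum_secondDiff_completedFourier Y X D
  have hdiff : Summable fun k : ℕ => 1 / (k : ℝ) ^ 2 * ((-1) ^ k * (secondDiff (dualColumn Y k) X D -
      dualDensity k * secondDiff (fun x => phaseIntegral Y (Real.pi * k * x)) X D)) := by
    refine Summable.of_norm_bounded hsum fun k => ?_
    rw [norm_mul, norm_mul, norm_pow, norm_neg, norm_one, one_pow, one_mul,
      Real.norm_of_nonneg (by positivity), Real.norm_eq_abs]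
  have hle2 : |∑' k : ℕ, 1 / (k : ℝ) ^ 2 * ((-1) ^ k * (secondDiff (dualColumn Y k) X D -
      dualDensity k * secondDiff (fun x => phaseIntegral Y (Real.pi * k * x)) X D))| ≤
      1080 * (K ^ 2 * √Y * (X + Y)) + 24 * (Y ^ 2 * √Y / K) := by
    rw [← Real.norm_eq_abs]
    refine (tsum_of_norm_bounded hsum.hasSum fun k => ?_).trans hle
    rw [norm_mul, norm_mul, norm_pow, norm_neg, norm_one, one_pow, one_mul,
      Real.norm_of_nonneg (by positivity), Real.norm_eq_abs]
  set A := ∑' k : ℕ, 1 / (k : ℝ) ^ 2 * ((-1) ^ k * (secondDiff (dualColumn Y k) X D -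
      dualDensity k * secondDiff (fun x => phaseIntegral Y (Real.pi * k * x)) X D)) with hA
  set P := ∑' k : ℕ, 1 / (k : ℝ) ^ 2 * ((-1) ^ k * (dualDensity k *
        secondDiff (fun x => phaseIntegral Y (Real.pi * k * x)) X D)) with hP
  set V := ∑ N ∈ (Finset.Icc 0 ⌊Y⌋₊).filter (fun N => Odd N),
        N * √N * (J(2 | N) * secondDiff (completedFourier N) X D) with hVdef
  have hVAP : P = V - A := by
    rw [hP, ← hV.tsum_eq, hA, ← hV.summable.tsum_sub hdiff]
    refine tsum_congr fun k => ?_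
    ring
  have hT : ∑ N ∈ (Finset.Icc 0 ⌊Y⌋₊).filter (fun N => Odd N),
      ∑ M ∈ (Finset.range ((B + 1) * 2)).filter (fun M => Odd M), trapezoid X D M * completedJacobi M N =
      X / 2 * (∑ N ∈ (Finset.Icc 0 ⌊Y⌋₊).filter (fun N => Odd N), (if IsSquare N then (1 : ℝ) else 0)) -
        1 / (Real.pi ^ 2 * D) * V := by
    rw [hVdef, Finset.mul_sum, Finset.mul_sum, ← Finset.sum_sub_distrib]
    refine Finset.sum_congr rfl fun N hN => ?_
    rw [sum_trapezoid_mul_completedJacobi hX.le hD (Finset.mem_filter.mp hN).2 hB]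
    split_ifs <;> ring
  have hQ := abs_sum_isSquare_sub_le hY0.le
  set Q := ∑ N ∈ (Finset.Icc 0 ⌊Y⌋₊).filter (fun N => Odd N), (if IsSquare N then (1 : ℝ) else 0)
  rw [hT, ← hM, secondDiff_mainTermAntideriv hY0.le, ← hP, hVAP]
  have e : X / 2 * Q - 1 / (Real.pi ^ 2 * D) * V -
      (X * D * √Y / 4 - 1 / Real.pi ^ 2 * (V - A)) / D = X / 2 * (Q - √Y / 2) + -(1 / (Real.pi ^ 2 * D) * A) := by
    field_simp; ring
  rw [e]
  refine (abs_add_le _ _).trans ?_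
  rw [abs_neg, abs_mul, abs_mul, abs_of_pos (by positivity : 0 < X / 2),
    abs_of_pos (by positivity : 0 < 1 / (Real.pi ^ 2 * D))]
  have h9 : 9 ≤ Real.pi ^ 2 := by nlinarith [Real.pi_gt_three]
  refine add_le_add (by nlinarith) ?_
  have hR : 0 ≤ K ^ 2 * √Y * (X + Y) := by positivity
  have hR' : 0 ≤ Y ^ 2 * √Y / K := by positivity
  calc _ ≤ 1 / (9 * D) * (1080 * (K ^ 2 * √Y * (X + Y) + Y ^ 2 * √Y / K)) := by
        gcongr
        linarith
    _ = _ := by field_simp; norm_num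

/-- `∑_{k ≥ 1} exp(-π k² z) / k²` -/
noncomputable def thetaPrimitive (z : ℂ) : ℂ :=
  ∑' n : ℕ, 1 / ((n : ℂ) + 1) ^ 2 * Complex.exp (-Real.pi * ((n : ℂ) + 1) ^ 2 * z)

theorem norm_exp_neg_pi_sq_mul (n : ℕ) (z : ℂ) :
    ‖Complex.exp (-Real.pi * ((n : ℂ) + 1) ^ 2 * z)‖ = Real.exp (-Real.pi * ((n : ℝ) + 1) ^ 2 * z.re) := by
  rw [Complex.norm_exp]
  congr 1
  have : (-Real.pi * ((n : ℂ) + 1) ^ 2 : ℂ) = ((-Real.pi * ((n : ℝ) + 1) ^ 2 : ℝ) : ℂ) := by push_cast; ring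
  rw [this, Complex.re_ofReal_mul]

theorem summable_one_div_succ_sq : Summable fun n : ℕ => 1 / ((n : ℝ) + 1) ^ 2 := by
  have := (summable_nat_add_iff 1).mpr (Real.summable_one_div_nat_pow.mpr one_lt_two)
  simpa using this

theorem norm_thetaPrimitive_term_le (n : ℕ) {z : ℂ} (hz : 0 ≤ z.re) :
    ‖1 / ((n : ℂ) + 1) ^ 2 * Complex.exp (-Real.pi * ((n : ℂ) + 1) ^ 2 * z)‖ ≤ 1 / ((n : ℝ) + 1) ^ 2 := by
  rw [norm_mul, norm_exp_neg_pi_sq_mul]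
  have h1 : ‖1 / ((n : ℂ) + 1) ^ 2‖ = 1 / ((n : ℝ) + 1) ^ 2 := by
    have : (1 / ((n : ℂ) + 1) ^ 2 : ℂ) = ((1 / ((n : ℝ) + 1) ^ 2 : ℝ) : ℂ) := by push_cast; ring
    rw [this, Complex.norm_real, Real.norm_of_nonneg (by positivity)]
  rw [h1]
  refine mul_le_of_le_one_right (by positivity) (Real.exp_le_one_iff.mpr ?_)
  have : 0 ≤ Real.pi * ((n : ℝ) + 1) ^ 2 * z.re := by positivity
  linarith

theorem continuousOn_thetaPrimitive : ContinuousOn thetaPrimitive {z | 0 ≤ z.re} :=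
  continuousOn_tsum (fun n => by fun_prop) summable_one_div_succ_sq
    fun n z hz => norm_thetaPrimitive_term_le n hz

theorem summable_thetaPrimitive {z : ℂ} (hz : 0 ≤ z.re) : Summable fun n : ℕ =>
    1 / ((n : ℂ) + 1) ^ 2 * Complex.exp (-Real.pi * ((n : ℂ) + 1) ^ 2 * z) :=
  Summable.of_norm_bounded summable_one_div_succ_sq fun n => norm_thetaPrimitive_term_le n hz

theorem exists_norm_thetaPrimitive_le : ∃ C, ∀ z : ℂ, 0 ≤ z.re → ‖thetaPrimitive z‖ ≤ C :=
  ⟨_, fun _ hz => tsum_of_norm_bounded summable_one_div_succ_sq.hasSum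
    fun n => norm_thetaPrimitive_term_le n hz⟩

theorem hasDerivAt_thetaPrimitive {z : ℂ} (hz : 0 < z.re) :
    HasDerivAt thetaPrimitive (-(Real.pi / 2) * (jacobiTheta (Complex.I * z) - 1)) z := by
  set c := z.re / 2 with hc
  have hc0 : 0 < c := by positivity
  have hs : ∀ w : ℂ, 0 < w.re → HasSum (fun n : ℕ => Complex.exp (-Real.pi * ((n : ℂ) + 1) ^ 2 * w))
      ((jacobiTheta (Complex.I * w) - 1) / 2) := by
    intro w hw
    have := hasSum_nat_jacobiTheta (τ := Complex.I * w) (by simpa using hw)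
    convert! this using 1
    ext n
    congr 1
    linear_combination (-(Real.pi * ((n : ℂ) + 1) ^ 2 * w)) * Complex.I_sq
  have hu : Summable fun n : ℕ => Real.pi * Real.exp (-Real.pi * ((n : ℝ) + 1) ^ 2 * c) := by
    have := (hs (c : ℂ) (by simpa using hc0)).summable.norm
    simp only [norm_exp_neg_pi_sq_mul, Complex.ofReal_re] at this
    exact this.mul_left _
  have hopen : IsOpen {w : ℂ | c < w.re} := isOpen_lt continuous_const Complex.continuous_re
  have hconv : Convex ℝ {w : ℂ | c < w.re} := convex_halfSpace_re_gt c
  have hzc : z ∈ {w : ℂ | c < w.re} := by simp only [Set.mem_ofPred_eq, hc]; linarith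
  have h := hasDerivAt_tsum_of_isPreconnected (y₀ := z) (y := z)
    (g := fun (n : ℕ) (z : ℂ) => 1 / ((n : ℂ) + 1) ^ 2 * Complex.exp (-Real.pi * ((n : ℂ) + 1) ^ 2 * z))
    (g' := fun (n : ℕ) (z : ℂ) => -Real.pi * Complex.exp (-Real.pi * ((n : ℂ) + 1) ^ 2 * z))
    hu hopen hconv.isPreconnected ?_ ?_ hzc (summable_thetaPrimitive hz.le) hzc
  · refine h.congr_deriv ?_
    rw [tsum_mul_left, (hs z hz).tsum_eq]; ring
  · intro n w _
    have hn : (n : ℂ) + 1 ≠ 0 := by exact_mod_cast Nat.succ_ne_zero n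
    have d1 : HasDerivAt (fun w : ℂ => -Real.pi * ((n : ℂ) + 1) ^ 2 * w) (-Real.pi * ((n : ℂ) + 1) ^ 2) w := by
      exact ((hasDerivAt_id w).const_mul _).congr_deriv (mul_one _)
    refine (d1.cexp.const_mul _).congr_deriv ?_
    field_simp
  · intro n w hw
    rw [norm_mul, norm_exp_neg_pi_sq_mul, norm_neg, Complex.norm_real, Real.norm_of_nonneg Real.pi_pos.le]
    gcongr ?_ * Real.exp ?_
    have hw' : c ≤ w.re := le_of_lt hw
    have h2 : 0 ≤ Real.pi * ((n : ℝ) + 1) ^ 2 := by positivity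
    nlinarith

theorem jacobiTheta_I_mul {z : ℂ} (hz : 0 < z.re) :
    jacobiTheta (Complex.I * z) = 1 / z ^ (1 / 2 : ℂ) * jacobiTheta (Complex.I * z⁻¹) := by
  have h := Complex.tsum_exp_neg_mul_int_sq hz
  have e1 : jacobiTheta (Complex.I * z) = ∑' n : ℤ, Complex.exp (-Real.pi * z * (n : ℂ) ^ 2) := by
    refine tsum_congr fun n => congrArg _ ?_
    linear_combination (Real.pi * (n : ℂ) ^ 2 * z) * Complex.I_sq
  have e2 : jacobiTheta (Complex.I * z⁻¹) = ∑' n : ℤ, Complex.exp (-Real.pi / z * (n : ℂ) ^ 2) := by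
    refine tsum_congr fun n => congrArg _ ?_
    rw [div_eq_mul_inv]
    linear_combination (Real.pi * (n : ℂ) ^ 2 * z⁻¹) * Complex.I_sq
  rw [e1, e2, h]

/-- The potential whose derivative expresses the functional equation of the theta function. -/
noncomputable def thetaPotential (z : ℂ) : ℂ :=
  thetaPrimitive z + Real.pi * z ^ (1 / 2 : ℂ) - Real.pi / 2 * z + z * z ^ (1 / 2 : ℂ) * thetaPrimitive z⁻¹

theorem inv_re_pos {z : ℂ} (hz : 0 < z.re) : 0 < (z⁻¹).re := by
  rw [Complex.inv_re]
  have : z ≠ 0 := by rintro rfl; simp at hz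
  exact div_pos hz (Complex.normSq_pos.mpr this)

theorem inv_re_nonneg {z : ℂ} (hz : 0 ≤ z.re) : 0 ≤ (z⁻¹).re := by
  rw [Complex.inv_re]
  exact div_nonneg hz (Complex.normSq_nonneg z)

theorem cpow_half_mul_self {z : ℂ} (hz : z ≠ 0) : z ^ (1 / 2 : ℂ) * z ^ (1 / 2 : ℂ) = z := by
  rw [← Complex.cpow_add _ _ hz]; norm_num

theorem hasDerivAt_thetaPotential {z : ℂ} (hz : 0 < z.re) :
    HasDerivAt thetaPotential (3 / 2 * z ^ (1 / 2 : ℂ) * thetaPrimitive z⁻¹) z := by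
  have hz0 : z ≠ 0 := by rintro rfl; simp at hz
  have hslit : z ∈ Complex.slitPlane := Or.inl hz
  have hww := cpow_half_mul_self hz0
  have hw0 : z ^ (1 / 2 : ℂ) ≠ 0 := fun h => hz0 (by rw [← hww, h, zero_mul])
  have dw : HasDerivAt (fun z : ℂ => z ^ (1 / 2 : ℂ)) (1 / (2 * z ^ (1 / 2 : ℂ))) z := by
    refine ((hasDerivAt_id z).cpow_const (c := 1 / 2) hslit).congr_deriv ?_
    rw [id, Complex.cpow_sub _ _ hz0, Complex.cpow_one]
    field_simp
    rw [sq, hww]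
  have d1 := hasDerivAt_thetaPrimitive hz
  have d2 := (hasDerivAt_thetaPrimitive (inv_re_pos hz)).comp z (hasDerivAt_inv hz0)
  have d := ((d1.add (dw.const_mul (Real.pi : ℂ))).sub ((hasDerivAt_id z).const_mul (Real.pi / 2 : ℂ))).add
    (((hasDerivAt_id z).mul dw).mul d2)
  refine d.congr_deriv ?_
  rw [jacobiTheta_I_mul hz]
  simp only [id, Function.comp, Pi.mul_apply]
  generalize z ^ (1 / 2 : ℂ) = w at *
  subst hww
  field_simp
  ring

/-- The vertical path on which the functional equation is integrated. -/
noncomputable def verticalPath (ε y : ℝ) : ℂ := (ε : ℂ) - Complex.I / 2 * y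

theorem verticalPath_re (ε y : ℝ) : (verticalPath ε y).re = ε := by
  simp [verticalPath]

theorem verticalPath_im (ε y : ℝ) : (verticalPath ε y).im = -y / 2 := by
  simp [verticalPath]; ring

theorem verticalPath_ne_zero {y : ℝ} (hy : 0 < y) : verticalPath 0 y ≠ 0 := fun h => by
  have := congrArg Complex.im h
  rw [verticalPath_im, Complex.zero_im] at this
  linarith

theorem tendsto_verticalPath (y : ℝ) : Filter.Tendsto (fun ε => verticalPath ε y)
    (nhdsWithin 0 (Set.Ioi 0)) (nhdsWithin (verticalPath 0 y) {z | 0 ≤ z.re}) := by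
  refine tendsto_nhdsWithin_iff.mpr ⟨?_, ?_⟩
  · have : Continuous fun ε => verticalPath ε y := by unfold verticalPath; fun_prop
    exact (this.tendsto 0).mono_left nhdsWithin_le_nhds
  · filter_upwards [self_mem_nhdsWithin] with ε hε
    have : (0 : ℝ) < ε := hε
    simp only [verticalPath_re]; exact this.le

theorem tendsto_thetaPrimitive_verticalPath (y : ℝ) : Filter.Tendsto (fun ε => thetaPrimitive (verticalPath ε y))
    (nhdsWithin 0 (Set.Ioi 0)) (nhds (thetaPrimitive (verticalPath 0 y))) :=
  (continuousOn_thetaPrimitive _ (by simp [verticalPath_re])).tendsto.comp (tendsto_verticalPath y)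

theorem tendsto_thetaPrimitive_inv_verticalPath {y : ℝ} (hy : 0 < y) :
    Filter.Tendsto (fun ε => thetaPrimitive (verticalPath ε y)⁻¹)
    (nhdsWithin 0 (Set.Ioi 0)) (nhds (thetaPrimitive (verticalPath 0 y)⁻¹)) := by
  refine (continuousOn_thetaPrimitive _ (inv_re_nonneg (by simp [verticalPath_re]))).tendsto.comp
    (tendsto_nhdsWithin_iff.mpr ⟨?_, ?_⟩)
  · exact ((tendsto_verticalPath y).mono_right nhdsWithin_le_nhds).inv₀ (verticalPath_ne_zero hy)
  · filter_upwards [self_mem_nhdsWithin] with ε hε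
    have : (0 : ℝ) < ε := hε
    exact inv_re_nonneg (by rw [verticalPath_re]; exact this.le)

theorem tendsto_cpow_half_verticalPath (y : ℝ) : Filter.Tendsto (fun ε => verticalPath ε y ^ (1 / 2 : ℂ))
    (nhdsWithin 0 (Set.Ioi 0)) (nhds (verticalPath 0 y ^ (1 / 2 : ℂ))) :=
  (Complex.continuousAt_cpow_const_of_re_pos (Or.inl (by simp [verticalPath_re])) (by norm_num)).tendsto.comp
    ((tendsto_verticalPath y).mono_right nhdsWithin_le_nhds)

theorem tendsto_thetaPotential_verticalPath {y : ℝ} (hy : 0 < y) :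
    Filter.Tendsto (fun ε => thetaPotential (verticalPath ε y))
    (nhdsWithin 0 (Set.Ioi 0)) (nhds (thetaPotential (verticalPath 0 y))) := by
  have hz := (tendsto_verticalPath y).mono_right nhdsWithin_le_nhds
  have hw := tendsto_cpow_half_verticalPath y
  exact (((tendsto_thetaPrimitive_verticalPath y).add (hw.const_mul _)).sub (hz.const_mul _)).add
    ((hz.mul hw).mul (tendsto_thetaPrimitive_inv_verticalPath hy))

theorem tendsto_thetaPotential_verticalPath_zero :
    Filter.Tendsto (fun ε => thetaPotential (verticalPath ε 0))
    (nhdsWithin 0 (Set.Ioi 0)) (nhds (thetaPrimitive 0)) := by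
  have h0 : verticalPath 0 0 = 0 := by simp [verticalPath]
  have hz := (tendsto_verticalPath 0).mono_right nhdsWithin_le_nhds
  have hw := tendsto_cpow_half_verticalPath 0
  have hp := tendsto_thetaPrimitive_verticalPath 0
  rw [h0] at hz hw hp
  rw [Complex.zero_cpow (by norm_num)] at hw
  obtain ⟨C, hC⟩ := exists_norm_thetaPrimitive_le
  have hlast : Filter.Tendsto (fun ε => verticalPath ε 0 * verticalPath ε 0 ^ (1 / 2 : ℂ) *
      thetaPrimitive (verticalPath ε 0)⁻¹) (nhdsWithin 0 (Set.Ioi 0)) (nhds 0) := by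
    have h1 := (hz.mul hw)
    rw [mul_zero] at h1
    refine Filter.Tendsto.zero_mul_isBoundedUnder_le h1 ?_
    refine Filter.isBoundedUnder_of_eventually_le (a := C) ?_
    filter_upwards [self_mem_nhdsWithin] with ε hε
    have : (0 : ℝ) < ε := hε
    exact hC _ (inv_re_nonneg (by rw [verticalPath_re]; exact this.le))
  have := (((hp.add (hw.const_mul (Real.pi : ℂ))).sub (hz.const_mul (Real.pi / 2 : ℂ))).add hlast)
  simpa [thetaPotential] using this

open MeasureTheory in
theorem thetaPotential_sub_eq_integral {α : ℝ} (hα : 0 < α) :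
    thetaPotential (verticalPath 0 α) - thetaPrimitive 0 = ∫ y in (0 : ℝ)..α, -(Complex.I / 2) *
      (3 / 2 * verticalPath 0 y ^ (1 / 2 : ℂ) * thetaPrimitive (verticalPath 0 y)⁻¹) := by
  have hcontV : ∀ ε, Continuous (verticalPath ε) := fun ε => by unfold verticalPath; fun_prop
  have hcont : ∀ ε : ℝ, 0 < ε → Continuous fun y => -(Complex.I / 2) *
      (3 / 2 * verticalPath ε y ^ (1 / 2 : ℂ) * thetaPrimitive (verticalPath ε y)⁻¹) := by
    intro ε hε
    refine continuous_iff_continuousAt.mpr fun y => ?_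
    have hre : 0 < (verticalPath ε y).re := by rw [verticalPath_re]; exact hε
    have hne : verticalPath ε y ≠ 0 := by intro h; rw [h] at hre; simp at hre
    have c1 : ContinuousAt (fun y => verticalPath ε y ^ (1 / 2 : ℂ)) y :=
      ContinuousAt.comp (g := fun z : ℂ => z ^ (1 / 2 : ℂ)) (f := verticalPath ε)
        (Complex.continuousAt_cpow_const_of_re_pos (Or.inl hre.le) (by norm_num)) (hcontV ε).continuousAt
    have c2 : ContinuousAt (fun y => thetaPrimitive (verticalPath ε y)⁻¹) y :=
      ContinuousAt.comp (g := thetaPrimitive) (f := fun y => (verticalPath ε y)⁻¹)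
        (hasDerivAt_thetaPrimitive (inv_re_pos hre)).continuousAt ((hcontV ε).continuousAt.inv₀ hne)
    exact continuousAt_const.mul ((continuousAt_const.mul c1).mul c2)
  have hFTC : ∀ ε : ℝ, 0 < ε → ∫ y in (0 : ℝ)..α, -(Complex.I / 2) *
      (3 / 2 * verticalPath ε y ^ (1 / 2 : ℂ) * thetaPrimitive (verticalPath ε y)⁻¹) =
      thetaPotential (verticalPath ε α) - thetaPotential (verticalPath ε 0) := by
    intro ε hε
    refine intervalIntegral.integral_eq_sub_of_hasDerivAt (f := fun y => thetaPotential (verticalPath ε y))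
      (fun y _ => ?_) ((hcont ε hε).intervalIntegrable _ _)
    have hre : 0 < (verticalPath ε y).re := by rw [verticalPath_re]; exact hε
    have d1 : HasDerivAt (verticalPath ε) (-(Complex.I / 2)) y := by
      have := ((hasDerivAt_id y).ofReal_comp.const_mul (Complex.I / 2)).const_sub (ε : ℂ)
      exact this.congr_deriv (by simp)
    exact (hasDerivAt_thetaPotential hre).scomp y d1
  obtain ⟨C, hC⟩ := exists_norm_thetaPrimitive_le
  have hC0 : 0 ≤ C := (norm_nonneg _).trans (hC 0 (by simp))
  have hlim : Filter.Tendsto (fun ε => ∫ y in (0 : ℝ)..α, -(Complex.I / 2) *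
      (3 / 2 * verticalPath ε y ^ (1 / 2 : ℂ) * thetaPrimitive (verticalPath ε y)⁻¹))
      (nhdsWithin 0 (Set.Ioi 0)) (nhds (∫ y in (0 : ℝ)..α, -(Complex.I / 2) *
      (3 / 2 * verticalPath 0 y ^ (1 / 2 : ℂ) * thetaPrimitive (verticalPath 0 y)⁻¹))) := by
    refine intervalIntegral.tendsto_integral_filter_of_dominated_convergence
      (fun _ => (1 + α) ^ (1 / 2 : ℝ) * C) ?_ ?_ intervalIntegrable_const ?_
    · filter_upwards [self_mem_nhdsWithin] with ε hε
      exact (hcont ε hε).aestronglyMeasurable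
    · filter_upwards [Ioo_mem_nhdsGT (zero_lt_one)] with ε hε
      refine ae_of_all _ fun y hy => ?_
      rw [Set.uIoc_of_le hα.le] at hy
      have h1 : ‖verticalPath ε y ^ (1 / 2 : ℂ)‖ ≤ (1 + α) ^ (1 / 2 : ℝ) := by
        have e : (1 / 2 : ℂ) = ((1 / 2 : ℝ) : ℂ) := by push_cast; ring
        rw [e, Complex.norm_cpow_real]
        refine Real.rpow_le_rpow (norm_nonneg _) ?_ (by norm_num)
        refine (Complex.norm_le_abs_re_add_abs_im _).trans ?_
        rw [verticalPath_re, verticalPath_im, abs_of_pos hε.1, abs_of_nonpos (by linarith [hy.1])]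
        linarith [hε.2, hy.1, hy.2]
      have h2 := hC (verticalPath ε y)⁻¹ (inv_re_nonneg (by rw [verticalPath_re]; exact hε.1.le))
      rw [norm_mul, norm_mul, norm_mul]
      have h3 : ‖-(Complex.I / 2)‖ = 1 / 2 := by simp
      have h4 : ‖(3 / 2 : ℂ)‖ = 3 / 2 := by norm_num
      rw [h3, h4]
      calc _ ≤ 1 / 2 * (3 / 2 * (1 + α) ^ (1 / 2 : ℝ) * C) := by gcongr
        _ ≤ _ := by
          have : 0 ≤ (1 + α) ^ (1 / 2 : ℝ) * C := by positivity
          nlinarith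
    · refine ae_of_all _ fun y hy => ?_
      rw [Set.uIoc_of_le hα.le] at hy
      exact (((tendsto_cpow_half_verticalPath y).const_mul _).mul
        (tendsto_thetaPrimitive_inv_verticalPath hy.1)).const_mul _
  have hlim2 := (tendsto_thetaPotential_verticalPath hα).sub tendsto_thetaPotential_verticalPath_zero
  refine tendsto_nhds_unique hlim2 (hlim.congr' ?_)
  filter_upwards [self_mem_nhdsWithin] with ε hε
  exact hFTC ε hε

theorem cpow_half_verticalPath {y : ℝ} (hy : 0 < y) :
    verticalPath 0 y ^ (1 / 2 : ℂ) = (√y / 2 : ℝ) * (1 - Complex.I) := by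
  have hs : ((√y : ℝ) : ℂ) * ((√y : ℝ) : ℂ) = y := by
    rw [← Complex.ofReal_mul, Real.mul_self_sqrt hy.le]
  have h1 : verticalPath 0 y = ((√y / 2 : ℝ) * (1 - Complex.I)) ^ (2 : ℕ) := by
    rw [verticalPath]; push_cast
    linear_combination (Complex.I / 2) * hs + (-(√y : ℂ) ^ 2 / 4) * Complex.I_sq
  rw [h1, one_div]
  refine Complex.sq_cpow_two_inv ?_
  have : 0 < √y := Real.sqrt_pos.mpr hy
  rw [Complex.re_ofReal_mul]
  simp [this]

/-- `∑_{k ≥ 1} h(k² t) / k²` -/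
noncomputable def sqSeries (h : ℝ → ℝ) (t : ℝ) : ℝ :=
  ∑' n : ℕ, 1 / ((n : ℝ) + 1) ^ 2 * h (((n : ℝ) + 1) ^ 2 * t)

theorem norm_sqSeries_term_le {h : ℝ → ℝ} {C : ℝ} (hC : ∀ x, |h x| ≤ C) (t : ℝ) (n : ℕ) :
    ‖1 / ((n : ℝ) + 1) ^ 2 * h (((n : ℝ) + 1) ^ 2 * t)‖ ≤ 1 / ((n : ℝ) + 1) ^ 2 * C := by
  rw [norm_mul, Real.norm_of_nonneg (by positivity)]
  gcongr
  exact hC _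

theorem summable_sqSeries {h : ℝ → ℝ} {C : ℝ} (hC : ∀ x, |h x| ≤ C) (t : ℝ) :
    Summable fun n : ℕ => 1 / ((n : ℝ) + 1) ^ 2 * h (((n : ℝ) + 1) ^ 2 * t) :=
  Summable.of_norm_bounded (summable_one_div_succ_sq.mul_right C) fun n => norm_sqSeries_term_le hC t n

theorem tsum_one_div_succ_sq_le : ∑' n : ℕ, 1 / ((n : ℝ) + 1) ^ 2 ≤ 2 := by
  refine Real.tsum_le_of_sum_range_le (fun n => by positivity) fun n => ?_
  refine le_trans (le_of_eq ?_) (sum_Icc_inv_sq_le n)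
  have h := Finset.sum_Ico_add' (fun l : ℕ => 1 / (l : ℝ) ^ 2) 0 n 1
  rw [zero_add] at h
  have e : Finset.Icc 1 n = Finset.Ico 1 (n + 1) := by ext; simp
  rw [Finset.range_eq_Ico, e]
  simpa using h

theorem abs_sqSeries_le {h : ℝ → ℝ} {C : ℝ} (hC : ∀ x, |h x| ≤ C) (t : ℝ) : |sqSeries h t| ≤ 2 * C := by
  rw [← Real.norm_eq_abs]
  refine (tsum_of_norm_bounded (summable_one_div_succ_sq.mul_right C).hasSum
    fun n => norm_sqSeries_term_le hC t n).trans ?_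
  rw [tsum_mul_right]
  exact mul_le_mul_of_nonneg_right tsum_one_div_succ_sq_le ((abs_nonneg _).trans (hC 0))

theorem continuous_sqSeries {h : ℝ → ℝ} (hc : Continuous h) {C : ℝ} (hC : ∀ x, |h x| ≤ C) :
    Continuous (sqSeries h) :=
  continuous_tsum (fun n => by fun_prop) (summable_one_div_succ_sq.mul_right C)
    fun n t => norm_sqSeries_term_le hC t n

open MeasureTheory in
theorem intervalIntegrable_sqrt_mul_comp_div {g : ℝ → ℝ} (hg : Measurable g) {C : ℝ} (hC : ∀ x, |g x| ≤ C)
    (ω a b : ℝ) : IntervalIntegrable (fun t => √t * g (ω / t)) volume a b := by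
  refine ((Real.continuous_sqrt.mul continuous_const).intervalIntegrable (μ := volume) a b
    (u := fun t => √t * C)).mono_fun ?_ ?_
  · exact (Real.continuous_sqrt.measurable.mul
      (hg.comp (measurable_const.div measurable_id))).aestronglyMeasurable
  · refine Filter.Eventually.of_forall fun t => ?_
    simp only [norm_mul]
    exact mul_le_mul_of_nonneg_left ((hC _).trans (le_abs_self C)) (norm_nonneg _)

open MeasureTheory in
theorem hasSum_integral_sqSeries {h : ℝ → ℝ} (hc : Continuous h) {C : ℝ} (hC : ∀ x, |h x| ≤ C) (ω b : ℝ) :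
    HasSum (fun n : ℕ => 1 / ((n : ℝ) + 1) ^ 2 * ∫ y in (0 : ℝ)..b, √y * h (((n : ℝ) + 1) ^ 2 * (ω / y)))
      (∫ y in (0 : ℝ)..b, √y * sqSeries h (ω / y)) := by
  have hm : ∀ n : ℕ, Measurable fun x => h (((n : ℝ) + 1) ^ 2 * x) := fun n =>
    (hc.comp (continuous_const.mul continuous_id)).measurable
  have key := intervalIntegral.hasSum_integral_of_dominated_convergence (μ := volume) (a := 0) (b := b)
    (F := fun (n : ℕ) y => √y * (1 / ((n : ℝ) + 1) ^ 2 * h (((n : ℝ) + 1) ^ 2 * (ω / y))))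
    (f := fun y => √y * sqSeries h (ω / y))
    (fun (n : ℕ) y => √y * (1 / ((n : ℝ) + 1) ^ 2 * C)) ?_ ?_ ?_ ?_ ?_
  · convert! key using 1
    ext n
    rw [← intervalIntegral.integral_const_mul]
    congr 1; ext y; ring
  · intro n
    refine Measurable.aestronglyMeasurable ?_
    exact Real.continuous_sqrt.measurable.mul (measurable_const.mul
      ((hm n).comp (measurable_const.div measurable_id)))
  · intro n
    refine ae_of_all _ fun y _ => ?_
    rw [norm_mul, Real.norm_of_nonneg (Real.sqrt_nonneg _)]
    gcongr
    exact norm_sqSeries_term_le hC _ n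
  · exact ae_of_all _ fun y _ => (summable_one_div_succ_sq.mul_right C).mul_left _
  · simp only [tsum_mul_left]
    exact (Real.continuous_sqrt.mul continuous_const).intervalIntegrable _ _
  · exact ae_of_all _ fun y _ => (summable_sqSeries hC _).hasSum.mul_left _

theorem thetaPrimitive_I_mul (u : ℝ) : thetaPrimitive (Complex.I * u) =
    (sqSeries Real.cos (Real.pi * u) : ℝ) - Complex.I * (sqSeries Real.sin (Real.pi * u) : ℝ) := by
  have h1 := (summable_sqSeries Real.abs_cos_le_one (Real.pi * u)).hasSum
  have h2 := (summable_sqSeries Real.abs_sin_le_one (Real.pi * u)).hasSum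
  have h3 := (Complex.hasSum_ofReal.mpr h1).sub ((Complex.hasSum_ofReal.mpr h2).mul_left Complex.I)
  rw [sqSeries, sqSeries, ← h3.tsum_eq]
  refine tsum_congr fun n => ?_
  have e : (-Real.pi * ((n : ℂ) + 1) ^ 2 * (Complex.I * u) : ℂ) =
      ((-(((n : ℝ) + 1) ^ 2 * (Real.pi * u)) : ℝ) : ℂ) * Complex.I := by push_cast; ring
  rw [e, Complex.exp_mul_I, ← Complex.ofReal_cos, ← Complex.ofReal_sin, Real.cos_neg, Real.sin_neg]
  push_cast
  ring

theorem sqSeries_neg_sin (t : ℝ) : sqSeries Real.sin (-t) = -sqSeries Real.sin t := by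
  rw [sqSeries, sqSeries, ← tsum_neg]
  refine tsum_congr fun n => ?_
  rw [mul_neg, Real.sin_neg]; ring

theorem sqSeries_sin_zero : sqSeries Real.sin 0 = 0 := by simp [sqSeries]

theorem verticalPath_zero_eq (y : ℝ) : verticalPath 0 y = Complex.I * ((-(y / 2) : ℝ) : ℂ) := by
  unfold verticalPath; push_cast; ring

theorem inv_verticalPath_zero_eq {y : ℝ} (hy : y ≠ 0) :
    (verticalPath 0 y)⁻¹ = Complex.I * ((2 / y : ℝ) : ℂ) := by
  have hyc : (y : ℂ) ≠ 0 := by exact_mod_cast hy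
  rw [verticalPath_zero_eq, mul_inv, Complex.inv_I]
  push_cast
  field_simp

open MeasureTheory in
/-- The real form of the integrated functional equation on the imaginary axis. -/
theorem sqSeries_sin_eq {α : ℝ} (hα : 0 < α) :
    sqSeries Real.sin (Real.pi * (α / 2)) = Real.pi * √α / 2 - Real.pi * α / 4 -
      α * √α / 4 * (sqSeries Real.sin (2 * Real.pi / α) - sqSeries Real.cos (2 * Real.pi / α)) +
      3 / 8 * ∫ y in (0 : ℝ)..α, √y * (sqSeries Real.sin (2 * Real.pi / y) - sqSeries Real.cos (2 * Real.pi / y)) := by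
  have key := thetaPotential_sub_eq_integral hα
  set c : ℝ → ℝ := fun y => sqSeries Real.cos (2 * Real.pi / y) with hc
  set d : ℝ → ℝ := fun y => sqSeries Real.sin (2 * Real.pi / y) with hd
  have hci : IntervalIntegrable (fun y => √y * c y) volume 0 α :=
    intervalIntegrable_sqrt_mul_comp_div (continuous_sqSeries Real.continuous_cos Real.abs_cos_le_one).measurable
      (abs_sqSeries_le Real.abs_cos_le_one) _ _ _
  have hdi : IntervalIntegrable (fun y => √y * d y) volume 0 α :=
    intervalIntegrable_sqrt_mul_comp_div (continuous_sqSeries Real.continuous_sin Real.abs_sin_le_one).measurable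
      (abs_sqSeries_le Real.abs_sin_le_one) _ _ _
  have hinv : ∀ y : ℝ, 0 < y → thetaPrimitive (verticalPath 0 y)⁻¹ = (c y : ℝ) - Complex.I * (d y : ℝ) := by
    intro y hy
    rw [inv_verticalPath_zero_eq hy.ne', thetaPrimitive_I_mul]
    simp only [hc, hd]
    rw [show Real.pi * (2 / y) = 2 * Real.pi / y by ring]
  have hint : ∫ y in (0 : ℝ)..α, -(Complex.I / 2) *
      (3 / 2 * verticalPath 0 y ^ (1 / 2 : ℂ) * thetaPrimitive (verticalPath 0 y)⁻¹) =
      ((∫ y in (0 : ℝ)..α, -(3 / 8) * (√y * c y + √y * d y) : ℝ) : ℂ) +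
      ((∫ y in (0 : ℝ)..α, 3 / 8 * (√y * d y - √y * c y) : ℝ) : ℂ) * Complex.I := by
    rw [← intervalIntegral.integral_ofReal, ← intervalIntegral.integral_ofReal,
      ← intervalIntegral.integral_mul_const, ← intervalIntegral.integral_add]
    · refine intervalIntegral.integral_congr_ae (ae_of_all _ fun y hy => ?_)
      rw [Set.uIoc_of_le hα.le] at hy
      rw [hinv y hy.1, cpow_half_verticalPath hy.1]
      push_cast
      linear_combination (3 / 8 * (√y : ℂ) * (c y + d y - Complex.I * d y)) * Complex.I_sq
    · have h := (hci.add hdi).const_mul (-(3 / 8))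
      exact ⟨h.1.ofReal, h.2.ofReal⟩
    · have h := (hdi.sub hci).const_mul (3 / 8)
      exact IntervalIntegrable.mul_const ⟨h.1.ofReal, h.2.ofReal⟩ _
  rw [hint, thetaPotential, hinv α hα, cpow_half_verticalPath hα, verticalPath_zero_eq, thetaPrimitive_I_mul,
    show (0 : ℂ) = Complex.I * ((0 : ℝ) : ℂ) by simp, thetaPrimitive_I_mul, mul_zero, mul_neg, sqSeries_neg_sin,
    sqSeries_sin_zero] at key
  have him := congrArg Complex.im key
  simp at him
  rw [intervalIntegral.integral_congr (g := fun y => √y * (d y - c y)) (fun y _ => by simp only []; ring)] at him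
  simp only [hc, hd] at him ⊢
  linarith

noncomputable def transitionWave (u : ℝ) : ℝ := 1 - Real.cos u + Real.sin u

theorem continuous_transitionWave : Continuous transitionWave := by unfold transitionWave; fun_prop

theorem abs_transitionWave_le (u : ℝ) : |transitionWave u| ≤ 3 := by
  have h1 := Real.abs_cos_le_one u
  have h2 := Real.abs_sin_le_one u
  unfold transitionWave
  rw [abs_le] at *
  constructor <;> linarith [h1.1, h1.2, h2.1, h2.2]

theorem sqSeries_transitionWave (t : ℝ) : sqSeries transitionWave t =
    ∑' n : ℕ, 1 / ((n : ℝ) + 1) ^ 2 + (sqSeries Real.sin t - sqSeries Real.cos t) := by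
  have h1 := summable_sqSeries Real.abs_cos_le_one t
  have h2 := summable_sqSeries Real.abs_sin_le_one t
  rw [sqSeries, sqSeries, sqSeries, ← h2.tsum_sub h1, ← summable_one_div_succ_sq.tsum_add (h2.sub h1)]
  refine tsum_congr fun n => ?_
  unfold transitionWave; ring

theorem transitionIntegrand_eq (k : ℕ) (y : ℝ) :
    transitionIntegrand k y = √y * transitionWave (2 * Real.pi * (k : ℝ) ^ 2 / y) := rfl

open MeasureTheory in
theorem intervalIntegrable_transitionIntegrand (k : ℕ) (a b : ℝ) :
    IntervalIntegrable (transitionIntegrand k) volume a b :=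
  intervalIntegrable_sqrt_mul_comp_div continuous_transitionWave.measurable abs_transitionWave_le _ a b

open MeasureTheory in
theorem intervalIntegrable_dualIntegrand (k : ℕ) (a b : ℝ) :
    IntervalIntegrable (dualIntegrand k) volume a b := by
  have h := intervalIntegrable_sqrt_mul_comp_div Real.measurable_sin Real.abs_sin_le_one
    (Real.pi * (k : ℝ) ^ 2 / 2) a b
  refine h.congr fun y _ => ?_
  simp only [dualIntegrand, div_div]

theorem hasSum_transitionTerm (α : ℝ) : HasSum (fun k : ℕ => transitionTerm α (k + 1))
    (∫ y in (0 : ℝ)..α, √y * sqSeries transitionWave (2 * Real.pi / y)) := by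
  refine (hasSum_integral_sqSeries continuous_transitionWave abs_transitionWave_le (2 * Real.pi) α).congr_fun
    fun k => ?_
  rw [transitionTerm]
  push_cast
  congr 1
  refine intervalIntegral.integral_congr fun y _ => ?_
  rw [transitionIntegrand_eq]
  push_cast
  ring_nf

theorem hasSum_dualTerm (α : ℝ) : HasSum (fun k : ℕ => dualTerm α (k + 1))
    (∫ y in (0 : ℝ)..(1 / α), √y * sqSeries Real.sin (Real.pi / 2 / y)) := by
  refine (hasSum_integral_sqSeries Real.continuous_sin Real.abs_sin_le_one (Real.pi / 2) (1 / α)).congr_fun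
    fun k => ?_
  rw [dualTerm]
  push_cast
  congr 1
  refine intervalIntegral.integral_congr fun y _ => ?_
  simp only [dualIntegrand]
  push_cast
  congr 2
  ring

/-- The total integral in the definition of `transitionC`. -/
noncomputable def transitionIntegral (α : ℝ) : ℝ :=
  ∫ y in (0 : ℝ)..α, √y * sqSeries transitionWave (2 * Real.pi / y)

noncomputable def dualIntegral (b : ℝ) : ℝ :=
  ∫ y in (0 : ℝ)..b, √y * sqSeries Real.sin (Real.pi / 2 / y)

theorem transitionC_eq (α : ℝ) : transitionC α = √α + 1 / (2 * Real.pi) * transitionIntegral α := by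
  rw [transitionC, (hasSum_transitionTerm α).tsum_eq, transitionIntegral]

open MeasureTheory in
theorem intervalIntegrable_sqrt_mul_sqSeries {h : ℝ → ℝ} (hc : Continuous h) {C : ℝ} (hC : ∀ x, |h x| ≤ C)
    (ω a b : ℝ) : IntervalIntegrable (fun y => √y * sqSeries h (ω / y)) volume a b :=
  intervalIntegrable_sqrt_mul_comp_div (continuous_sqSeries hc hC).measurable (abs_sqSeries_le hC) ω a b

theorem hasDerivAt_integral_sqrt_mul_sqSeries {h : ℝ → ℝ} (hc : Continuous h) {C : ℝ} (hC : ∀ x, |h x| ≤ C)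
    (ω : ℝ) {b : ℝ} (hb : 0 < b) :
    HasDerivAt (fun b => ∫ y in (0 : ℝ)..b, √y * sqSeries h (ω / y)) (√b * sqSeries h (ω / b)) b := by
  refine intervalIntegral.integral_hasDerivAt_right (intervalIntegrable_sqrt_mul_sqSeries hc hC ω 0 b) ?_ ?_
  · refine Measurable.stronglyMeasurable ?_ |>.stronglyMeasurableAtFilter
    exact Real.continuous_sqrt.measurable.mul
      ((continuous_sqSeries hc hC).measurable.comp (measurable_const.div measurable_id))
  · refine Real.continuous_sqrt.continuousAt.mul ?_
    exact ContinuousAt.comp (g := sqSeries h) (f := fun y => ω / y) (continuous_sqSeries hc hC).continuousAt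
      (continuousAt_const.div continuousAt_id hb.ne')

open MeasureTheory in
theorem sqSeries_sin_eq_transition {α : ℝ} (hα : 0 < α) :
    sqSeries Real.sin (Real.pi * (α / 2)) = Real.pi * √α / 2 - Real.pi * α / 4 -
      α * √α / 4 * sqSeries transitionWave (2 * Real.pi / α) + 3 / 8 * transitionIntegral α := by
  rw [sqSeries_sin_eq hα, transitionIntegral]
  set ζ := ∑' n : ℕ, 1 / ((n : ℝ) + 1) ^ 2 with hζ
  have h1 : ∀ t, sqSeries Real.sin t - sqSeries Real.cos t = sqSeries transitionWave t - ζ := by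
    intro t; rw [sqSeries_transitionWave]; ring
  have h2 : ∫ y in (0 : ℝ)..α, √y = 2 / 3 * (α * √α) := by
    have := intervalIntegral.integral_eq_sub_of_hasDerivAt_of_le hα.le (f := fun y => 2 / 3 * (y * √y))
      (f' := fun y => √y) (by fun_prop) (fun y hy => by
        have hy0 := hy.1
        have hs : 0 < √y := Real.sqrt_pos.mpr hy0
        refine (((hasDerivAt_id y).mul (Real.hasDerivAt_sqrt hy0.ne')).const_mul (2 / 3)).congr_deriv ?_
        simp only [id]
        field_simp
        nlinarith [Real.mul_self_sqrt hy0.le]) (Real.continuous_sqrt.intervalIntegrable _ _)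
    simpa using this
  simp only [h1, mul_sub]
  rw [intervalIntegral.integral_sub (intervalIntegrable_sqrt_mul_sqSeries continuous_transitionWave
    abs_transitionWave_le _ _ _) ((Real.continuous_sqrt.intervalIntegrable _ _).mul_const _),
    intervalIntegral.integral_mul_const, h2]
  ring

theorem hasDerivAt_transition_sub_dual {α : ℝ} (hα : 0 < α) :
    HasDerivAt (fun α => 1 / α + 1 / (2 * Real.pi) * (transitionIntegral α / (α * √α)) - 1 / √α -
      2 / Real.pi * dualIntegral (1 / α)) 0 α := by
  have hs : 0 < √α := Real.sqrt_pos.mpr hα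
  have hsq : √α * √α = α := Real.mul_self_sqrt hα.le
  have hπ := Real.pi_pos
  have d1 : HasDerivAt (fun α : ℝ => 1 / α) (-1 / α ^ 2) α := by
    have := (hasDerivAt_inv hα.ne')
    simp only [one_div]
    exact this.congr_deriv (by ring)
  have d2 := (hasDerivAt_integral_sqrt_mul_sqSeries continuous_transitionWave abs_transitionWave_le
    (2 * Real.pi) hα)
  have d3 : HasDerivAt (fun α : ℝ => α * √α) (3 / 2 * √α) α := by
    refine ((hasDerivAt_id α).mul (Real.hasDerivAt_sqrt hα.ne')).congr_deriv ?_
    simp only [id]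
    field_simp
    nlinarith
  have d4 : HasDerivAt (fun α : ℝ => 1 / √α) (-(1 / (2 * √α)) / (√α) ^ 2) α := by
    have := (Real.hasDerivAt_sqrt hα.ne').inv hs.ne'
    simp only [one_div] at this ⊢
    exact this
  have d5 := (hasDerivAt_integral_sqrt_mul_sqSeries Real.continuous_sin Real.abs_sin_le_one
    (Real.pi / 2) (one_div_pos.mpr hα)).comp α d1
  have d := ((d1.add ((d2.div d3 (by positivity)).const_mul (1 / (2 * Real.pi)))).sub d4).sub
    (d5.const_mul (2 / Real.pi))
  refine d.congr_deriv ?_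
  have key := sqSeries_sin_eq_transition hα
  have e1 : Real.pi / 2 / (1 / α) = Real.pi * (α / 2) := by field_simp
  rw [e1, key, Real.sqrt_div zero_le_one, Real.sqrt_one]
  rw [← transitionIntegral]
  generalize transitionIntegral α = T
  generalize sqSeries transitionWave (2 * Real.pi / α) = E
  generalize √α = w at *
  subst hsq
  field_simp
  ring

open MeasureTheory in
theorem tendsto_transitionIntegral_div : Filter.Tendsto (fun α => transitionIntegral α / (α * √α))
    Filter.atTop (nhds 0) := by
  have hE := continuous_sqSeries continuous_transitionWave abs_transitionWave_le
  have h0 : sqSeries transitionWave 0 = 0 := by simp [sqSeries, transitionWave]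
  have e : ∀ α : ℝ, 0 < α → ∫ u in (0 : ℝ)..1, √u * sqSeries transitionWave (2 * Real.pi / (α * u)) =
      transitionIntegral α / (α * √α) := by
    intro α hα
    have hs : 0 < √α := Real.sqrt_pos.mpr hα
    have h := intervalIntegral.integral_comp_mul_left (a := 0) (b := 1)
      (fun y => √y * sqSeries transitionWave (2 * Real.pi / y)) hα.ne'
    rw [mul_zero, mul_one, ← transitionIntegral, smul_eq_mul] at h
    simp only [Real.sqrt_mul hα.le, mul_assoc] at h
    rw [intervalIntegral.integral_const_mul] at h
    rw [eq_div_iff (by positivity)]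
    field_simp at h
    linarith
  have hlim : Filter.Tendsto (fun α : ℝ => ∫ u in (0 : ℝ)..1, √u * sqSeries transitionWave (2 * Real.pi / (α * u)))
      Filter.atTop (nhds (∫ u in (0 : ℝ)..1, √u * sqSeries transitionWave 0)) := by
    refine intervalIntegral.tendsto_integral_filter_of_dominated_convergence (fun u => √u * (2 * 3)) ?_ ?_
      ((Real.continuous_sqrt.intervalIntegrable _ _).mul_const _) ?_
    · refine Filter.Eventually.of_forall fun α => Measurable.aestronglyMeasurable ?_
      exact Real.continuous_sqrt.measurable.mul (hE.measurable.comp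
        (measurable_const.div (measurable_const.mul measurable_id)))
    · refine Filter.Eventually.of_forall fun α => ae_of_all _ fun u _ => ?_
      rw [norm_mul, Real.norm_of_nonneg (Real.sqrt_nonneg _)]
      gcongr
      exact abs_sqSeries_le abs_transitionWave_le _
    · refine ae_of_all _ fun u hu => ?_
      rw [Set.uIoc_of_le zero_le_one] at hu
      refine Filter.Tendsto.const_mul _ ((hE.tendsto 0).comp ?_)
      exact Filter.Tendsto.const_div_atTop (Filter.tendsto_id.atTop_mul_const hu.1) _
  rw [h0] at hlim
  simp only [mul_zero, intervalIntegral.integral_zero] at hlim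
  refine hlim.congr' ?_
  filter_upwards [Filter.eventually_gt_atTop 0] with α hα using e α hα

theorem abs_dualIntegral_le {b : ℝ} (hb : 0 ≤ b) : |dualIntegral b| ≤ 2 * (b * √b) := by
  have := intervalIntegral.norm_integral_le_of_norm_le_const (a := (0 : ℝ)) (b := b) (C := 2 * √b)
    (f := fun y => √y * sqSeries Real.sin (Real.pi / 2 / y)) (fun t ht => by
      rw [Set.uIoc_of_le hb] at ht
      rw [norm_mul, Real.norm_of_nonneg (Real.sqrt_nonneg _), mul_comm]
      have h1 := abs_sqSeries_le Real.abs_sin_le_one (Real.pi / 2 / t)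
      rw [mul_one] at h1
      exact mul_le_mul h1 (Real.sqrt_le_sqrt ht.2) (Real.sqrt_nonneg _) zero_le_two)
  rw [dualIntegral, ← Real.norm_eq_abs]
  refine this.trans (le_of_eq ?_)
  rw [sub_zero, abs_of_nonneg hb]; ring

theorem tendsto_dualIntegral : Filter.Tendsto (fun α : ℝ => dualIntegral (1 / α)) Filter.atTop (nhds 0) := by
  have h1 : Filter.Tendsto (fun α : ℝ => 2 * (1 / α * √(1 / α))) Filter.atTop (nhds (2 * (0 * √0))) := by
    have h0 : Filter.Tendsto (fun α : ℝ => 1 / α) Filter.atTop (nhds 0) :=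
      Filter.tendsto_id.const_div_atTop 1
    exact (h0.mul ((Real.continuous_sqrt.tendsto 0).comp h0)).const_mul 2
  rw [zero_mul, mul_zero] at h1
  refine squeeze_zero_norm' ?_ h1
  filter_upwards [Filter.eventually_gt_atTop 0] with α hα
  exact abs_dualIntegral_le (one_div_pos.mpr hα).le

theorem transition_sub_dual_eq_zero {α : ℝ} (hα : 0 < α) :
    1 / α + 1 / (2 * Real.pi) * (transitionIntegral α / (α * √α)) - 1 / √α -
      2 / Real.pi * dualIntegral (1 / α) = 0 := by
  set H : ℝ → ℝ := fun α => 1 / α + 1 / (2 * Real.pi) * (transitionIntegral α / (α * √α)) - 1 / √α -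
      2 / Real.pi * dualIntegral (1 / α) with hH
  have hlim : Filter.Tendsto H Filter.atTop (nhds 0) := by
    have h0 : Filter.Tendsto (fun α : ℝ => 1 / α) Filter.atTop (nhds 0) :=
      Filter.tendsto_id.const_div_atTop 1
    have h1 : Filter.Tendsto (fun α : ℝ => 1 / √α) Filter.atTop (nhds 0) :=
      Real.tendsto_sqrt_atTop.const_div_atTop 1
    have := ((h0.add (tendsto_transitionIntegral_div.const_mul (1 / (2 * Real.pi)))).sub h1).sub
      (tendsto_dualIntegral.const_mul (2 / Real.pi))
    simpa [hH] using this
  have hconst : ∀ b, α < b → H b = H α := by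
    intro b hb
    obtain ⟨c, -, hc2⟩ := exists_hasDerivAt_eq_slope H (fun _ => 0) hb
      (fun x hx => (hasDerivAt_transition_sub_dual (hα.trans_le hx.1)).continuousAt.continuousWithinAt)
      (fun x hx => hasDerivAt_transition_sub_dual (hα.trans hx.1))
    rw [eq_comm, div_eq_zero_iff] at hc2
    rcases hc2 with h | h <;> linarith
  refine tendsto_nhds_unique (tendsto_const_nhds.congr' ?_) hlim
  filter_upwards [Filter.eventually_gt_atTop α] with b hb using (hconst b hb).symm

/-- The dual expression for `transitionC`. -/
theorem transitionC_eq_dual {α : ℝ} (hα : 0 < α) :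
    transitionC α = α + α * √α * (2 / Real.pi) * dualIntegral (1 / α) := by
  have h := transition_sub_dual_eq_zero hα
  have hs : 0 < √α := Real.sqrt_pos.mpr hα
  have hsq : √α * √α = α := Real.mul_self_sqrt hα.le
  have hπ := Real.pi_pos
  rw [transitionC_eq]
  generalize transitionIntegral α = T at *
  generalize dualIntegral (1 / α) = U at *
  generalize √α = w at *
  subst hsq
  field_simp at h ⊢
  linarith

theorem rpow_three_halves {x : ℝ} (hx : 0 ≤ x) : x ^ (3 / 2 : ℝ) = x * √x := by
  rw [Real.sqrt_eq_rpow, show (3 / 2 : ℝ) = 1 + 1 / 2 by norm_num, Real.rpow_add_of_nonneg hx (by norm_num)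
    (by norm_num), Real.rpow_one]

theorem sqrt_add_le_sqrt_add_sqrt {a b : ℝ} (ha : 0 ≤ a) (hb : 0 ≤ b) : √(a + b) ≤ √a + √b := by
  rw [Real.sqrt_le_left (by positivity)]
  nlinarith [Real.mul_self_sqrt ha, Real.mul_self_sqrt hb, mul_nonneg (Real.sqrt_nonneg a) (Real.sqrt_nonneg b)]

open MeasureTheory in
theorem integral_sqrt_mul_sqSeries_scale {h : ℝ → ℝ} (ω : ℝ) {x Y : ℝ} (hx : 0 < x) :
    ∫ t in (0 : ℝ)..Y, √t * sqSeries h (ω * x / t) =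
      x * √x * ∫ y in (0 : ℝ)..(Y / x), √y * sqSeries h (ω / y) := by
  have h1 := intervalIntegral.smul_integral_comp_mul_left (a := 0) (b := Y / x)
    (fun t => √t * sqSeries h (ω * x / t)) x
  rw [smul_eq_mul] at h1
  rw [mul_zero, mul_div_cancel₀ _ hx.ne'] at h1
  rw [← h1, mul_assoc x, ← intervalIntegral.integral_const_mul (√x)]
  refine congrArg (fun I => x * I) (intervalIntegral.integral_congr fun y _ => ?_)
  simp only [Real.sqrt_mul hx.le]
  rw [mul_comm ω x, mul_div_mul_left _ _ hx.ne', mul_assoc]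

/-- The constant by which `mainTerm` differs from the scaled transition function. -/
noncomputable def mainTermShift (Y : ℝ) : ℝ :=
  (∑' n : ℕ, 1 / ((n : ℝ) + 1) ^ 2) / (8 * Real.pi) * ∫ t in (0 : ℝ)..Y, √t

open MeasureTheory in
theorem mainTerm_eq {x Y : ℝ} (hx : 0 < x) (hY : 0 ≤ Y) :
    mainTerm Y x + mainTermShift Y = x * √x / 4 * transitionC (Y / x) := by
  have hb : ∀ u, |Real.sin u - Real.cos u| ≤ 2 := fun u => (abs_sub _ _).trans (by
    linarith [Real.abs_cos_le_one u, Real.abs_sin_le_one u])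
  have hs := hasSum_integral_sqSeries (h := fun u => Real.sin u - Real.cos u) (by fun_prop) hb (2 * Real.pi * x) Y
  have h1 : ∑' j : ℕ, 1 / (j : ℝ) ^ 2 * phaseDerivIntegral Y (2 * Real.pi * j ^ 2 * x) =
      ∫ t in (0 : ℝ)..Y, √t * sqSeries (fun u => Real.sin u - Real.cos u) (2 * Real.pi * x / t) := by
    rw [← hs.tsum_eq, tsum_eq_zero_add']
    · simp only [Nat.cast_zero, ne_eq, OfNat.ofNat_ne_zero, not_false_eq_true, zero_pow, div_zero, zero_mul, zero_add]
      refine tsum_congr fun n => ?_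
      rw [phaseDerivIntegral]
      push_cast
      congr 1
      refine intervalIntegral.integral_congr fun y _ => ?_
      rw [show 2 * Real.pi * ((n : ℝ) + 1) ^ 2 * x / y = ((n : ℝ) + 1) ^ 2 * (2 * Real.pi * x / y) by ring]
    · refine Summable.of_norm_bounded (summable_one_div_succ_sq.mul_right (2 * (Y * √Y))) fun n => ?_
      rw [norm_mul, Real.norm_of_nonneg (by positivity)]
      push_cast
      gcongr
      exact abs_phaseDerivIntegral_le hY _
  have h2 : ∀ t, sqSeries (fun u => Real.sin u - Real.cos u) t =
      sqSeries transitionWave t - ∑' n : ℕ, 1 / ((n : ℝ) + 1) ^ 2 := by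
    intro t
    rw [sqSeries_transitionWave, sqSeries, sqSeries, sqSeries, add_sub_cancel_left,
      ← (summable_sqSeries Real.abs_sin_le_one t).tsum_sub (summable_sqSeries Real.abs_cos_le_one t)]
    refine tsum_congr fun n => ?_
    ring
  rw [mainTerm, h1]
  simp only [h2, mul_sub]
  rw [intervalIntegral.integral_sub (intervalIntegrable_sqrt_mul_sqSeries continuous_transitionWave
    abs_transitionWave_le _ _ _) ((Real.continuous_sqrt.intervalIntegrable _ _).mul_const _),
    intervalIntegral.integral_mul_const, integral_sqrt_mul_sqSeries_scale _ hx, ← transitionIntegral,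
    transitionC_eq, mainTermShift, Real.sqrt_div hY]
  have : 0 < √x := Real.sqrt_pos.mpr hx
  field_simp
  ring

theorem mainTerm_eq_dual {x Y : ℝ} (hx : 0 < x) (hY : 0 < Y) :
    mainTerm Y x + mainTermShift Y = Y * √x / 4 + Y * √Y / (2 * Real.pi) * dualIntegral (x / Y) := by
  have hs : 0 < √x := Real.sqrt_pos.mpr hx
  have hsx : √x * √x = x := Real.mul_self_sqrt hx.le
  have hπ := Real.pi_pos
  rw [mainTerm_eq hx hY.le, transitionC_eq_dual (div_pos hY hx), Real.sqrt_div hY.le, one_div_div]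
  generalize dualIntegral (x / Y) = U
  generalize √x = w at *
  subst hsx
  field_simp
  ring

open MeasureTheory in
theorem abs_dualIntegral_sub_le {a b : ℝ} (hab : a ≤ b) :
    |dualIntegral b - dualIntegral a| ≤ 2 * √b * (b - a) := by
  have hi := fun a b => intervalIntegrable_sqrt_mul_sqSeries Real.continuous_sin Real.abs_sin_le_one
    (Real.pi / 2) a b
  rw [dualIntegral, dualIntegral, intervalIntegral.integral_interval_sub_left (hi 0 b) (hi 0 a)]
  have := intervalIntegral.norm_integral_le_of_norm_le_const (a := a) (b := b) (C := 2 * √b)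
    (f := fun y => √y * sqSeries Real.sin (Real.pi / 2 / y)) (fun t ht => by
      rw [Set.uIoc_of_le hab] at ht
      rw [norm_mul, Real.norm_of_nonneg (Real.sqrt_nonneg _), mul_comm]
      have h1 := abs_sqSeries_le Real.abs_sin_le_one (Real.pi / 2 / t)
      rw [mul_one] at h1
      exact mul_le_mul h1 (Real.sqrt_le_sqrt ht.2) (Real.sqrt_nonneg _) zero_le_two)
  rwa [abs_of_nonneg (by linarith : 0 ≤ b - a)] at this

theorem abs_mainTerm_sub_le {X D ξ Y : ℝ} (hY : 0 < Y) (hX : 0 < X) (hDX : D ≤ X) (h1 : X ≤ ξ) (h2 : ξ ≤ X + D) :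
    |mainTerm Y ξ - mainTerm Y X| ≤ Y * √D + D * √X := by
  have hD : 0 ≤ D := by linarith
  have e : mainTerm Y ξ - mainTerm Y X = (mainTerm Y ξ + mainTermShift Y) - (mainTerm Y X + mainTermShift Y) := by
    ring
  have hπ := Real.pi_gt_three
  rw [e, mainTerm_eq_dual (hX.trans_le h1) hY, mainTerm_eq_dual hX hY]
  have e2 : Y * √ξ / 4 + Y * √Y / (2 * Real.pi) * dualIntegral (ξ / Y) -
      (Y * √X / 4 + Y * √Y / (2 * Real.pi) * dualIntegral (X / Y)) =
      Y / 4 * (√ξ - √X) + Y * √Y / (2 * Real.pi) * (dualIntegral (ξ / Y) - dualIntegral (X / Y)) := by ring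
  rw [e2]
  refine (abs_add_le _ _).trans (add_le_add ?_ ?_)
  · have h3 : √ξ ≤ √X + √D := (Real.sqrt_le_sqrt h2).trans (sqrt_add_le_sqrt_add_sqrt hX.le hD)
    have h4 : √X ≤ √ξ := Real.sqrt_le_sqrt h1
    rw [abs_mul, abs_of_pos (by positivity : 0 < Y / 4), abs_of_nonneg (by linarith)]
    have : Y / 4 * (√ξ - √X) ≤ Y / 4 * √D := by gcongr; linarith
    have : 0 ≤ Y * √D := by positivity
    linarith
  · have h5 := abs_dualIntegral_sub_le (a := X / Y) (b := ξ / Y) (by gcongr)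
    rw [abs_mul, abs_of_pos (by positivity : 0 < Y * √Y / (2 * Real.pi))]
    have h6 : √(ξ / Y) ≤ 2 * √X / √Y := by
      rw [Real.sqrt_div (by linarith), show 2 * √X = √(4 * X) by
        rw [Real.sqrt_mul (by norm_num), show (4 : ℝ) = 2 ^ 2 by norm_num, Real.sqrt_sq (by norm_num)]]
      gcongr
      linarith
    have hsY : 0 < √Y := Real.sqrt_pos.mpr hY
    calc _ ≤ Y * √Y / (2 * Real.pi) * (2 * (2 * √X / √Y) * (D / Y)) := by
          gcongr
          refine h5.trans ?_
          have : ξ / Y - X / Y ≤ D / Y := by rw [← sub_div]; gcongr; linarith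
          have h0 : 0 ≤ ξ / Y - X / Y := by rw [← sub_div]; exact div_nonneg (by linarith) hY.le
          gcongr
      _ = 2 * (D * √X) / Real.pi := by field_simp
      _ ≤ _ := by
          rw [div_le_iff₀ (by linarith)]
          have : 0 ≤ D * √X := by positivity
          nlinarith

theorem abs_mainTerm_add_shift_le {D η Y : ℝ} (hY : 0 < Y) (h1 : 0 < η) (h2 : η ≤ D) :
    |mainTerm Y η + mainTermShift Y| ≤ Y * √D + D * √D := by
  have hπ := Real.pi_gt_three
  have hD : 0 < D := by linarith
  have hsY : 0 < √Y := Real.sqrt_pos.mpr hY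
  rw [mainTerm_eq_dual h1 hY]
  refine (abs_add_le _ _).trans (add_le_add ?_ ?_)
  · rw [abs_of_nonneg (by positivity)]
    have : Y * √η ≤ Y * √D := by gcongr
    have : 0 ≤ Y * √D := by positivity
    linarith
  · rw [abs_mul, abs_of_pos (by positivity : 0 < Y * √Y / (2 * Real.pi))]
    calc _ ≤ Y * √Y / (2 * Real.pi) * (2 * (D / Y * (√D / √Y))) := by
          gcongr
          refine (abs_dualIntegral_le (by positivity)).trans ?_
          rw [← Real.sqrt_div hD.le]
          gcongr
      _ = D * √D / Real.pi := by field_simp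
      _ ≤ _ := div_le_self (by positivity) (by linarith)

/-- The smoothed completed sum in terms of the transition function. -/
theorem abs_sum_trapezoid_mul_completedJacobi_sub_le {X Y D K : ℝ} (hY : 1 ≤ Y) (hD : 0 < D) (hDX : D ≤ X)
    (hK : 0 < K) {B : ℕ} (hB : X + D ≤ B) :
    |∑ N ∈ (Finset.Icc 0 ⌊Y⌋₊).filter (fun N => Odd N),
        ∑ M ∈ (Finset.range ((B + 1) * 2)).filter (fun M => Odd M), trapezoid X D M * completedJacobi M N -
      X * √X / 4 * transitionC (Y / X)| ≤
      120 * (X + Y * √D + D * √X + K ^ 2 * √Y * (X + Y) / D + Y ^ 2 * √Y / (K * D)) := by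
  have hX : 0 < X := hD.trans_le hDX
  have hY0 : 0 < Y := by linarith
  obtain ⟨ξ, hξ, η, hη, h⟩ := exists_abs_sum_trapezoid_sub_le hY hD hDX hK hB
  have h1 := abs_mainTerm_sub_le hY0 hX hDX hξ.1.le hξ.2.le
  have h2 := abs_mainTerm_add_shift_le hY0 hη.1 hη.2.le
  have h3 := mainTerm_eq hX hY0.le
  have h4 : D * √D ≤ D * √X := by gcongr
  have h5 : 0 ≤ Y * √D := by positivity
  have h6 : 0 ≤ D * √X := by positivity
  have h7 : (K ^ 2 * √Y * (X + Y) + Y ^ 2 * √Y / K) / D =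
      K ^ 2 * √Y * (X + Y) / D + Y ^ 2 * √Y / (K * D) := by rw [add_div, div_div]
  rw [h7] at h
  rw [← h3]
  rw [abs_le] at *
  constructor <;> linarith [h.1, h.2, h1.1, h1.2, h2.1, h2.2]

/-- The sum of Jacobi symbols smoothed in the numerator. -/
noncomputable def smoothSum (X D Y : ℝ) (n : ℕ) : ℝ :=
  ∑ N ∈ (Finset.Icc 0 ⌊Y⌋₊).filter (fun N => Odd N),
    ∑ M ∈ (Finset.range n).filter (fun M => Odd M), trapezoid X D M * J((M : ℤ) | N)

noncomputable def smoothCompletedSum (X D Y : ℝ) (n : ℕ) : ℝ :=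
  ∑ N ∈ (Finset.Icc 0 ⌊Y⌋₊).filter (fun N => Odd N),
    ∑ M ∈ (Finset.range n).filter (fun M => Odd M), trapezoid X D M * completedJacobi M N

/-- Recovering the Jacobi symbol from its completion. -/
theorem sum_moebius_mul_completedJacobi {N : ℕ} (hN : N ≠ 0) (M : ℕ) :
    ∑ l ∈ N.divisors.filter (fun l => l * l ∣ N ∧ l * l ∣ M),
      (ArithmeticFunction.moebius l : ℝ) * (l * completedJacobi (M / (l * l)) (N / (l * l))) = J((M : ℤ) | N) := by
  have hmem : ∀ l, l ∈ N.divisors.filter (fun l => l * l ∣ N ∧ l * l ∣ M) ↔ l * l ∣ N ∧ l * l ∣ M := by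
    intro l
    simp only [Finset.mem_filter, Nat.mem_divisors]
    exact ⟨fun h => h.2, fun h => ⟨⟨(Dvd.intro l rfl).trans h.1, hN⟩, h⟩⟩
  set S := N.divisors.filter (fun l => l * l ∣ N ∧ l * l ∣ M) with hS
  have h1 : ∀ l ∈ S, (ArithmeticFunction.moebius l : ℝ) * (l * completedJacobi (M / (l * l)) (N / (l * l))) =
      ∑ f ∈ S, if l ∣ f then (ArithmeticFunction.moebius l : ℝ) *
        (f * J(((M / (f * f) : ℕ) : ℤ) | N / (f * f))) else 0 := by
    intro l hl
    obtain ⟨hlN, hlM⟩ := (hmem l).mp hl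
    have hl0 : 0 < l := Nat.pos_of_ne_zero fun h => hN (by rw [h] at hlN; simpa using hlN)
    have hN' : N / (l * l) ≠ 0 := (Nat.div_pos (Nat.le_of_dvd (Nat.pos_of_ne_zero hN) hlN) (by positivity)).ne'
    rw [completedJacobi, Finset.mul_sum, Finset.mul_sum, ← Finset.sum_filter]
    refine Finset.sum_bij (fun e _ => l * e) ?_ ?_ ?_ ?_
    · intro e he
      obtain ⟨-, h2, h3⟩ := Finset.mem_filter.mp he
      rw [Finset.mem_filter, hmem]
      refine ⟨⟨?_, ?_⟩, Dvd.intro e rfl⟩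
      · rw [mul_mul_mul_comm]; exact Nat.mul_dvd_of_dvd_div hlN h2
      · rw [mul_mul_mul_comm]; exact Nat.mul_dvd_of_dvd_div hlM h3
    · intro a _ b _ hab
      exact Nat.eq_of_mul_eq_mul_left hl0 hab
    · intro f hf
      obtain ⟨hf1, e, rfl⟩ := Finset.mem_filter.mp hf
      rw [hmem, mul_mul_mul_comm] at hf1
      have h2 := Nat.dvd_div_of_mul_dvd hf1.1
      refine ⟨e, ?_, rfl⟩
      rw [Finset.mem_filter, Nat.mem_divisors]
      exact ⟨⟨(Dvd.intro e rfl).trans h2, hN'⟩, h2, Nat.dvd_div_of_mul_dvd hf1.2⟩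
    · intro e _
      rw [Nat.div_div_eq_div_mul, Nat.div_div_eq_div_mul, mul_mul_mul_comm]
      push_cast
      ring
  rw [Finset.sum_congr rfl h1, Finset.sum_comm]
  have h2 : ∀ f ∈ S, ∑ l ∈ S, (if l ∣ f then (ArithmeticFunction.moebius l : ℝ) *
        (f * J(((M / (f * f) : ℕ) : ℤ) | N / (f * f))) else 0) =
      if f = 1 then (J((M : ℤ) | N) : ℝ) else 0 := by
    intro f hf
    obtain ⟨hfN, hfM⟩ := (hmem f).mp hf
    have hf0 : f ≠ 0 := fun h => hN (by rw [h] at hfN; simpa using hfN)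
    have e : S.filter (fun l => l ∣ f) = f.divisors := by
      ext l
      rw [Finset.mem_filter, hmem, Nat.mem_divisors]
      exact ⟨fun h => ⟨h.2, hf0⟩, fun h => ⟨⟨(mul_dvd_mul h.1 h.1).trans hfN, (mul_dvd_mul h.1 h.1).trans hfM⟩, h.1⟩⟩
    have hm : ∑ l ∈ f.divisors, (ArithmeticFunction.moebius l : ℝ) = if f = 1 then 1 else 0 := by
      have := congrArg (Int.cast : ℤ → ℝ) (sum_divisors_moebius f)
      push_cast at this
      exact this
    rw [← Finset.sum_filter, e, ← Finset.sum_mul, hm]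
    split_ifs with h
    · subst h; simp
    · simp
  rw [Finset.sum_congr rfl h2, Finset.sum_ite_eq' S 1, if_pos ((hmem 1).mpr ⟨by simp, by simp⟩)]

theorem sum_ite_mul_self_dvd {l : ℕ} (hl : 0 < l) {s s' : Finset ℕ} (h : ∀ n, n ∈ s' ↔ l * l * n ∈ s) (F : ℕ → ℝ) :
    ∑ N ∈ s, (if l * l ∣ N then F N else 0) = ∑ n ∈ s', F (l * l * n) := by
  rw [← Finset.sum_filter]
  symm
  refine Finset.sum_bij (fun n _ => l * l * n) ?_ ?_ ?_ ?_
  · intro n hn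
    exact Finset.mem_filter.mpr ⟨(h n).mp hn, Dvd.intro n rfl⟩
  · intro a _ b _ hab
    exact Nat.eq_of_mul_eq_mul_left (by positivity) hab
  · intro N hN
    obtain ⟨h1, n, rfl⟩ := Finset.mem_filter.mp hN
    exact ⟨n, (h n).mpr h1, rfl⟩
  · intro n _; rfl

theorem smoothCompletedSum_scale {l : ℕ} (hl : Odd l) {X D Y : ℝ} (hX : 0 ≤ X) (hD : 0 ≤ D) {n : ℕ} (hn : X + D ≤ n) :
    smoothCompletedSum (X / (l : ℝ) ^ 2) (D / (l : ℝ) ^ 2) (Y / (l : ℝ) ^ 2) n =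
      ∑ N ∈ (Finset.Icc 0 ⌊Y⌋₊).filter (fun N => Odd N), ∑ M ∈ (Finset.range n).filter (fun M => Odd M),
        if l * l ∣ N ∧ l * l ∣ M then trapezoid X D M * completedJacobi (M / (l * l)) (N / (l * l)) else 0 := by
  have hl0 := hl.pos
  have hlR : (0 : ℝ) < (l : ℝ) ^ 2 := by positivity
  have hll : 0 < l * l := by positivity
  have hoddl : Odd (l * l) := hl.mul hl
  symm
  have hN : ∀ F : ℕ → ℝ, ∑ N ∈ (Finset.Icc 0 ⌊Y⌋₊).filter (fun N => Odd N), (if l * l ∣ N then F N else 0) =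
      ∑ N ∈ (Finset.Icc 0 ⌊Y / (l : ℝ) ^ 2⌋₊).filter (fun N => Odd N), F (l * l * N) := by
    intro F
    refine sum_ite_mul_self_dvd hl0 (fun n => ?_) F
    have e : ⌊Y / (l : ℝ) ^ 2⌋₊ = ⌊Y⌋₊ / (l * l) := by
      rw [← Nat.floor_div_natCast]; push_cast; rw [sq]
    simp only [Finset.mem_filter, Finset.mem_Icc, Nat.odd_mul, hl, true_and, zero_le, e,
      Nat.le_div_iff_mul_le hll, mul_comm n (l * l)]
  have hM : ∀ F : ℕ → ℝ, (∀ M, n ≤ M → F M = 0) →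
      ∑ M ∈ (Finset.range n).filter (fun M => Odd M), (if l * l ∣ M then F M else 0) =
      ∑ M ∈ (Finset.range n).filter (fun M => Odd M), F (l * l * M) := by
    intro F hF
    rw [sum_ite_mul_self_dvd hl0 (s' := ((Finset.range n).filter (fun M => Odd M)).filter (fun M => l * l * M < n))
      (fun m => ?_) F]
    · refine Finset.sum_subset (Finset.filter_subset _ _) fun m hm1 hm2 => hF _ ?_
      by_contra hcon
      exact hm2 (Finset.mem_filter.mpr ⟨hm1, by omega⟩)
    · simp only [Finset.mem_filter, Finset.mem_range, Nat.odd_mul, hl, true_and]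
      have : m ≤ l * l * m := Nat.le_mul_of_pos_left _ hll
      constructor
      · rintro ⟨⟨_, h2⟩, h3⟩; exact ⟨h3, h2⟩
      · rintro ⟨h3, h2⟩; exact ⟨⟨by omega, h2⟩, h3⟩
  simp only [ite_and]
  have hpull : ∀ N ∈ (Finset.Icc 0 ⌊Y⌋₊).filter (fun N => Odd N), ∑ M ∈ (Finset.range n).filter (fun M => Odd M),
      (if l * l ∣ N then (if l * l ∣ M then trapezoid X D M * completedJacobi (M / (l * l)) (N / (l * l)) else 0)
        else 0) = if l * l ∣ N then ∑ M ∈ (Finset.range n).filter (fun M => Odd M),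
      (if l * l ∣ M then trapezoid X D M * completedJacobi (M / (l * l)) (N / (l * l)) else 0) else 0 := by
    intro N _
    split_ifs <;> simp
  rw [Finset.sum_congr rfl hpull, hN, smoothCompletedSum]
  refine Finset.sum_congr rfl fun N _ => ?_
  rw [hM]
  · refine Finset.sum_congr rfl fun M _ => ?_
    rw [Nat.mul_div_cancel_left _ hll, Nat.mul_div_cancel_left _ hll]
    congr 1
    push_cast
    rw [← sq]
    exact trapezoid_mul_left X D M hlR
  · intro M hM
    rw [trapezoid_eq_zero hX hD (hn.trans (by exact_mod_cast hM)), zero_mul]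

theorem smoothSum_eq {X D Y : ℝ} (hX : 0 ≤ X) (hD : 0 ≤ D) {n : ℕ} (hn : X + D ≤ n) :
    smoothSum X D Y n = ∑ l ∈ (Finset.Icc 1 (Nat.sqrt ⌊Y⌋₊)).filter (fun l => Odd l),
      (ArithmeticFunction.moebius l : ℝ) *
        (l * smoothCompletedSum (X / (l : ℝ) ^ 2) (D / (l : ℝ) ^ 2) (Y / (l : ℝ) ^ 2) n) := by
  have h1 : ∀ l ∈ (Finset.Icc 1 (Nat.sqrt ⌊Y⌋₊)).filter (fun l => Odd l), (ArithmeticFunction.moebius l : ℝ) *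
        (l * smoothCompletedSum (X / (l : ℝ) ^ 2) (D / (l : ℝ) ^ 2) (Y / (l : ℝ) ^ 2) n) =
      ∑ N ∈ (Finset.Icc 0 ⌊Y⌋₊).filter (fun N => Odd N), ∑ M ∈ (Finset.range n).filter (fun M => Odd M),
        if l * l ∣ N ∧ l * l ∣ M then (ArithmeticFunction.moebius l : ℝ) * (l * (trapezoid X D M *
          completedJacobi (M / (l * l)) (N / (l * l)))) else 0 := by
    intro l hl
    rw [smoothCompletedSum_scale (Finset.mem_filter.mp hl).2 hX hD hn]
    simp only [Finset.mul_sum, mul_ite, mul_zero]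
  rw [Finset.sum_congr rfl h1, Finset.sum_comm, smoothSum]
  refine Finset.sum_congr rfl fun N hN => ?_
  rw [Finset.sum_comm]
  refine Finset.sum_congr rfl fun M hM => ?_
  obtain ⟨hN1, hN2⟩ := Finset.mem_filter.mp hN
  rw [← sum_moebius_mul_completedJacobi hN2.pos.ne' M, Finset.mul_sum, ← Finset.sum_filter]
  refine Finset.sum_congr ?_ fun l _ => by ring
  ext l
  simp only [Finset.mem_filter, Finset.mem_Icc, Nat.mem_divisors]
  constructor
  · rintro ⟨⟨h2, -⟩, h3, h4⟩
    have h5 : l * l ≤ ⌊Y⌋₊ := (Nat.le_of_dvd hN2.pos h3).trans (Finset.mem_Icc.mp hN1).2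
    exact ⟨⟨⟨Nat.pos_of_dvd_of_pos h2 hN2.pos, Nat.le_sqrt.mpr h5⟩, hN2.of_dvd_nat h2⟩, h3, h4⟩
  · rintro ⟨-, h3, h4⟩
    exact ⟨⟨(Dvd.intro l rfl).trans h3, hN2.pos.ne'⟩, h3, h4⟩

theorem summable_moebius_div_sq : Summable fun n : ℕ => (ArithmeticFunction.moebius n : ℝ) / (n : ℝ) ^ 2 := by
  refine Summable.of_norm_bounded (Real.summable_one_div_nat_pow.mpr one_lt_two) fun n => ?_
  rw [norm_div, Real.norm_of_nonneg (by positivity : 0 ≤ (n : ℝ) ^ 2)]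
  gcongr
  exact abs_moebius_cast_le n

theorem tsum_moebius_div_sq : ∑' n : ℕ, (ArithmeticFunction.moebius n : ℝ) / (n : ℝ) ^ 2 = 6 / Real.pi ^ 2 := by
  have h := ArithmeticFunction.LSeries_zeta_mul_Lseries_moebius (s := 2) (by norm_num)
  rw [ArithmeticFunction.LSeries_zeta_eq_riemannZeta (by norm_num), riemannZeta_two] at h
  have e : LSeries (fun n => ((ArithmeticFunction.moebius n : ℤ) : ℂ)) 2 =
      ((∑' n : ℕ, (ArithmeticFunction.moebius n : ℝ) / (n : ℝ) ^ 2 : ℝ) : ℂ) := by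
    rw [LSeries, Complex.ofReal_tsum]
    refine tsum_congr fun n => ?_
    rw [LSeries.term_def]
    split_ifs with hn
    · simp [hn]
    · push_cast
      norm_cast
  rw [e] at h
  have h2 : Real.pi ^ 2 / 6 * ∑' n : ℕ, (ArithmeticFunction.moebius n : ℝ) / (n : ℝ) ^ 2 = 1 := by
    exact_mod_cast h
  have := Real.pi_pos
  field_simp at h2 ⊢
  linarith

/-- `μ(n) / n²` on odd `n`. -/
noncomputable def oddMoebiusTerm (n : ℕ) : ℝ :=
  if Odd n then (ArithmeticFunction.moebius n : ℝ) / (n : ℝ) ^ 2 else 0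

theorem abs_oddMoebiusTerm_le (n : ℕ) : |oddMoebiusTerm n| ≤ 1 / (n : ℝ) ^ 2 := by
  unfold oddMoebiusTerm
  split_ifs
  · rw [abs_div, abs_of_nonneg (by positivity : 0 ≤ (n : ℝ) ^ 2)]
    gcongr
    exact abs_moebius_cast_le n
  · simp

theorem summable_oddMoebiusTerm : Summable oddMoebiusTerm :=
  Summable.of_norm_bounded (Real.summable_one_div_nat_pow.mpr one_lt_two) abs_oddMoebiusTerm_le

theorem moebius_two_mul (n : ℕ) : ArithmeticFunction.moebius (2 * n) =
    if Odd n then -ArithmeticFunction.moebius n else 0 := by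
  split_ifs with h
  · rw [ArithmeticFunction.isMultiplicative_moebius.map_mul_of_coprime (Nat.coprime_two_left.mpr h),
      ArithmeticFunction.moebius_apply_prime Nat.prime_two]
    ring
  · refine ArithmeticFunction.moebius_eq_zero_of_not_squarefree fun hsq => ?_
    obtain ⟨m, rfl⟩ := (Nat.not_odd_iff_even.mp h).two_dvd
    have := hsq 2 ⟨m, by ring⟩
    simp at this

theorem tsum_oddMoebiusTerm : ∑' n, oddMoebiusTerm n = 8 / Real.pi ^ 2 := by
  have h1 : ∀ n : ℕ, (ArithmeticFunction.moebius n : ℝ) / (n : ℝ) ^ 2 = oddMoebiusTerm n +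
      (if 2 ∣ n then (ArithmeticFunction.moebius n : ℝ) / (n : ℝ) ^ 2 else 0) := by
    intro n
    unfold oddMoebiusTerm
    by_cases h : Odd n
    · rw [if_pos h, if_neg (by rw [← even_iff_two_dvd]; exact Nat.not_even_iff_odd.mpr h), add_zero]
    · rw [if_neg h, if_pos (Nat.not_odd_iff_even.mp h).two_dvd, zero_add]
  have h2 : ∑' n : ℕ, (if 2 ∣ n then (ArithmeticFunction.moebius n : ℝ) / (n : ℝ) ^ 2 else 0) =
      -(1 / 4) * ∑' n, oddMoebiusTerm n := by
    rw [tsum_ite_dvd (by norm_num) (fun n => (ArithmeticFunction.moebius n : ℝ) / (n : ℝ) ^ 2), ← tsum_mul_left]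
    refine tsum_congr fun n => ?_
    rw [moebius_two_mul, oddMoebiusTerm]
    split_ifs
    · push_cast
      rw [mul_pow, neg_div, ← div_div]
      ring
    · simp
  have hs : Summable fun n : ℕ => (if 2 ∣ n then (ArithmeticFunction.moebius n : ℝ) / (n : ℝ) ^ 2 else 0) := by
    have := summable_moebius_div_sq.sub summable_oddMoebiusTerm
    refine this.congr fun n => ?_
    linarith [h1 n]
  have h3 := tsum_moebius_div_sq
  rw [tsum_congr h1, summable_oddMoebiusTerm.tsum_add hs, h2] at h3
  have : ∑' n, oddMoebiusTerm n = 4 / 3 * (6 / Real.pi ^ 2) := by rw [← h3]; ring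
  rw [this]; ring

theorem abs_sum_oddMoebiusTerm_sub_le (L : ℕ) :
    |∑ l ∈ (Finset.Icc 1 L).filter (fun l => Odd l), (ArithmeticFunction.moebius l : ℝ) / (l : ℝ) ^ 2 -
      8 / Real.pi ^ 2| ≤ 2 / ((L : ℝ) + 1) := by
  have h1 : ∑ l ∈ (Finset.Icc 1 L).filter (fun l => Odd l), (ArithmeticFunction.moebius l : ℝ) / (l : ℝ) ^ 2 =
      ∑ l ∈ Finset.range (L + 1), oddMoebiusTerm l := by
    have : Finset.Icc 1 L = (Finset.range (L + 1)).erase 0 := by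
      ext l; simp only [Finset.mem_Icc, Finset.mem_erase, Finset.mem_range]; omega
    rw [Finset.sum_filter, this, Finset.sum_erase _ (by simp)]
    rfl
  have h2 := summable_oddMoebiusTerm.sum_add_tsum_nat_add (L + 1)
  rw [tsum_oddMoebiusTerm] at h2
  rw [h1, ← h2, sub_add_cancel_left, abs_neg, ← Real.norm_eq_abs]
  have hs : Summable fun i : ℕ => 1 / (((i + (L + 1) : ℕ) : ℝ)) ^ 2 :=
    (summable_nat_add_iff (f := fun n : ℕ => 1 / (n : ℝ) ^ 2) (L + 1)).mpr (Real.summable_one_div_nat_pow.mpr one_lt_two)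
  refine (tsum_of_norm_bounded hs.hasSum fun i => abs_oddMoebiusTerm_le _).trans ?_
  refine Real.tsum_le_of_sum_range_le (fun i => by positivity) fun n => ?_
  have h3 := sum_Ioo_inv_sq_le (α := ℝ) L (L + 1 + n)
  refine le_trans (le_of_eq ?_) h3
  have e : Finset.Ioo L (L + 1 + n) = Finset.Ico (0 + (L + 1)) (n + (L + 1)) := by
    ext l; simp only [Finset.mem_Ioo, Finset.mem_Ico]; omega
  rw [e, ← Finset.sum_Ico_add' (fun i : ℕ => ((i : ℝ) ^ 2)⁻¹) 0 n (L + 1), Finset.range_eq_Ico]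
  simp

theorem sum_Icc_inv_le (L : ℕ) : ∑ l ∈ Finset.Icc 1 L, 1 / (l : ℝ) ≤ 1 + Real.log L := by
  have h := harmonic_le_one_add_log L
  rw [harmonic_eq_sum_Icc] at h
  push_cast at h
  simpa using h

theorem transitionC_scaled_bound {X Y : ℝ} (hX : 0 < X) (hY : 0 < Y) :
    |X * √X * transitionC (Y / X)| ≤ √Y * (X + Y) := by
  have hα : 0 < Y / X := div_pos hY hX
  have hT : |transitionIntegral (Y / X)| ≤ 6 * (Y / X * √(Y / X)) := by
    have := intervalIntegral.norm_integral_le_of_norm_le_const (a := (0 : ℝ)) (b := Y / X) (C := 6 * √(Y / X))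
      (f := fun y => √y * sqSeries transitionWave (2 * Real.pi / y)) (fun t ht => by
        rw [Set.uIoc_of_le hα.le] at ht
        rw [norm_mul, Real.norm_of_nonneg (Real.sqrt_nonneg _), mul_comm]
        have h1 := abs_sqSeries_le abs_transitionWave_le (2 * Real.pi / t)
        refine mul_le_mul (h1.trans (by norm_num)) (Real.sqrt_le_sqrt ht.2) (Real.sqrt_nonneg _) (by norm_num))
    rw [transitionIntegral, ← Real.norm_eq_abs]
    refine this.trans (le_of_eq ?_)
    rw [sub_zero, abs_of_pos hα]; ring
  have hsX : 0 < √X := Real.sqrt_pos.mpr hX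
  have hsY : 0 < √Y := Real.sqrt_pos.mpr hY
  have hπ := Real.pi_gt_three
  rw [transitionC_eq, mul_add]
  refine (abs_add_le _ _).trans ?_
  rw [mul_add]
  refine add_le_add (le_of_eq ?_) ?_
  · rw [abs_of_nonneg (by positivity), Real.sqrt_div hY.le]
    field_simp
  · rw [abs_mul (X * √X), abs_mul (1 / (2 * Real.pi)), abs_of_pos (by positivity : 0 < X * √X), abs_of_pos (by positivity : 0 < 1 / (2 * Real.pi))]
    calc _ ≤ X * √X * (1 / (2 * 3) * (6 * (Y / X * √(Y / X)))) := by gcongr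
      _ = _ := by rw [Real.sqrt_div hY.le]; field_simp; norm_num

/-- The error term before the choice of the parameters. -/
noncomputable def smoothingError (X Y D K : ℝ) : ℝ :=
  X + Y + Y * √D + D * √X + K ^ 2 * √Y * (X + Y) / D + Y ^ 2 * √Y / (K * D)

theorem abs_smoothSum_sub_le {X Y D K : ℝ} (hY : 1 ≤ Y) (hD : 0 < D) (hDX : D ≤ X) (hK : 0 < K)
    {B : ℕ} (hB : X + D ≤ B) :
    |smoothSum X D Y ((B + 1) * 2) - 2 / Real.pi ^ 2 * transitionC (Y / X) * (X * √X)| ≤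
      121 * smoothingError X Y D K * (1 + Real.log Y) := by
  have hX : 0 < X := hD.trans_le hDX
  have hY0 : 0 < Y := by linarith
  have hsY : 0 < √Y := Real.sqrt_pos.mpr hY0
  have hn : X + D ≤ ((B + 1) * 2 : ℕ) := by push_cast; linarith
  rw [smoothSum_eq hX.le hD.le hn]
  set L := Nat.sqrt ⌊Y⌋₊ with hL
  have hLY : (L : ℝ) ^ 2 ≤ Y := by
    have : L ^ 2 ≤ ⌊Y⌋₊ := by rw [sq]; exact Nat.sqrt_le _
    exact (by exact_mod_cast this : (L : ℝ) ^ 2 ≤ ⌊Y⌋₊).trans (Nat.floor_le hY0.le)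
  have hLY' : √Y ≤ (L : ℝ) + 1 := by
    rw [Real.sqrt_le_left (by positivity)]
    have : ⌊Y⌋₊ + 1 ≤ (L + 1) ^ 2 := by rw [sq]; exact Nat.succ_le_succ_sqrt _
    exact (Nat.lt_floor_add_one Y).le.trans (by exact_mod_cast this)
  set A := X * √X * transitionC (Y / X) with hA
  set E := smoothingError X Y D K with hE
  have hE0 : 0 ≤ E := by rw [hE, smoothingError]; positivity
  have hterm : ∀ l ∈ (Finset.Icc 1 L).filter (fun l => Odd l),
      |(ArithmeticFunction.moebius l : ℝ) *
        (l * smoothCompletedSum (X / (l : ℝ) ^ 2) (D / (l : ℝ) ^ 2) (Y / (l : ℝ) ^ 2) ((B + 1) * 2)) -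
        A / 4 * ((ArithmeticFunction.moebius l : ℝ) / (l : ℝ) ^ 2)| ≤ 120 * E * (1 / (l : ℝ)) := by
    intro l hl
    obtain ⟨hl1, hl2⟩ := Finset.mem_Icc.mp (Finset.mem_filter.mp hl).1
    have hlR : (1 : ℝ) ≤ l := by exact_mod_cast hl1
    have hl0 : (0 : ℝ) < l := by linarith
    have hlL : (l : ℝ) ^ 2 ≤ Y := le_trans (by gcongr) hLY
    have hsl : 0 < √(l : ℝ) := Real.sqrt_pos.mpr hl0
    have hsl2 : √(l : ℝ) * √(l : ℝ) = l := Real.mul_self_sqrt hl0.le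
    have hsll : √(l : ℝ) ≤ l := (Real.sqrt_le_left hl0.le).mpr (by nlinarith)
    have h := abs_sum_trapezoid_mul_completedJacobi_sub_le (X := X / (l : ℝ) ^ 2) (Y := Y / (l : ℝ) ^ 2)
      (D := D / (l : ℝ) ^ 2) (K := K / √(l : ℝ)) ((one_le_div (by positivity)).mpr hlL) (by positivity)
      (by gcongr) (by positivity) (B := B) (by
        rw [← add_div]
        exact (div_le_self (by linarith) (one_le_pow₀ hlR)).trans hB)
    rw [← smoothCompletedSum] at h
    set T := smoothCompletedSum (X / (l : ℝ) ^ 2) (D / (l : ℝ) ^ 2) (Y / (l : ℝ) ^ 2) ((B + 1) * 2)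
    have hsq : ∀ x : ℝ, 0 ≤ x → √(x / (l : ℝ) ^ 2) = √x / l := fun x hx => by
      rw [Real.sqrt_div hx, Real.sqrt_sq hl0.le]
    rw [hsq X hX.le, hsq D hD.le, hsq Y hY0.le, div_div_div_cancel_right₀ (by positivity)] at h
    have e1 : (ArithmeticFunction.moebius l : ℝ) * (l * T) - A / 4 * ((ArithmeticFunction.moebius l : ℝ) / (l : ℝ) ^ 2) =
        (ArithmeticFunction.moebius l : ℝ) * (l * (T - X / (l : ℝ) ^ 2 * (√X / l) / 4 * transitionC (Y / X))) := by
      rw [hA]; field_simp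
    rw [e1, abs_mul, abs_mul, abs_of_pos hl0]
    have e2 : (l : ℝ) * (120 * (X / (l : ℝ) ^ 2 + Y / (l : ℝ) ^ 2 * (√D / l) + D / (l : ℝ) ^ 2 * (√X / l) +
        (K / √(l : ℝ)) ^ 2 * (√Y / l) * (X / (l : ℝ) ^ 2 + Y / (l : ℝ) ^ 2) / (D / (l : ℝ) ^ 2) +
        (Y / (l : ℝ) ^ 2) ^ 2 * (√Y / l) / (K / √(l : ℝ) * (D / (l : ℝ) ^ 2)))) =
        120 * (X * (1 / l) + Y * √D * (1 / l * (1 / l)) + D * √X * (1 / l * (1 / l)) +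
          K ^ 2 * √Y * (X + Y) / D * (1 / l) + Y ^ 2 * √Y / (K * D) * (√(l : ℝ) / l * (1 / l))) := by
      have e3 : (K / √(l : ℝ)) ^ 2 = K ^ 2 / l := by rw [div_pow, sq (√(l : ℝ)), hsl2]
      rw [e3]
      field_simp
    have hinv : 1 / (l : ℝ) ≤ 1 := (div_le_one hl0).mpr hlR
    have hq : √(l : ℝ) / l ≤ 1 := (div_le_one hl0).mpr hsll
    calc _ ≤ 1 * (l * (120 * (X / (l : ℝ) ^ 2 + Y / (l : ℝ) ^ 2 * (√D / l) + D / (l : ℝ) ^ 2 * (√X / l) +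
        (K / √(l : ℝ)) ^ 2 * (√Y / l) * (X / (l : ℝ) ^ 2 + Y / (l : ℝ) ^ 2) / (D / (l : ℝ) ^ 2) +
        (Y / (l : ℝ) ^ 2) ^ 2 * (√Y / l) / (K / √(l : ℝ) * (D / (l : ℝ) ^ 2))))) := by
          gcongr
          exact abs_moebius_cast_le l
      _ ≤ 120 * (X * (1 / l) + Y * √D * (1 * (1 / l)) + D * √X * (1 * (1 / l)) +
          K ^ 2 * √Y * (X + Y) / D * (1 / l) + Y ^ 2 * √Y / (K * D) * (1 * (1 / l))) := by
          rw [one_mul, e2]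
          gcongr
      _ ≤ _ := by
          rw [hE, smoothingError]
          have : 0 ≤ Y * (1 / (l : ℝ)) := by positivity
          nlinarith
  have hsum := (Finset.abs_sum_le_sum_abs _ _).trans (Finset.sum_le_sum hterm)
  rw [Finset.sum_sub_distrib, ← Finset.mul_sum, ← Finset.mul_sum] at hsum
  have hlog : ∑ l ∈ (Finset.Icc 1 L).filter (fun l => Odd l), 1 / (l : ℝ) ≤ 1 + Real.log Y := by
    refine (Finset.sum_le_sum_of_subset_of_nonneg (Finset.filter_subset _ _) fun _ _ _ => by positivity).trans
      ((sum_Icc_inv_le L).trans ?_)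
    have hL1 : 1 ≤ L := Nat.le_sqrt.mpr (by simpa using (Nat.one_le_floor_iff Y).mpr hY)
    have hL1R : (1 : ℝ) ≤ L := by exact_mod_cast hL1
    gcongr
    nlinarith
  have htail := abs_sum_oddMoebiusTerm_sub_le L
  set Q := ∑ l ∈ (Finset.Icc 1 L).filter (fun l => Odd l), (ArithmeticFunction.moebius l : ℝ) / (l : ℝ) ^ 2
  have hAb := transitionC_scaled_bound hX hY0
  rw [← hA] at hAb
  have hlast : |A / 4 * (Q - 8 / Real.pi ^ 2)| ≤ E := by
    rw [abs_mul, abs_div, abs_of_pos (by norm_num : (0 : ℝ) < 4)]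
    calc _ ≤ √Y * (X + Y) / 4 * (2 / √Y) := by
          gcongr
          exact htail.trans (by gcongr)
      _ = (X + Y) / 2 := by field_simp; ring
      _ ≤ E := by
          rw [hE, smoothingError]
          have h1 : 0 ≤ Y * √D := by positivity
          have h2 : 0 ≤ D * √X := by positivity
          have h3 : 0 ≤ K ^ 2 * √Y * (X + Y) / D := by positivity
          have h4 : 0 ≤ Y ^ 2 * √Y / (K * D) := by positivity
          linarith
  have e : ∀ S : ℝ, S - 2 / Real.pi ^ 2 * transitionC (Y / X) * (X * √X) =
      (S - A / 4 * Q) + A / 4 * (Q - 8 / Real.pi ^ 2) := by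
    intro S; rw [hA]; ring
  rw [e]
  have hlogY : 0 ≤ Real.log Y := Real.log_nonneg hY
  calc _ ≤ 120 * E * (1 + Real.log Y) + E := by
        refine (abs_add_le _ _).trans (add_le_add (hsum.trans ?_) hlast)
        gcongr
    _ ≤ _ := by nlinarith [mul_nonneg hE0 hlogY]

/-- The sum of `(m / N)` over odd `N ≤ Y`. -/
noncomputable def jacobiColumn (Y : ℝ) (m : ℕ) : ℝ :=
  ∑ N ∈ (Finset.Icc 0 ⌊Y⌋₊).filter (fun N => Odd N), (J((m : ℤ) | N) : ℝ)

theorem sum_odd_eq_sum_classes (F : ℕ → ℝ) (t : ℕ) :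
    ∑ N ∈ (Finset.range t).filter (fun N => Odd N), F N =
      ∑ b ∈ ({1, 3, 5, 7} : Finset ℕ), ∑ N ∈ (Finset.range t).filter (fun N => N % 8 = b), F N := by
  simp only [Finset.sum_filter]
  rw [Finset.sum_comm]
  refine Finset.sum_congr rfl fun N _ => ?_
  rw [Finset.sum_ite_eq]
  refine if_congr ?_ rfl rfl
  simp only [Finset.mem_insert, Finset.mem_singleton, Nat.odd_iff]
  omega

theorem jacobiColumn_eq_sum_classes (Y : ℝ) (m : ℕ) : jacobiColumn Y m =
    ∑ b ∈ ({1, 3, 5, 7} : Finset ℕ), ∑ N ∈ (Finset.range (⌊Y⌋₊ + 1)).filter (fun N => N % 8 = b),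
      (J((m : ℤ) | N) : ℝ) := by
  rw [jacobiColumn, ← Nat.range_succ_eq_Icc_zero, sum_odd_eq_sum_classes]

theorem abs_jacobiColumn_le {m : ℕ} (hm : Odd m) (hsq : ¬ IsSquare m) (Y : ℝ) :
    |jacobiColumn Y m| ≤ 4 * (√m * (1 + Real.log m)) := by
  have h2 : ¬ IsSquare (2 * m) := by
    rintro ⟨r, hr⟩
    have : Even (r * r) := by rw [← hr]; exact even_two_mul m
    have : Even r := by rcases Nat.even_mul.mp this with h | h <;> exact h
    obtain ⟨j, rfl⟩ := this
    obtain ⟨i, rfl⟩ := hm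
    have : 2 * i + 1 = 2 * (j * j) := by nlinarith
    omega
  rw [jacobiColumn_eq_sum_classes]
  refine (Finset.abs_sum_le_sum_abs _ _).trans ?_
  refine (Finset.sum_le_card_nsmul _ _ (√m * (1 + Real.log m)) fun b hb => ?_).trans (le_of_eq ?_)
  · refine abs_sum_jacobiSym_right_mod_eight_le hm.pos.ne' hsq h2 ?_ ?_ _
    · simp only [Finset.mem_insert, Finset.mem_singleton] at hb; omega
    · simp only [Finset.mem_insert, Finset.mem_singleton] at hb; rw [Nat.odd_iff]; omega
  · rw [nsmul_eq_mul]; norm_num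

theorem abs_jacobiColumn_le_self {Y : ℝ} (hY : 0 ≤ Y) (m : ℕ) : |jacobiColumn Y m| ≤ Y := by
  refine (Finset.abs_sum_le_sum_abs _ _).trans ?_
  refine (Finset.sum_le_card_nsmul _ _ 1 fun N _ => abs_jacobiSym_cast_le _ _).trans ?_
  rw [nsmul_eq_mul, mul_one]
  refine le_trans ?_ (Nat.floor_le hY)
  have : (Finset.Icc 0 ⌊Y⌋₊).filter (fun N => Odd N) ⊆ Finset.Icc 1 ⌊Y⌋₊ := fun N hN => by
    simp only [Finset.mem_filter, Finset.mem_Icc] at hN ⊢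
    exact ⟨hN.2.pos, hN.1.2⟩
  have := Finset.card_le_card this
  rw [Nat.card_Icc, Nat.add_sub_cancel] at this
  exact_mod_cast this

theorem jacobiDoubleSum_eq (X Y : ℝ) :
    jacobiDoubleSum X Y = ∑ m ∈ (Finset.Icc 1 ⌊X⌋₊).filter (fun m => Odd m), jacobiColumn Y m := by
  rw [jacobiDoubleSum]
  refine Finset.sum_congr rfl fun m _ => ?_
  rw [jacobiColumn]
  refine Finset.sum_congr ?_ fun _ _ => rfl
  ext N
  simp only [Finset.mem_filter, Finset.mem_Icc]
  exact ⟨fun h => ⟨⟨Nat.zero_le _, h.1.2⟩, h.2⟩, fun h => ⟨⟨h.2.pos, h.1.2⟩, h.2⟩⟩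

theorem trapezoid_eq_one {X D x : ℝ} (hD : 0 < D) (h1 : D ≤ x) (h2 : x ≤ X) :
    trapezoid X D x = 1 := by
  unfold trapezoid secondDiff
  simp only []
  rw [max_eq_left (by linarith), max_eq_left (by linarith), max_eq_right (by linarith), max_eq_right (by linarith)]
  field_simp
  ring

theorem trapezoid_mem_Icc {X D x : ℝ} (hD : 0 < D) (hDX : D ≤ X) (h0 : 0 ≤ x) :
    trapezoid X D x ∈ Set.Icc (0 : ℝ) 1 := by
  unfold trapezoid secondDiff
  simp only []
  rw [Set.mem_Icc, le_div_iff₀ hD, div_le_iff₀ hD, max_eq_right (by linarith : 0 - x ≤ 0)]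
  rcases max_cases (X + D - x) 0 with ⟨e1, h1⟩ | ⟨e1, h1⟩ <;> rcases max_cases (X - x) 0 with ⟨e2, h2⟩ | ⟨e2, h2⟩ <;>
    rcases max_cases (D - x) 0 with ⟨e3, h3⟩ | ⟨e3, h3⟩ <;> rw [e1, e2, e3] <;> constructor <;> linarith

theorem card_filter_isSquare_Ioc_le (a b : ℕ) :
    (((Finset.Ioc a b).filter (fun m => IsSquare m)).card) ≤ Nat.sqrt b - Nat.sqrt a := by
  have hsub : (Finset.Ioc a b).filter (fun m => IsSquare m) ⊆
      (Finset.Ioc (Nat.sqrt a) (Nat.sqrt b)).image (fun r => r * r) := by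
    intro m hm
    simp only [Finset.mem_filter, Finset.mem_Ioc] at hm
    obtain ⟨⟨h1, h2⟩, r, rfl⟩ := hm
    exact Finset.mem_image.mpr ⟨r, Finset.mem_Ioc.mpr ⟨Nat.sqrt_lt.mpr h1, Nat.le_sqrt.mpr h2⟩, rfl⟩
  refine (Finset.card_le_card hsub).trans (Finset.card_image_le.trans ?_)
  rw [Nat.card_Ioc]

theorem natSqrt_floor_le {x : ℝ} (hx : 0 ≤ x) : (Nat.sqrt ⌊x⌋₊ : ℝ) ≤ √x := by
  rw [Real.le_sqrt (Nat.cast_nonneg _) hx]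
  have : Nat.sqrt ⌊x⌋₊ ^ 2 ≤ ⌊x⌋₊ := by rw [sq]; exact Nat.sqrt_le _
  exact (by exact_mod_cast this : (Nat.sqrt ⌊x⌋₊ : ℝ) ^ 2 ≤ ⌊x⌋₊).trans (Nat.floor_le hx)

theorem sqrt_le_natSqrt_floor_add_one (x : ℝ) : √x ≤ Nat.sqrt ⌊x⌋₊ + 1 := by
  rw [Real.sqrt_le_left (by positivity)]
  have : ⌊x⌋₊ + 1 ≤ (Nat.sqrt ⌊x⌋₊ + 1) ^ 2 := by rw [sq]; exact Nat.succ_le_succ_sqrt _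
  exact (Nat.lt_floor_add_one x).le.trans (by exact_mod_cast this)

theorem sum_Ioc_abs_jacobiColumn_le {x D Y Z : ℝ} (hx : 0 ≤ x) (hD : 1 ≤ D) (hY : 0 ≤ Y) (hZ1 : 1 ≤ Z)
    (hZ : x + D ≤ Z) :
    ∑ m ∈ (Finset.Ioc ⌊x⌋₊ ⌊x + D⌋₊).filter (fun m => Odd m), |jacobiColumn Y m| ≤
      8 * D * (√Z * (1 + Real.log Z)) + 2 * (Y * √D) := by
  have hD1 : 1 ≤ √D := Real.one_le_sqrt.mpr hD
  have hlogZ : 0 ≤ Real.log Z := Real.log_nonneg hZ1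
  have h1 : ∀ m ∈ (Finset.Ioc ⌊x⌋₊ ⌊x + D⌋₊).filter (fun m => Odd m), |jacobiColumn Y m| ≤
      4 * (√Z * (1 + Real.log Z)) + if IsSquare m then Y else 0 := by
    intro m hm
    obtain ⟨hm1, hm2⟩ := Finset.mem_filter.mp hm
    have hmZ : (m : ℝ) ≤ Z :=
      ((Nat.cast_le.mpr (Finset.mem_Ioc.mp hm1).2).trans (Nat.floor_le (by linarith))).trans hZ
    have hm0 : (1 : ℝ) ≤ m := by exact_mod_cast hm2.pos
    split_ifs with hsq
    · have := abs_jacobiColumn_le_self hY m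
      have : 0 ≤ 4 * (√Z * (1 + Real.log Z)) := by positivity
      linarith
    · rw [add_zero]
      refine (abs_jacobiColumn_le hm2 hsq Y).trans ?_
      gcongr
  have hfl : ⌊x⌋₊ ≤ ⌊x + D⌋₊ := Nat.floor_le_floor (by linarith)
  have hc : (((Finset.Ioc ⌊x⌋₊ ⌊x + D⌋₊).filter (fun m => Odd m)).card : ℝ) ≤ 2 * D := by
    have h2 := Finset.card_filter_le (Finset.Ioc ⌊x⌋₊ ⌊x + D⌋₊) (fun m => Odd m)
    rw [Nat.card_Ioc] at h2
    have h3 : (((Finset.Ioc ⌊x⌋₊ ⌊x + D⌋₊).filter (fun m => Odd m)).card : ℝ) ≤ (⌊x + D⌋₊ : ℝ) - ⌊x⌋₊ := by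
      rw [← Nat.cast_sub hfl]; exact_mod_cast h2
    have h4 := Nat.floor_le (by linarith : 0 ≤ x + D)
    have h5 := Nat.lt_floor_add_one x
    linarith
  have hs : ((((Finset.Ioc ⌊x⌋₊ ⌊x + D⌋₊).filter (fun m => Odd m)).filter (fun m => IsSquare m)).card : ℝ) ≤ 2 * √D := by
    have h2 : (((Finset.Ioc ⌊x⌋₊ ⌊x + D⌋₊).filter (fun m => Odd m)).filter (fun m => IsSquare m)).card ≤
        Nat.sqrt ⌊x + D⌋₊ - Nat.sqrt ⌊x⌋₊ := by
      refine (Finset.card_le_card ?_).trans (card_filter_isSquare_Ioc_le ⌊x⌋₊ ⌊x + D⌋₊)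
      exact Finset.filter_subset_filter _ (Finset.filter_subset _ _)
    have h3 : ((((Finset.Ioc ⌊x⌋₊ ⌊x + D⌋₊).filter (fun m => Odd m)).filter (fun m => IsSquare m)).card : ℝ) ≤
        (Nat.sqrt ⌊x + D⌋₊ : ℝ) - Nat.sqrt ⌊x⌋₊ := by
      rw [← Nat.cast_sub (Nat.sqrt_le_sqrt hfl)]; exact_mod_cast h2
    have h4 := natSqrt_floor_le (by linarith : 0 ≤ x + D)
    have h5 := sqrt_le_natSqrt_floor_add_one x
    have h6 := sqrt_add_le_sqrt_add_sqrt hx (by linarith : 0 ≤ D)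
    linarith
  refine (Finset.sum_le_sum h1).trans ?_
  rw [Finset.sum_add_distrib, Finset.sum_const, ← Finset.sum_filter, Finset.sum_const, nsmul_eq_mul, nsmul_eq_mul]
  calc _ ≤ 2 * D * (4 * (√Z * (1 + Real.log Z))) + 2 * √D * Y := by gcongr
    _ = _ := by ring

theorem abs_smoothSum_sub_jacobiDoubleSum_le {X Y D : ℝ} (hY : 0 ≤ Y) (hD : 1 ≤ D) (hDX : D ≤ X) {n : ℕ}
    (hn : X + D ≤ n) :
    |smoothSum X D Y n - jacobiDoubleSum X Y| ≤ 16 * D * (√(2 * X) * (1 + Real.log (2 * X))) + 4 * (Y * √D) := by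
  have hD0 : 0 < D := by linarith
  have hX : 0 < X := by linarith
  have e1 : smoothSum X D Y n = ∑ m ∈ (Finset.range n).filter (fun m => Odd m), trapezoid X D m * jacobiColumn Y m := by
    rw [smoothSum, Finset.sum_comm]
    refine Finset.sum_congr rfl fun m _ => ?_
    rw [jacobiColumn, Finset.mul_sum]
  have e2 : jacobiDoubleSum X Y = ∑ m ∈ (Finset.range n).filter (fun m => Odd m),
      (if m ≤ ⌊X⌋₊ then 1 else 0) * jacobiColumn Y m := by
    rw [jacobiDoubleSum_eq]
    simp only [ite_mul, one_mul, zero_mul]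
    rw [← Finset.sum_filter]
    refine Finset.sum_congr ?_ fun _ _ => rfl
    ext m
    simp only [Finset.mem_filter, Finset.mem_Icc, Finset.mem_range]
    constructor
    · rintro ⟨⟨h1, h2⟩, h3⟩
      refine ⟨⟨?_, h3⟩, h2⟩
      have : (m : ℝ) < n := by
        have := (Nat.cast_le.mpr h2).trans (Nat.floor_le hX.le)
        linarith
      exact_mod_cast this
    · rintro ⟨⟨h1, h3⟩, h2⟩
      exact ⟨⟨h3.pos, h2⟩, h3⟩
  rw [e1, e2, ← Finset.sum_sub_distrib]
  have hterm : ∀ m ∈ (Finset.range n).filter (fun m => Odd m),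
      |trapezoid X D m * jacobiColumn Y m - (if m ≤ ⌊X⌋₊ then 1 else 0) * jacobiColumn Y m| ≤
      (if m ∈ Finset.Ioc ⌊(0 : ℝ)⌋₊ ⌊0 + D⌋₊ then |jacobiColumn Y m| else 0) +
      (if m ∈ Finset.Ioc ⌊X⌋₊ ⌊X + D⌋₊ then |jacobiColumn Y m| else 0) := by
    intro m hm
    have hmo := (Finset.mem_filter.mp hm).2
    have hW := trapezoid_mem_Icc hD0 hDX (Nat.cast_nonneg m : (0 : ℝ) ≤ m)
    have hA : |trapezoid X D m * jacobiColumn Y m - (if m ≤ ⌊X⌋₊ then 1 else 0) * jacobiColumn Y m| ≤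
        |jacobiColumn Y m| := by
      rw [← sub_mul, abs_mul]
      refine mul_le_of_le_one_left (abs_nonneg _) ?_
      rw [abs_le]
      split_ifs <;> constructor <;> linarith [hW.1, hW.2]
    have hn0 := abs_nonneg (jacobiColumn Y m)
    have hm0 := hmo.pos
    by_cases h1 : m ∈ Finset.Ioc ⌊(0 : ℝ)⌋₊ ⌊0 + D⌋₊
    · refine hA.trans ?_
      rw [if_pos h1]
      split_ifs <;> linarith
    · by_cases h2 : m ∈ Finset.Ioc ⌊X⌋₊ ⌊X + D⌋₊
      · refine hA.trans ?_
        rw [if_pos h2]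
        split_ifs
        linarith
      · rw [if_neg h1, if_neg h2, add_zero]
        rw [Nat.floor_zero, zero_add, Finset.mem_Ioc] at h1
        rw [Finset.mem_Ioc] at h2
        have hDm : D < m := by
          have : ⌊D⌋₊ < m := by omega
          exact (Nat.floor_lt hD0.le).mp this
        by_cases hmX : m ≤ ⌊X⌋₊
        · have : (m : ℝ) ≤ X := (Nat.cast_le.mpr hmX).trans (Nat.floor_le hX.le)
          rw [if_pos hmX, trapezoid_eq_one hD0 hDm.le this, sub_self, abs_zero]
        · have : X + D < m := by
            have : ⌊X + D⌋₊ < m := by omega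
            exact (Nat.floor_lt (by linarith)).mp this
          rw [if_neg hmX, trapezoid_eq_zero hX.le hD0.le this.le, sub_self, abs_zero]
  refine (Finset.abs_sum_le_sum_abs _ _).trans ((Finset.sum_le_sum hterm).trans ?_)
  rw [Finset.sum_add_distrib, ← Finset.sum_filter, ← Finset.sum_filter]
  have hsub : ∀ a b : ℕ, ∑ m ∈ ((Finset.range n).filter (fun m => Odd m)).filter (fun m => m ∈ Finset.Ioc a b),
      |jacobiColumn Y m| ≤ ∑ m ∈ (Finset.Ioc a b).filter (fun m => Odd m), |jacobiColumn Y m| := by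
    intro a b
    refine Finset.sum_le_sum_of_subset_of_nonneg (fun m hm => ?_) fun _ _ _ => abs_nonneg _
    simp only [Finset.mem_filter] at hm ⊢
    exact ⟨hm.2, hm.1.2⟩
  have h1 := sum_Ioc_abs_jacobiColumn_le (x := 0) (D := D) (Y := Y) (Z := 2 * X) le_rfl hD hY (by linarith) (by linarith)
  have h2 := sum_Ioc_abs_jacobiColumn_le (x := X) (D := D) (Y := Y) (Z := 2 * X) hX.le hD hY (by linarith) (by linarith)
  have h3 := hsub ⌊(0 : ℝ)⌋₊ ⌊0 + D⌋₊
  have h4 := hsub ⌊X⌋₊ ⌊X + D⌋₊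
  linarith

/-- The asymptotic formula with free parameters `D` and `K`. -/
theorem abs_jacobiDoubleSum_sub_le {X Y D K : ℝ} (hY : 1 ≤ Y) (hD : 1 ≤ D) (hDX : D ≤ X) (hK : 0 < K) :
    |jacobiDoubleSum X Y - 2 / Real.pi ^ 2 * transitionC (Y / X) * (X * √X)| ≤
      200 * smoothingError X Y D K * (1 + Real.log X + Real.log Y) := by
  have hX : 1 ≤ X := hD.trans hDX
  have hD0 : 0 < D := by linarith
  have hX0 : 0 < X := by linarith
  have hY0 : 0 < Y := by linarith
  obtain ⟨B, hB⟩ := exists_nat_ge (X + D)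
  have h1 := abs_smoothSum_sub_le hY hD0 hDX hK hB
  have h2 := abs_smoothSum_sub_jacobiDoubleSum_le hY0.le hD hDX (n := (B + 1) * 2) (by push_cast; linarith)
  have hlX := Real.log_nonneg hX
  have hlY := Real.log_nonneg hY
  have hE : Y * √D + D * √X ≤ smoothingError X Y D K := by
    rw [smoothingError]
    have h3 : 0 ≤ K ^ 2 * √Y * (X + Y) / D := by positivity
    have h4 : 0 ≤ Y ^ 2 * √Y / (K * D) := by positivity
    linarith
  have hDX0 : 0 ≤ D * √X := by positivity
  have hYD0 : 0 ≤ Y * √D := by positivity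
  set E := smoothingError X Y D K
  have hs2 : √(2 * X) ≤ 3 / 2 * √X := by
    rw [Real.sqrt_mul (by norm_num)]
    gcongr
    rw [Real.sqrt_le_left (by norm_num)]
    norm_num
  have hl2 : Real.log (2 * X) ≤ 1 + Real.log X := by
    rw [Real.log_mul (by norm_num) hX0.ne']
    linarith [Real.log_two_lt_d9]
  have hl2' : 0 ≤ Real.log (2 * X) := Real.log_nonneg (by linarith)
  have h5 : 16 * D * (√(2 * X) * (1 + Real.log (2 * X))) ≤ 24 * E * (2 + Real.log X) := by
    calc _ ≤ 16 * D * (3 / 2 * √X * (1 + (1 + Real.log X))) := by gcongr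
      _ = 24 * (D * √X) * (2 + Real.log X) := by ring
      _ ≤ _ := by gcongr; linarith
  have h6 : 4 * (Y * √D) ≤ 4 * E := by linarith
  have hE0 : 0 ≤ E := by linarith
  rw [abs_le] at h1 h2 ⊢
  constructor <;> nlinarith [h1.1, h1.2, h2.1, h2.2, mul_nonneg hE0 hlX, mul_nonneg hE0 hlY]

theorem abs_jacobiColumn_sq_sub_le {r : ℕ} (hr : Odd r) {Y : ℝ} (hY : 0 ≤ Y) :
    |jacobiColumn Y (r * r) - Y / 2 * coprimeDensity r| ≤ 5 * r := by
  set t := ⌊Y⌋₊ + 1 with ht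
  have h1 : |jacobiColumn Y (r * r) - t / 2 * coprimeDensity r| ≤ 4 * r := by
    have e : (t : ℝ) / 2 * coprimeDensity r = ∑ _b ∈ ({1, 3, 5, 7} : Finset ℕ), t / 8 * coprimeDensity r := by
      rw [Finset.sum_const, nsmul_eq_mul]; norm_num; ring
    rw [jacobiColumn_eq_sum_classes, e, ← Finset.sum_sub_distrib]
    refine (Finset.abs_sum_le_sum_abs _ _).trans ?_
    refine (Finset.sum_le_card_nsmul _ _ (r : ℝ) fun b hb => ?_).trans (le_of_eq ?_)
    · simp only [Finset.mem_insert, Finset.mem_singleton] at hb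
      refine le_trans (le_of_eq ?_) (abs_count_coprime_mod_eight_sub_le hr (b := b) (by omega) t)
      rw [Finset.sum_filter (p := fun n => r.Coprime n)]
      congr 2
      refine Finset.sum_congr rfl fun N hN => ?_
      have hNo : Odd N := by
        have := (Finset.mem_filter.mp hN).2
        rw [Nat.odd_iff]; omega
      have h := jacobiSym_two_pow_mul_sq (e := 0) (r := r) hNo
      rw [pow_zero, one_mul, sq] at h
      rw [h, pow_zero, Int.cast_one, one_mul]
    · rw [nsmul_eq_mul]; norm_num
  have h2 : |(t : ℝ) / 2 * coprimeDensity r - Y / 2 * coprimeDensity r| ≤ r := by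
    have e : (t : ℝ) / 2 * coprimeDensity r - Y / 2 * coprimeDensity r = (t - Y) / 2 * coprimeDensity r := by ring
    have h3 := Nat.floor_le hY
    have h4 := Nat.lt_floor_add_one Y
    have h5 : |((t : ℝ) - Y) / 2| ≤ 1 := by
      rw [ht, abs_le]; push_cast; constructor <;> linarith
    rw [e, abs_mul]
    calc _ ≤ 1 * (r : ℝ) := mul_le_mul h5 (abs_coprimeDensity_le r) (abs_nonneg _) zero_le_one
      _ = _ := one_mul _
  rw [abs_le] at *
  constructor <;> linarith [h1.1, h1.2, h2.1, h2.2]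

theorem sum_odd_coprimeDensity_eq (R : ℕ) :
    ∑ r ∈ (Finset.Icc 1 R).filter (fun r => Odd r), coprimeDensity r =
      ∑ d ∈ (Finset.Icc 1 R).filter (fun d => Odd d),
        (ArithmeticFunction.moebius d : ℝ) / d * ((R / d + 1) / 2 : ℕ) := by
  have h1 : ∀ r ∈ (Finset.Icc 1 R).filter (fun r => Odd r), coprimeDensity r =
      ∑ d ∈ (Finset.Icc 1 R).filter (fun d => Odd d),
        if d ∣ r then (ArithmeticFunction.moebius d : ℝ) / d else 0 := by
    intro r hr
    obtain ⟨hr1, hr2⟩ := Finset.mem_filter.mp hr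
    rw [← Finset.sum_filter, coprimeDensity]
    refine Finset.sum_congr ?_ fun _ _ => rfl
    ext d
    simp only [Nat.mem_divisors, Finset.mem_filter, Finset.mem_Icc]
    constructor
    · rintro ⟨h, -⟩
      exact ⟨⟨⟨Nat.pos_of_dvd_of_pos h hr2.pos, (Nat.le_of_dvd hr2.pos h).trans (Finset.mem_Icc.mp hr1).2⟩,
        hr2.of_dvd_nat h⟩, h⟩
    · rintro ⟨-, h⟩
      exact ⟨h, hr2.pos.ne'⟩
  have hcard : ∀ m : ℕ, ((Finset.Icc 1 m).filter (fun s => Odd s)).card = (m + 1) / 2 := by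
    intro m
    induction m with
    | zero => simp
    | succ m ih =>
      rw [← Finset.insert_Icc_right_eq_Icc_add_one (by omega), Finset.filter_insert]
      split_ifs with h
      · rw [Finset.card_insert_of_notMem (by simp), ih]
        rw [Nat.odd_iff] at h; omega
      · rw [ih]; rw [Nat.odd_iff] at h; omega
  rw [Finset.sum_congr rfl h1, Finset.sum_comm]
  refine Finset.sum_congr rfl fun d hd => ?_
  obtain ⟨hd1, hd2⟩ := Finset.mem_filter.mp hd
  have hd0 := hd2.pos
  rw [← Finset.sum_filter, Finset.sum_const, nsmul_eq_mul, mul_comm, ← hcard]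
  congr 2
  symm
  refine Finset.card_bij (fun j _ => d * j) ?_ ?_ ?_
  · intro j hj
    simp only [Finset.mem_filter, Finset.mem_Icc] at hj ⊢
    have := (Nat.le_div_iff_mul_le hd0).mp hj.1.2
    exact ⟨⟨⟨Nat.mul_pos hd0 hj.1.1, by linarith [mul_comm d j]⟩, hd2.mul hj.2⟩, Dvd.intro j rfl⟩
  · intro a _ b _ hab
    exact Nat.eq_of_mul_eq_mul_left hd0 hab
  · intro r hr
    simp only [Finset.mem_filter, Finset.mem_Icc] at hr
    obtain ⟨⟨⟨h1, h2⟩, h3⟩, j, rfl⟩ := hr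
    refine ⟨j, ?_, rfl⟩
    simp only [Finset.mem_filter, Finset.mem_Icc]
    exact ⟨⟨Nat.pos_of_mul_pos_left h1, (Nat.le_div_iff_mul_le hd0).mpr (by linarith [mul_comm d j])⟩,
      (Nat.odd_mul.mp h3).2⟩

theorem abs_sum_odd_coprimeDensity_sub_le (R : ℕ) :
    |∑ r ∈ (Finset.Icc 1 R).filter (fun r => Odd r), coprimeDensity r - 4 / Real.pi ^ 2 * R| ≤
      2 + Real.log R := by
  rw [sum_odd_coprimeDensity_eq]
  have h1 : |∑ d ∈ (Finset.Icc 1 R).filter (fun d => Odd d),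
        (ArithmeticFunction.moebius d : ℝ) / d * ((R / d + 1) / 2 : ℕ) -
      R / 2 * ∑ d ∈ (Finset.Icc 1 R).filter (fun d => Odd d), (ArithmeticFunction.moebius d : ℝ) / (d : ℝ) ^ 2| ≤
      1 + Real.log R := by
    rw [Finset.mul_sum, ← Finset.sum_sub_distrib]
    refine (Finset.abs_sum_le_sum_abs _ _).trans ((Finset.sum_le_sum fun d hd => ?_).trans
      ((Finset.sum_le_sum_of_subset_of_nonneg (Finset.filter_subset _ _) fun _ _ _ => by positivity).trans
        (sum_Icc_inv_le R)))
    have hd0 := (Finset.mem_filter.mp hd).2.pos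
    have hdR : (0 : ℝ) < d := by exact_mod_cast hd0
    have e : (ArithmeticFunction.moebius d : ℝ) / d * ((R / d + 1) / 2 : ℕ) -
        R / 2 * ((ArithmeticFunction.moebius d : ℝ) / (d : ℝ) ^ 2) =
        (ArithmeticFunction.moebius d : ℝ) * ((((R / d + 1) / 2 : ℕ) - R / d / 2) * (1 / d)) := by
      field_simp
    have h2 : |(((R / d + 1) / 2 : ℕ) : ℝ) - R / d / 2| ≤ 1 := by
      have h3 : ((R / d : ℕ) : ℝ) ≤ R / d := Nat.cast_div_le
      have h4 : (R : ℝ) / d < (R / d : ℕ) + 1 := by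
        rw [div_lt_iff₀ hdR]
        have := Nat.lt_mul_of_div_lt (Nat.lt_succ_self (R / d)) hd0
        rw [Nat.succ_eq_add_one] at this
        exact_mod_cast (by linarith [mul_comm d (R / d + 1)] : R < (R / d + 1) * d)
      have h5 : ((R / d : ℕ) : ℝ) ≤ 2 * ((R / d + 1) / 2 : ℕ) := by
        exact_mod_cast (by omega : R / d ≤ 2 * ((R / d + 1) / 2))
      have h6 : 2 * (((R / d + 1) / 2 : ℕ) : ℝ) ≤ (R / d : ℕ) + 1 := by
        exact_mod_cast (by omega : 2 * ((R / d + 1) / 2) ≤ R / d + 1)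
      rw [abs_le]; constructor <;> linarith
    rw [e, abs_mul, abs_mul, abs_of_pos (by positivity : 0 < 1 / (d : ℝ))]
    calc _ ≤ 1 * (1 * (1 / (d : ℝ))) := by
          gcongr
          exact abs_moebius_cast_le d
      _ = _ := by ring
  have h2 := abs_sum_oddMoebiusTerm_sub_le R
  set Q := ∑ d ∈ (Finset.Icc 1 R).filter (fun d => Odd d), (ArithmeticFunction.moebius d : ℝ) / (d : ℝ) ^ 2
  have h3 : |(R : ℝ) / 2 * (Q - 8 / Real.pi ^ 2)| ≤ 1 := by
    rw [abs_mul, abs_of_nonneg (by positivity : (0 : ℝ) ≤ R / 2)]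
    calc _ ≤ (R : ℝ) / 2 * (2 / (R + 1)) := by gcongr
      _ = R / (R + 1) := by field_simp
      _ ≤ 1 := (div_le_one (by positivity)).mpr (by linarith)
  have e : (R : ℝ) / 2 * (Q - 8 / Real.pi ^ 2) = R / 2 * Q - 4 / Real.pi ^ 2 * R := by ring
  rw [e] at h3
  rw [abs_le] at *
  constructor <;> linarith [h1.1, h1.2, h3.1, h3.2]

/-- The asymptotic formula for `Y` much larger than `X`. -/
theorem abs_jacobiDoubleSum_sub_linear_le {X Y : ℝ} (hX : 1 ≤ X) (hY : 1 ≤ Y) :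
    |jacobiDoubleSum X Y - 2 / Real.pi ^ 2 * (Y * √X)| ≤ (9 * (X * √X) + 2 * Y) * (1 + Real.log X) := by
  have hX0 : 0 < X := by linarith
  have hY0 : 0 < Y := by linarith
  have hlX := Real.log_nonneg hX
  have hsX : 1 ≤ √X := Real.one_le_sqrt.mpr hX
  set R := Nat.sqrt ⌊X⌋₊ with hR
  have hRX : (R : ℝ) ≤ √X := natSqrt_floor_le hX0.le
  have hRX' : √X ≤ R + 1 := sqrt_le_natSqrt_floor_add_one X
  have hR1 : 1 ≤ R := Nat.le_sqrt.mpr (by simpa using (Nat.one_le_floor_iff X).mpr hX)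
  have hR1R : (1 : ℝ) ≤ R := by exact_mod_cast hR1
  have hsq : √X * √X = X := Real.mul_self_sqrt hX0.le
  rw [jacobiDoubleSum_eq, ← Finset.sum_filter_not_add_sum_filter _ (fun m => IsSquare m)]
  have hA : |∑ m ∈ ((Finset.Icc 1 ⌊X⌋₊).filter (fun m => Odd m)).filter (fun m => ¬ IsSquare m), jacobiColumn Y m| ≤
      4 * (X * √X) * (1 + Real.log X) := by
    refine (Finset.abs_sum_le_sum_abs _ _).trans ?_
    refine (Finset.sum_le_card_nsmul _ _ (4 * (√X * (1 + Real.log X))) fun m hm => ?_).trans ?_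
    · simp only [Finset.mem_filter, Finset.mem_Icc] at hm
      refine (abs_jacobiColumn_le hm.1.2 hm.2 Y).trans ?_
      have hmX : (m : ℝ) ≤ X := (Nat.cast_le.mpr hm.1.1.2).trans (Nat.floor_le hX0.le)
      have hm0 : (0 : ℝ) < m := by exact_mod_cast hm.1.1.1
      gcongr
    · rw [nsmul_eq_mul]
      have hc : ((((Finset.Icc 1 ⌊X⌋₊).filter (fun m => Odd m)).filter (fun m => ¬ IsSquare m)).card : ℝ) ≤ X := by
        refine le_trans ?_ (Nat.floor_le hX0.le)
        have := (Finset.card_filter_le ((Finset.Icc 1 ⌊X⌋₊).filter (fun m => Odd m)) (fun m => ¬ IsSquare m)).trans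
          (Finset.card_filter_le (Finset.Icc 1 ⌊X⌋₊) (fun m => Odd m))
        rw [Nat.card_Icc, Nat.add_sub_cancel] at this
        exact_mod_cast this
      calc _ ≤ X * (4 * (√X * (1 + Real.log X))) := by gcongr
        _ = _ := by ring
  have hB : ∑ m ∈ ((Finset.Icc 1 ⌊X⌋₊).filter (fun m => Odd m)).filter (fun m => IsSquare m), jacobiColumn Y m =
      ∑ r ∈ (Finset.Icc 1 R).filter (fun r => Odd r), jacobiColumn Y (r * r) := by
    symm
    refine Finset.sum_bij (fun r _ => r * r) ?_ ?_ ?_ fun _ _ => rfl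
    · intro r hr
      simp only [Finset.mem_filter, Finset.mem_Icc] at hr ⊢
      exact ⟨⟨⟨Nat.mul_pos hr.1.1 hr.1.1, Nat.le_sqrt.mp hr.1.2⟩, hr.2.mul hr.2⟩, r, rfl⟩
    · intro a _ b _ hab
      exact Nat.mul_self_inj.mp hab
    · intro m hm
      simp only [Finset.mem_filter, Finset.mem_Icc] at hm
      obtain ⟨⟨⟨h1, h2⟩, h3⟩, r, rfl⟩ := hm
      refine ⟨r, ?_, rfl⟩
      simp only [Finset.mem_filter, Finset.mem_Icc]
      exact ⟨⟨Nat.pos_of_mul_pos_left h1, Nat.le_sqrt.mpr h2⟩, (Nat.odd_mul.mp h3).1⟩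
  have hC : |∑ r ∈ (Finset.Icc 1 R).filter (fun r => Odd r), jacobiColumn Y (r * r) -
      Y / 2 * ∑ r ∈ (Finset.Icc 1 R).filter (fun r => Odd r), coprimeDensity r| ≤ 5 * X := by
    rw [Finset.mul_sum, ← Finset.sum_sub_distrib]
    refine (Finset.abs_sum_le_sum_abs _ _).trans ?_
    refine (Finset.sum_le_card_nsmul _ _ (5 * (R : ℝ)) fun r hr => ?_).trans ?_
    · simp only [Finset.mem_filter, Finset.mem_Icc] at hr
      refine (abs_jacobiColumn_sq_sub_le hr.2 hY0.le).trans ?_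
      have : (r : ℝ) ≤ R := by exact_mod_cast hr.1.2
      linarith
    · rw [nsmul_eq_mul]
      have hc : (((Finset.Icc 1 R).filter (fun r => Odd r)).card : ℝ) ≤ R := by
        have := Finset.card_filter_le (Finset.Icc 1 R) (fun r => Odd r)
        rw [Nat.card_Icc, Nat.add_sub_cancel] at this
        exact_mod_cast this
      calc _ ≤ (R : ℝ) * (5 * R) := by gcongr
        _ ≤ √X * (5 * √X) := by gcongr
        _ = 5 * X := by linear_combination 5 * hsq
  have hD := abs_sum_odd_coprimeDensity_sub_le R
  rw [hB]
  set S1 := ∑ m ∈ ((Finset.Icc 1 ⌊X⌋₊).filter (fun m => Odd m)).filter (fun m => ¬ IsSquare m), jacobiColumn Y m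
  set S2 := ∑ r ∈ (Finset.Icc 1 R).filter (fun r => Odd r), jacobiColumn Y (r * r)
  set S3 := ∑ r ∈ (Finset.Icc 1 R).filter (fun r => Odd r), coprimeDensity r
  have hlR : Real.log R ≤ Real.log X := by
    gcongr
    nlinarith
  have hπ : 4 / Real.pi ^ 2 ≤ 1 := by
    rw [div_le_one (by positivity)]
    nlinarith [Real.pi_gt_three]
  have hπ0 : 0 < 4 / Real.pi ^ 2 := by positivity
  have hE : |S3 - 4 / Real.pi ^ 2 * √X| ≤ 3 + Real.log X := by
    rw [abs_le] at hD ⊢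
    constructor <;> nlinarith [hD.1, hD.2]
  have hF : |Y / 2 * (S3 - 4 / Real.pi ^ 2 * √X)| ≤ Y / 2 * (3 + Real.log X) := by
    rw [abs_mul, abs_of_pos (by positivity : 0 < Y / 2)]
    gcongr
  have e : S1 + S2 - 2 / Real.pi ^ 2 * (Y * √X) = S1 + (S2 - Y / 2 * S3) + Y / 2 * (S3 - 4 / Real.pi ^ 2 * √X) := by
    ring
  rw [e]
  refine (abs_add_three _ _ _).trans ((add_le_add (add_le_add hA hC) hF).trans ?_)
  have h1 : X ≤ X * √X := le_mul_of_one_le_right hX0.le hsX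
  have h2 : 0 ≤ X * √X * Real.log X := by positivity
  have h3 : 0 ≤ Y * Real.log X := by positivity
  linarith

theorem abs_transitionC_sub_self_le {α : ℝ} (hα : 0 < α) : |transitionC α - α| ≤ 2 := by
  have hπ := Real.pi_gt_three
  have hs : 0 < √α := Real.sqrt_pos.mpr hα
  rw [transitionC_eq_dual hα, add_sub_cancel_left, abs_mul, abs_of_pos (by positivity : 0 < α * √α * (2 / Real.pi))]
  calc _ ≤ α * √α * (2 / Real.pi) * (2 * (1 / α * √(1 / α))) := by
        gcongr
        exact abs_dualIntegral_le (by positivity)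
    _ = 4 / Real.pi := by rw [Real.sqrt_div zero_le_one, Real.sqrt_one]; field_simp; norm_num
    _ ≤ 2 := by rw [div_le_iff₀ (by linarith)]; linarith

theorem smoothingError_le_of_le {a b : ℝ} (hb : 1 ≤ b) (hba : b ≤ a) :
    smoothingError (a ^ 16) (b ^ 16) (a ^ 8 * b ^ 6) (a ^ 4) ≤
      10 * (a ^ 16 * b ^ 7 + b ^ 16 * a ^ 7) := by
  have ha : 1 ≤ a := hb.trans hba
  have ha0 : 0 < a := by linarith
  have hb0 : 0 < b := by linarith
  have hsD : √(a ^ 8 * b ^ 6) = a ^ 4 * b ^ 3 := by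
    rw [show a ^ 8 * b ^ 6 = (a ^ 4 * b ^ 3) ^ 2 by ring, Real.sqrt_sq (by positivity)]
  have hsX : √(a ^ 16) = a ^ 8 := by
    rw [show a ^ 16 = (a ^ 8) ^ 2 by ring, Real.sqrt_sq (by positivity)]
  have hsY : √(b ^ 16) = b ^ 8 := by
    rw [show b ^ 16 = (b ^ 8) ^ 2 by ring, Real.sqrt_sq (by positivity)]
  rw [smoothingError, hsD, hsX, hsY]
  have h1 : a ^ 16 ≤ a ^ 16 * b ^ 7 := le_mul_of_one_le_right (by positivity) (one_le_pow₀ hb)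
  have h2 : b ^ 16 ≤ b ^ 16 * a ^ 7 := le_mul_of_one_le_right (by positivity) (one_le_pow₀ ha)
  have h3 : b ^ 16 * (a ^ 4 * b ^ 3) ≤ a ^ 16 * b ^ 7 := by
    calc _ = a ^ 4 * b ^ 7 * b ^ 12 := by ring
      _ ≤ a ^ 4 * b ^ 7 * a ^ 12 := by gcongr
      _ = _ := by ring
  have h4 : a ^ 8 * b ^ 6 * a ^ 8 ≤ a ^ 16 * b ^ 7 := by
    calc _ = a ^ 16 * b ^ 6 := by ring
      _ ≤ _ := by (gcongr; norm_num)
  have h5 : (a ^ 4) ^ 2 * b ^ 8 * (a ^ 16 + b ^ 16) / (a ^ 8 * b ^ 6) ≤ 2 * (a ^ 16 * b ^ 7) := by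
    rw [show (a ^ 4) ^ 2 * b ^ 8 * (a ^ 16 + b ^ 16) / (a ^ 8 * b ^ 6) = b ^ 2 * (a ^ 16 + b ^ 16) by
      field_simp]
    calc _ ≤ b ^ 7 * (a ^ 16 + a ^ 16) := by (gcongr; norm_num)
      _ = _ := by ring
  have h6 : (b ^ 16) ^ 2 * b ^ 8 / (a ^ 4 * (a ^ 8 * b ^ 6)) ≤ a ^ 16 * b ^ 7 := by
    rw [div_le_iff₀ (by positivity)]
    calc _ = b ^ 13 * b ^ 27 := by ring
      _ ≤ b ^ 13 * a ^ 27 := by gcongr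
      _ ≤ b ^ 13 * a ^ 28 := by (gcongr; norm_num)
      _ = _ := by ring
  have h7 : 0 ≤ b ^ 16 * a ^ 7 := by positivity
  have h8 : 0 ≤ a ^ 16 * b ^ 7 := by positivity
  linarith

theorem smoothingError_le_of_ge {a b : ℝ} (ha : 1 ≤ a) (hab : a ≤ b) (hba : b ^ 8 ≤ a ^ 9) :
    smoothingError (a ^ 16) (b ^ 16) (a ^ 14) (a ^ 6) ≤
      10 * (a ^ 16 * b ^ 7 + b ^ 16 * a ^ 7) := by
  have hb : 1 ≤ b := ha.trans hab
  have ha0 : 0 < a := by linarith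
  have hb0 : 0 < b := by linarith
  have hsD : √(a ^ 14) = a ^ 7 := by
    rw [show a ^ 14 = (a ^ 7) ^ 2 by ring, Real.sqrt_sq (by positivity)]
  have hsX : √(a ^ 16) = a ^ 8 := by
    rw [show a ^ 16 = (a ^ 8) ^ 2 by ring, Real.sqrt_sq (by positivity)]
  have hsY : √(b ^ 16) = b ^ 8 := by
    rw [show b ^ 16 = (b ^ 8) ^ 2 by ring, Real.sqrt_sq (by positivity)]
  rw [smoothingError, hsD, hsX, hsY]
  have h1 : a ^ 16 ≤ a ^ 16 * b ^ 7 := le_mul_of_one_le_right (by positivity) (one_le_pow₀ hb)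
  have h2 : b ^ 16 ≤ b ^ 16 * a ^ 7 := le_mul_of_one_le_right (by positivity) (one_le_pow₀ ha)
  have h4 : a ^ 14 * a ^ 8 ≤ a ^ 16 * b ^ 7 := by
    calc _ = a ^ 16 * a ^ 6 := by ring
      _ ≤ a ^ 16 * a ^ 7 := by (gcongr; norm_num)
      _ ≤ _ := by gcongr
  have h5 : (a ^ 6) ^ 2 * b ^ 8 * (a ^ 16 + b ^ 16) / a ^ 14 ≤ 2 * (b ^ 16 * a ^ 7) := by
    rw [div_le_iff₀ (by positivity)]
    calc _ ≤ (a ^ 6) ^ 2 * a ^ 9 * (b ^ 16 + b ^ 16) := by gcongr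
      _ = 2 * (b ^ 16 * a ^ 7) * a ^ 14 := by ring
  have h6 : (b ^ 16) ^ 2 * b ^ 8 / (a ^ 6 * a ^ 14) ≤ b ^ 16 * a ^ 7 := by
    rw [div_le_iff₀ (by positivity)]
    calc _ = b ^ 16 * (b ^ 8) ^ 3 := by ring
      _ ≤ b ^ 16 * (a ^ 9) ^ 3 := by gcongr
      _ = _ := by ring
  have h7 : 0 ≤ b ^ 16 * a ^ 7 := by positivity
  have h8 : 0 ≤ a ^ 16 * b ^ 7 := by positivity
  linarith

theorem abs_jacobiDoubleSum_sub_transition_le {X Y : ℝ} (hX : 1 ≤ X) (hY : 1 ≤ Y) :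
    |jacobiDoubleSum X Y - 2 / Real.pi ^ 2 * transitionC (Y / X) * (X * √X)| ≤
      2000 * (X * Y ^ (7 / 16 : ℝ) + Y * X ^ (7 / 16 : ℝ)) * (1 + Real.log X + Real.log Y) := by
  have hlX := Real.log_nonneg hX
  have hlY := Real.log_nonneg hY
  obtain ⟨a, ha, hXa, hXa'⟩ : ∃ a : ℝ, 1 ≤ a ∧ X = a ^ 16 ∧ X ^ (7 / 16 : ℝ) = a ^ 7 := by
    refine ⟨X ^ (1 / 16 : ℝ), Real.one_le_rpow hX (by norm_num), ?_, ?_⟩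
    · rw [← Real.rpow_mul_natCast (by linarith)]; norm_num
    · rw [← Real.rpow_mul_natCast (by linarith)]; norm_num
  obtain ⟨b, hb, hYb, hYb'⟩ : ∃ b : ℝ, 1 ≤ b ∧ Y = b ^ 16 ∧ Y ^ (7 / 16 : ℝ) = b ^ 7 := by
    refine ⟨Y ^ (1 / 16 : ℝ), Real.one_le_rpow hY (by norm_num), ?_, ?_⟩
    · rw [← Real.rpow_mul_natCast (by linarith)]; norm_num
    · rw [← Real.rpow_mul_natCast (by linarith)]; norm_num
  have ha0 : 0 < a := by linarith
  have hb0 : 0 < b := by linarith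
  rw [hXa', hYb']
  have of_smoothing {D K : ℝ} (hD : 1 ≤ D) (hDX : D ≤ X) (hK : 0 < K)
      (h : smoothingError X Y D K ≤ 10 * (X * b ^ 7 + Y * a ^ 7)) :
      |jacobiDoubleSum X Y - 2 / Real.pi ^ 2 * transitionC (Y / X) * (X * √X)| ≤
        2000 * (X * b ^ 7 + Y * a ^ 7) * (1 + Real.log X + Real.log Y) :=
    (abs_jacobiDoubleSum_sub_le hY hD hDX hK).trans
      (mul_le_mul_of_nonneg_right (by linarith) (by linarith))
  rcases le_total b a with hba | hab
  · refine of_smoothing (D := a ^ 8 * b ^ 6) (K := a ^ 4) ?_ ?_ (by positivity) ?_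
    · exact one_le_mul_of_one_le_of_one_le (one_le_pow₀ ha) (one_le_pow₀ hb)
    · calc a ^ 8 * b ^ 6 ≤ a ^ 8 * a ^ 6 := by gcongr
        _ = a ^ 14 := by ring
        _ ≤ a ^ 16 := by (gcongr; norm_num)
        _ = X := hXa.symm
    · rw [hXa, hYb]
      exact smoothingError_le_of_le hb hba
  rcases le_total (b ^ 8) (a ^ 9) with h | h
  · refine of_smoothing (D := a ^ 14) (K := a ^ 6) (one_le_pow₀ ha) ?_ (by positivity) ?_
    · rw [hXa]
      gcongr
      norm_num
    · rw [hXa, hYb]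
      exact smoothingError_le_of_ge ha hab h
  have hX0 : 0 < X := by linarith
  have hY0 : 0 < Y := by linarith
  have hsX : √X = a ^ 8 := by
    rw [hXa, show a ^ 16 = (a ^ 8) ^ 2 by ring, Real.sqrt_sq (by positivity)]
  have hXX : X * √X ≤ Y * a ^ 7 := by
    rw [hsX, hXa, hYb]
    calc a ^ 16 * a ^ 8 ≤ a ^ 16 * a ^ 9 := by (gcongr; norm_num)
      _ = (a ^ 9) * (a ^ 9 * a ^ 7) := by ring
      _ ≤ b ^ 8 * (b ^ 8 * a ^ 7) := by gcongr
      _ = _ := by ring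
  have hYY : Y ≤ Y * a ^ 7 := le_mul_of_one_le_right hY0.le (one_le_pow₀ ha)
  have hπ : 2 / Real.pi ^ 2 ≤ 1 := by
    rw [div_le_one (by positivity)]
    nlinarith [Real.pi_gt_three]
  have h1 := abs_jacobiDoubleSum_sub_linear_le hX hY
  have h2 := abs_transitionC_sub_self_le (div_pos hY0 hX0)
  have h3 : |2 / Real.pi ^ 2 * (Y * √X) - 2 / Real.pi ^ 2 * transitionC (Y / X) * (X * √X)| ≤
      2 * (X * √X) := by
    have : 2 / Real.pi ^ 2 * (Y * √X) - 2 / Real.pi ^ 2 * transitionC (Y / X) * (X * √X) =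
        -(2 / Real.pi ^ 2 * (X * √X) * (transitionC (Y / X) - Y / X)) := by
      field_simp
      ring
    rw [this, abs_neg, abs_mul, abs_of_nonneg (by positivity)]
    calc _ ≤ 1 * (X * √X) * 2 := by gcongr
      _ = _ := by ring
  have hP : 0 ≤ X * b ^ 7 := by positivity
  have hXX0 : 0 ≤ X * √X := by positivity
  have hL : 1 ≤ 1 + Real.log X + Real.log Y := by linarith
  calc _ ≤ (9 * (X * √X) + 2 * Y) * (1 + Real.log X) + 2 * (X * √X) :=
        (abs_sub_le _ _ _).trans (add_le_add h1 h3)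
    _ ≤ (9 * (X * √X) + 2 * Y) * (1 + Real.log X + Real.log Y) +
        2 * (X * √X) * (1 + Real.log X + Real.log Y) := by
      refine add_le_add (mul_le_mul_of_nonneg_left (by linarith) (by linarith)) ?_
      exact le_mul_of_one_le_right (by linarith) hL
    _ = (11 * (X * √X) + 2 * Y) * (1 + Real.log X + Real.log Y) := by ring
    _ ≤ _ := mul_le_mul_of_nonneg_right (by linarith) (by linarith)

theorem one_add_log_add_log_le {X Y : ℝ} (hX : 3 ≤ X) (hY : 3 ≤ Y) :
    1 + Real.log X + Real.log Y ≤ 2 * Real.log (X * Y) := by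
  have h : 1 ≤ Real.log X := by
    rw [Real.le_log_iff_exp_le (by linarith)]
    linarith [Real.exp_one_lt_d9]
  have h' := Real.log_nonneg (show 1 ≤ Y by linarith)
  rw [Real.log_mul (by linarith) (by linarith)]
  linarith

theorem theorem1 :
    -- the integrals and the series that define `C(α)` exist
    (∀ α : ℝ, 0 ≤ α →
      (∀ k : ℕ, 1 ≤ k →
        IntervalIntegrable (transitionIntegrand k) MeasureTheory.volume 0 α) ∧
      Summable (fun k : ℕ => transitionTerm α (k + 1))) ∧
    -- the asymptotic formula, uniformly for all large `X` and `Y`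
    (∃ K Z : ℝ, ∀ X Y : ℝ, Z ≤ X → Z ≤ Y →
      |jacobiDoubleSum X Y
          - 2 / Real.pi ^ 2 * transitionC (Y / X) * X ^ (3 / 2 : ℝ)| ≤
        K * ((X * Y ^ (7 / 16 : ℝ) + Y * X ^ (7 / 16 : ℝ)) * Real.log (X * Y))) ∧
    -- the alternate expression for `C(α)`
    (∀ α : ℝ, 0 < α →
      (∀ k : ℕ, 1 ≤ k →
        IntervalIntegrable (dualIntegrand k) MeasureTheory.volume 0 (1 / α)) ∧
      Summable (fun k : ℕ => dualTerm α (k + 1)) ∧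
      transitionC α =
        α + α ^ (3 / 2 : ℝ) * (2 / Real.pi) * ∑' k : ℕ, dualTerm α (k + 1)) := by
  refine ⟨fun α _ => ⟨fun k _ => intervalIntegrable_transitionIntegrand k 0 α,
    (hasSum_transitionTerm α).summable⟩, ⟨4000, 3, fun X Y hX hY => ?_⟩, fun α hα =>
    ⟨fun k _ => intervalIntegrable_dualIntegrand k 0 (1 / α), (hasSum_dualTerm α).summable, ?_⟩⟩
  · have hX0 : 0 < X := by linarith
    have hY0 : 0 < Y := by linarith
    rw [rpow_three_halves hX0.le]
    calc _ ≤ _ := abs_jacobiDoubleSum_sub_transition_le (by linarith) (by linarith)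
      _ ≤ 2000 * (X * Y ^ (7 / 16 : ℝ) + Y * X ^ (7 / 16 : ℝ)) * (2 * Real.log (X * Y)) :=
        mul_le_mul_of_nonneg_left (one_add_log_add_log_le hX hY) (by positivity)
      _ = _ := by ring
  · rw [(hasSum_dualTerm α).tsum_eq, rpow_three_halves hα.le]
    exact transitionC_eq_dual hα
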